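/- Let $U,V\subset\mathbb R^3$ be open connected sets and let $\Phi\in C^\infty(U\times V)$ be real-valued. For $y\in V$ put $S_y=\{x\in U:\Phi(x,y)=0\}$, and for $x\in U$ put $T_x=\{y\in V:\Phi(x,y)=0\}$. Assume: (DF1) $\Phi'_x(x,y)\neq0$ and $\Phi'_y(x,y)\neq0$ whenever $\Phi(x,y)=0$; (DF2) for each $x\in U$ and each unit vector $\alpha$ there is $y\in T_x$ with $\alpha=\pm\Phi'_x(x,y)/|\Phi'_x(x,y)|$; (DF3) for each $y\in V$ and all $x\ne z$ in $S_y$ the vectors $\Phi'_y(x,y)$ and $\Phi'_y(z,y)$ are not parallel; (DF4) whenever $\Phi(x,y)=0$, the $2\times2$ matrix of the mixed second derivatives of $\Phi$ at $(x,y)$, taken along a basis of the tangent plane of $S_y$ at $x$ and a basis of the tangent plane of $T_x$ at $y$, has non-zero determinant. Let $b\in C^\infty(U\times V)$ be real-valued and non-vanishing, and let $$(\mathcal Rf)(y)=\int_{S_y}b(x,y)f(x)\,dx,\qquad y\in V,$$ where $dx$ is the area element on $S_y$. Let $D_1,\dots,D_m\subset U$ be bounded domains and $S=\bigcup_j\partial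 D_j$. Let $x_0\in S\cap U$ and $y_0\in V$ be such that, near $x_0$, $S$ is a smooth surface, and $S_{y_0}$ passes through $x_0$ and is tangent to $S$ there. Let $n$ be a smooth unit normal field on $S$ near $x_0$. For $z\in S$ near $x_0$ and a surface $S_y$ tangent to $S$ at $z$, let $N(z)=\mathrm{II}_{S_y}(z)-\mathrm{II}_S(z)$ be the difference of the second fundamental forms, both taken with respect to $n(z)$ (so that for a graph over the tangent plane, with heights measured along $n(z)$, $\mathrm{II}(z)$ is the Hessian of the graph function at $z$), written as a matrix in an orthonormal basis of $T_zS$. Suppose that $N(x_0)$, formed with $y=y_0$, is negative definite. Then there are neighborhoods $B$ and $W$ of $x_0$, a neighborhood $V_1\subset V$ of $y_0$, and $\delta>0$ such that: (i) For all $z\in S\cap W$ and $|p|<\delta$ there is exactly one $y=\overline y(z,p)\in V_1$ such that $z+p\,n(z)\in S_y$ and $n(z)$ is normal to $S_y$ at $z+p\,n(z)$; the function $\overline y$ is smooth, and $\overline y(x_0,0)=y_0$. (ii) Let $f=\sum_{j=1}^m\chi_{D_j}f_j$, where each real-valued $f_j$ is $C^\infty$ in an open set containing $\overline{D_j}$,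 and suppose that $\mathrm{supp} f\subset B$. Then for $z\in S\cap W$ the jump $$f_0(z)=\lim_{\varepsilon\to0^+}\bigl(f(z+\varepsilon n(z))-f(z-\varepsilon n(z))\bigr)$$ exists, for $z\in S\cap W$ and $|p|<\delta$ the integral that defines $g(\overline y(z,p))$, $g=\mathcal Rf$, converges absolutely, and there are smooth functions $G,G_1$ of $(z,p)\in(S\cap W)\times(-\delta,\delta)$ such that, with $p_+=\max(p,0)$, $$g(\overline y(z,p))=p_+\,G(z,p)+G_1(z,p),\qquad z\in S\cap W,\ |p|<\delta,$$ and $$G(z,0)=f_0(z)\,b(z,\overline y(z,0))\,\frac{2\pi}{\sqrt{\det N(z)}},\qquad z\in S\cap W,$$ where $N(z)$, formed with $y=\overline y(z,0)$, is negative definite. -/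

import Mathlib

open Set Filter Topology MeasureTheory
open scoped ContDiff

noncomputable section

namespace GRT

/-- Three-dimensional Euclidean space. -/
abbrev Space : Type := EuclideanSpace ℝ (Fin 3)

/-- The surface `S_y = {x ∈ U : Φ(x, y) = 0}`. -/
def surface (U : Set Space) (Φ : Space → Space → ℝ) (y : Space) : Set Space :=
  {x | x ∈ U ∧ Φ x y = 0}

/-- The partial gradient `Φ'_x(x, y)`. -/
def gradX (Φ : Space → Space → ℝ) (x y : Space) : Space :=
  gradient (fun x' => Φ x' y) x

/-- The partial gradient `Φ'_y(x, y)`. -/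
def gradY (Φ : Space → Space → ℝ) (x y : Space) : Space :=
  gradient (fun y' => Φ x y') y

/-- The mixed second derivative of `Φ` at `(x, y)`, in the direction `u` for the first variable
and in the direction `v` for the second one. -/
def mixedDeriv (Φ : Space → Space → ℝ) (x y u v : Space) : ℝ :=
  fderiv ℝ (fun y' => fderiv ℝ (fun x' => Φ x' y') x u) y v

/-- The unit vector field `∇ρ / |∇ρ|`, normal to the level sets of `ρ`. -/
def unitNormal (ρ : Space → ℝ) (x : Space) : Space :=
  ‖gradient ρ x‖⁻¹ • gradient ρ x

/-- `Φ` is a smooth function on `U × V` with the properties DF1-DF4. -/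
structure IsDefiningFunction (U V : Set Space) (Φ : Space → Space → ℝ) : Prop where
  smooth : ContDiffOn ℝ ∞ (Function.uncurry Φ) (U ×ˢ V)
  /-- DF1: both partial gradients do not vanish on the incidence relation. -/
  nondegenerate : ∀ x ∈ U, ∀ y ∈ V, Φ x y = 0 → gradX Φ x y ≠ 0 ∧ gradY Φ x y ≠ 0
  /-- DF2: for each point `x`, every direction is normal to some surface through `x`. -/
  complete : ∀ x ∈ U, ∀ α : Space, ‖α‖ = 1 → ∃ y ∈ V, Φ x y = 0 ∧
    (unitNormal (fun x' => Φ x' y) x = α ∨ -unitNormal (fun x' => Φ x' y) x = α)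
  /-- DF3: no conjugate points. -/
  noConjugate : ∀ y ∈ V, ∀ x ∈ surface U Φ y, ∀ z ∈ surface U Φ y, x ≠ z →
    LinearIndependent ℝ ![gradY Φ x y, gradY Φ z y]
  /-- DF4: the mixed Hessian, taken along bases of the tangent planes of `S_y` at `x` and of
  `T_x = {y : Φ(x, y) = 0}` at `y`, is nondegenerate. -/
  bolker : ∀ x ∈ U, ∀ y ∈ V, Φ x y = 0 → ∀ u v : Fin 2 → Space,
    LinearIndependent ℝ u → (∀ i, inner ℝ (gradX Φ x y) (u i) = 0) →
    LinearIndependent ℝ v → (∀ j, inner ℝ (gradY Φ x y) (v j) = 0) →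
    (Matrix.of fun i j => mixedDeriv Φ x y (u i) (v j)).det ≠ 0

/-- In the open neighborhood `O` of `x₀`, the set `S` is the smooth surface `{ρ = 0}`, where `ρ` is
smooth with non-vanishing gradient. The choice of the sign of `ρ` is the choice of the unit normal
field `unitNormal ρ` of `S` near `x₀`. -/
structure IsLocalEquation (S : Set Space) (x₀ : Space) (O : Set Space) (ρ : Space → ℝ) :
    Prop where
  isOpen : IsOpen O
  mem : x₀ ∈ O
  smooth : ContDiffOn ℝ ∞ ρ O
  gradient_ne_zero : ∀ x ∈ O, gradient ρ x ≠ 0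
  inter_eq : S ∩ O = {x | x ∈ O ∧ ρ x = 0}

/-- The point `x` lies on `S_y`, and the (nonzero) vector `ν` is normal to `S_y` at `x`. -/
def IsNormalAt (U : Set Space) (Φ : Space → Space → ℝ) (y x ν : Space) : Prop :=
  x ∈ surface U Φ y ∧ ∃ l : ℝ, gradX Φ x y = l • ν

/-- The second fundamental form `II(u, v) = -⟨dn(u), v⟩` at `x` of the level surface of `ρ` through
`x`, for tangent vectors `u`, `v`. Here `n` is that one of the two unit normal fields `±∇ρ/|∇ρ|`
which points at `x` to the same side as `ν`. If the surface is written near `x` as the graph of a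
function over its tangent plane, with heights measured along `n(x)`, then this is the Hessian of
this function. -/
def secondFundamentalForm (ρ : Space → ℝ) (ν x u v : Space) : ℝ :=
  -inner ℝ (fderiv ℝ (fun x' => Real.sign (inner ℝ (gradient ρ x) ν) • unitNormal ρ x') x u) v

/-- The form `N(z) = II_{S_y}(z) - II_S(z)`, where `S` is given by `ρ = 0` and is tangent to `S_y`
at `z`, and both second fundamental forms are taken with respect to the unit normal
`n(z) = ∇ρ(z)/|∇ρ(z)|`. -/
def formN (Φ : Space → Space → ℝ) (ρ : Space → ℝ) (y z u v : Space) : ℝ :=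
  secondFundamentalForm (fun x => Φ x y) (unitNormal ρ z) z u v
    - secondFundamentalForm ρ (unitNormal ρ z) z u v

/-- The matrix of `N(z)` in the basis `e` of the common tangent plane. -/
def matrixN (Φ : Space → Space → ℝ) (ρ : Space → ℝ) (y z : Space) (e : Fin 2 → Space) :
    Matrix (Fin 2) (Fin 2) ℝ :=
  Matrix.of fun i j => formN Φ ρ y z (e i) (e j)

/-- The generalized Radon transform: the integral of `b(·, y) f` over `S_y` with respect to the
area (the two-dimensional Hausdorff measure, normalized to agree with Lebesgue measure on
planes). -/
def radon (U : Set Space) (Φ b : Space → Space → ℝ) (f : Space → ℝ) (y : Space) : ℝ :=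
  ∫ x in surface U Φ y, b x y * f x ∂(μHE[2] : Measure Space)

/-- The function `∑ j, χ_{D j} F j`. -/
def piecewiseFun {m : ℕ} (D : Fin m → Set Space) (F : Fin m → Space → ℝ) (x : Space) : ℝ :=
  ∑ j, (D j).indicator (F j) x

/-- The union of the boundaries of the sets `D j`. -/
def boundaryUnion {m : ℕ} (D : Fin m → Set Space) : Set Space :=
  ⋃ j, frontier (D j)

end GRT

end

/-! Along a surface `S_y` close to `S_{y₀}` the local equation `ρ` of `S` has a nondegenerate
maximum. Indeed, at a point of tangency the Hessian of `ρ` along `S_y` is `|∇ρ| N`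
(`formN_eq_hessian`), and `N` is negative definite. The Morse lemma with parameters
(`exists_morse_normal_form`, `exists_morse_chart`) gives parametrizations `X(·, y)` of `S_y` near
`x₀` with `ρ(X(u, y)) = v(y) - ‖u‖²`. In the parameter plane the part of `S_y` on the side `ρ > 0`
is therefore the disc `‖u‖² < v(y)`.

Near `x₀` and off `S` one has `f = a + c·1_{ρ > 0}` with smooth `a` and `c`, and on `S` the function
`c` is the jump of `f` (`exists_jump_decomposition`, `tendsto_jump`). By the area formula
(`setIntegral_image_area`) the transform is a smooth function of `y` plus the integral of a smooth
density `C(u, y)` over the disc (`IsMorseChart.radon_eq`). Scaling by `r = √v` writes the latter as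
`v₊ ∫_{‖w‖ < 1} C(r w, y) dw`. This last integral is even in `r`, so by Whitney's theorem on even
functions it is a smooth function `H(v, y)`, and `H(0, y) = π C(0, y)`
(`exists_contDiff_integral_disc`). Whitney's theorem itself (`exists_contDiff_comp_sq`) comes from a
cosine series in which `cos (n r)` is replaced by `κ(n² r²)`, where `κ` is smooth on the line, has
bounded derivatives and continues `cos √t`.

The map `(z, p) ↦ yb z p` comes from the implicit function theorem, whose nondegeneracy condition is
DF4 (`exists_contact`). For `z ∈ S` the point of tangency is the center of the chart, so `v(yb z 0)
= 0`, and the derivative of `v(yb z p)` in `p` at `0` is `|∇ρ(z)|` (`IsMorseChart.tangency`,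
`IsMorseChart.hasDerivAt_height`). Hence `v = p q` with `q > 0`, so that `v₊ = p₊ q` and `G = q H`.
At `p = 0` this equals `|∇ρ| π J b f₀`, where `J` is the area factor of `X(·, y)` at `0`. In the
parameter plane `N` is `-2/|∇ρ|` times the Euclidean form, so `√det N = 2/(|∇ρ| J)`, which gives the
stated constant. -/

namespace GRT

/-! ### Cutoff functions and smooth extensions -/

section Extension

variable {E F : Type*} [NormedAddCommGroup E] [NormedSpace ℝ E]
  [NormedAddCommGroup F] [NormedSpace ℝ F]

/-- A smooth cutoff function of a compact set. -/
theorem exists_smooth_cutoff [FiniteDimensional ℝ E] {K Ω : Set E} (hK : IsCompact K) (hΩ : IsOpen Ω) (h : K ⊆ Ω) :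
    ∃ χ : E → ℝ, ContDiff ℝ ∞ χ ∧ HasCompactSupport χ ∧ tsupport χ ⊆ Ω ∧
      ∃ N, IsOpen N ∧ K ⊆ N ∧ N ⊆ Ω ∧ ∀ x ∈ N, χ x = 1 := by
  obtain ⟨L, hL, hKL, hLΩ⟩ := exists_compact_between hK hΩ h
  obtain ⟨f, hf1, hf0, -⟩ := exists_contMDiffMap_one_nhds_of_subset_interior
    (modelWithCornersSelf ℝ E) (n := (⊤ : ℕ∞)) hK.isClosed hKL
  have hsupp : Function.support f ⊆ L := fun x hx => by
    by_contra hxL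
    exact hx (hf0 x hxL)
  have hts : tsupport f ⊆ L := closure_minimal hsupp hL.isClosed
  obtain ⟨N, hKN, hN, hN1⟩ := eventually_nhdsSet_iff_exists.1 hf1
  refine ⟨f, f.contMDiff.contDiff, HasCompactSupport.of_support_subset_isCompact hL hsupp,
    hts.trans hLΩ, N ∩ Ω, hKN.inter hΩ, subset_inter hN h, inter_subset_right,
    fun x hx => hN1 x hx.1⟩

/-- Multiplication by a cutoff function gives a globally smooth function. -/
theorem contDiff_smul_of_tsupport_subset {χ : E → ℝ} {f : E → F} {Ω : Set E} (hχ : ContDiff ℝ ∞ χ)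
    (hΩ : IsOpen Ω) (h : tsupport χ ⊆ Ω) (hf : ContDiffOn ℝ ∞ f Ω) :
    ContDiff ℝ ∞ (fun x => χ x • f x) := by
  rw [contDiff_iff_contDiffAt]
  intro x
  by_cases hx : x ∈ Ω
  · exact hχ.contDiffAt.smul (hf.contDiffAt (hΩ.mem_nhds hx))
  · have hx' : x ∉ tsupport χ := fun h' => hx (h h')
    have : (fun x => χ x • f x) =ᶠ[𝓝 x] fun _ => 0 := by
      filter_upwards [notMem_tsupport_iff_eventuallyEq.1 hx'] with y hy
      simp [hy]
    exact contDiffAt_const.congr_of_eventuallyEq this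

/-- A function that is smooth near a compact set agrees near this set with a globally smooth
function of compact support. -/
theorem exists_smooth_extension [FiniteDimensional ℝ E] {K Ω : Set E} (hK : IsCompact K) (hΩ : IsOpen Ω) (h : K ⊆ Ω)
    {f : E → F} (hf : ContDiffOn ℝ ∞ f Ω) :
    ∃ g : E → F, ContDiff ℝ ∞ g ∧ HasCompactSupport g ∧
      ∃ N, IsOpen N ∧ K ⊆ N ∧ N ⊆ Ω ∧ ∀ x ∈ N, g x = f x := by
  obtain ⟨χ, hχ, hχc, hχs, N, hN, hKN, hNΩ, hN1⟩ := exists_smooth_cutoff hK hΩ h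
  refine ⟨fun x => χ x • f x, contDiff_smul_of_tsupport_subset hχ hΩ hχs hf, hχc.smul_right,
    N, hN, hKN, hNΩ, fun x hx => by simp [hN1 x hx]⟩

end Extension

/-! ### Integrals depending smoothly on parameters -/

section ParametricIntegral

variable {P G F : Type*} [NormedAddCommGroup P] [NormedSpace ℝ P] [NormedAddCommGroup G]
  [NormedSpace ℝ G] [FiniteDimensional ℝ G] [MeasurableSpace G] [BorelSpace G]
  [NormedAddCommGroup F] [NormedSpace ℝ F]

/-- The integral over a bounded set of a smooth family of functions is a smooth function of the
parameter. -/
theorem contDiff_setIntegral_param {μ : Measure G} [IsLocallyFiniteMeasure μ] {f : P → G → F}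
    (hf : ContDiff ℝ ∞ (Function.uncurry f)) {s : Set G} (hs : Bornology.IsBounded s)
    (hsm : MeasurableSet s) : ContDiff ℝ ∞ (fun p => ∫ x in s, f p x ∂μ) := by
  have hK : IsCompact (closure s) := Metric.isCompact_of_isClosed_isBounded isClosed_closure
    hs.closure
  obtain ⟨χ, hχ, hχc, -, N, -, hKN, -, hN1⟩ :=
    exists_smooth_cutoff hK isOpen_univ (subset_univ _)
  have hloc : LocallyIntegrable (s.indicator (fun _ => (1 : ℝ))) μ :=
    (locallyIntegrable_const 1).indicator hsm
  have hk : IsCompact (-(tsupport χ)) := by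
    have : IsCompact (tsupport χ) := hχc
    exact this.neg
  -- The integral is the value at `0` of the convolution of the indicator of `s` with the reflected
  -- family `x ↦ χ (-x) • f p (-x)`. The cutoff supplies the compact support, uniform in `p`, and
  -- does not change the integral because it is `1` on the closure of `s`.
  have key := contDiffOn_convolution_right_with_param_comp (n := (⊤ : ℕ∞)) (μ := μ)
    (ContinuousLinearMap.lsmul ℝ ℝ : ℝ →L[ℝ] F →L[ℝ] F) (s := (univ : Set P))
    (v := fun _ => (0 : G)) contDiffOn_const (f := s.indicator (fun _ => (1 : ℝ)))
    (g := fun p x => χ (-x) • f p (-x)) isOpen_univ hk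
    (fun p x _ hx => by
      have : χ (-x) = 0 := by
        by_contra h0
        exact hx (by simpa using subset_tsupport _ h0)
      simp [this]) hloc
    (ContDiff.contDiffOn (by
      have h1 : ContDiff ℝ ∞ (fun q : P × G => χ (-q.2)) := hχ.comp contDiff_snd.neg
      have h2 : ContDiff ℝ ∞ (fun q : P × G => f q.1 (-q.2)) :=
        hf.comp (contDiff_fst.prodMk contDiff_snd.neg)
      exact h1.smul h2))
  rw [contDiffOn_univ] at key
  convert key using 2 with p
  rw [convolution_def, ← integral_indicator hsm]
  congr 1
  ext x
  by_cases hx : x ∈ s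
  · simp [hx, hN1 x (hKN (subset_closure hx))]
  · simp [hx]

theorem contDiff_intervalIntegral_param {f : P → ℝ → F}
    (hf : ContDiff ℝ ∞ (Function.uncurry f)) {a b : ℝ} (hab : a ≤ b) :
    ContDiff ℝ ∞ (fun p => ∫ x in a..b, f p x) := by
  simp_rw [intervalIntegral.integral_of_le hab]
  exact contDiff_setIntegral_param hf (Metric.isBounded_Ioc a b) measurableSet_Ioc

/-- Hadamard's lemma in one variable, with parameters. -/
theorem exists_contDiff_hadamard [CompleteSpace F] {f : P → ℝ → F}
    (hf : ContDiff ℝ ∞ (Function.uncurry f)) :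
    ∃ q : P → ℝ → F, ContDiff ℝ ∞ (Function.uncurry q) ∧
      (∀ z p, f z p = f z 0 + p • q z p) ∧ ∀ z, q z 0 = deriv (f z) 0 := by
  have hd : ∀ z, ContDiff ℝ ∞ (f z) := fun z => hf.comp (contDiff_prodMk_right z)
  have hD : ContDiff ℝ ∞ (fun r : P × ℝ => deriv (f r.1) r.2) := by
    have h1 : ContDiff ℝ ∞ (fun r : P × ℝ => fderiv ℝ (Function.uncurry f) r (0, 1)) :=
      (hf.fderiv_right (by simp)).clm_apply contDiff_const
    convert h1 using 2 with r
    have h2 : HasFDerivAt (Function.uncurry f) (fderiv ℝ (Function.uncurry f) (r.1, r.2))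
      (r.1, r.2) := ((hf.differentiable (by simp)) _).hasFDerivAt
    have h3 : HasDerivAt (fun t : ℝ => (r.1, t)) ((0 : P), (1 : ℝ)) r.2 :=
      (hasDerivAt_const _ _).prodMk (hasDerivAt_id _)
    exact (h2.comp_hasDerivAt r.2 h3).deriv
  refine ⟨fun z p => ∫ t in (0 : ℝ)..1, deriv (f z) (t * p), ?_, ?_, ?_⟩
  · refine contDiff_intervalIntegral_param (P := P × ℝ)
      (f := fun r t => deriv (f r.1) (t * r.2)) ?_ zero_le_one
    exact hD.comp (g := fun r : P × ℝ => deriv (f r.1) r.2)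
      (f := fun r : (P × ℝ) × ℝ => (r.1.1, r.2 * r.1.2)) (by fun_prop)
  · intro z p
    have h1 : ∀ t ∈ uIcc (0 : ℝ) 1, HasDerivAt (fun t => f z (t * p)) (p • deriv (f z) (t * p)) t := by
      intro t _
      have := (((hd z).differentiable (by simp)) (t * p)).hasDerivAt.scomp t
        ((hasDerivAt_id t).mul_const p)
      simpa [Function.comp_def] using this
    have h2 : Continuous fun t : ℝ => deriv (f z) (t * p) :=
      ((hd z).continuous_deriv (by simp)).comp (by fun_prop)
    have h3 := intervalIntegral.integral_eq_sub_of_hasDerivAt h1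
      ((h2.const_smul p).intervalIntegrable 0 1)
    rw [intervalIntegral.integral_smul] at h3
    rw [h3]
    simp
  · intro z
    simp

end ParametricIntegral

end GRT

namespace GRT

/-! ### A smooth function of `t` that continues `cos √t`, with bounded derivatives -/

section CosSqrt

/-- The entire function `∑ (-1)ⁿ tⁿ / (2n)!`, equal to `cos √t` for `t ≥ 0`. -/
theorem exists_contDiff_cos_sqrt :
    ∃ f : ℝ → ℝ, ContDiff ℝ ∞ f ∧ ∀ r, f (r ^ 2) = Real.cos r := by
  set c : ℕ → ℝ := fun n => (-1) ^ n / (2 * n).factorial with hc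
  set p := FormalMultilinearSeries.ofScalars ℝ c with hp
  have hfac : ∀ n : ℕ, ((2 * n).factorial : ℝ) ≠ 0 := fun n => by positivity
  have hrad : p.radius = ⊤ := by
    refine FormalMultilinearSeries.ofScalars_radius_eq_top_of_tendsto ℝ c
      (Eventually.of_forall fun n => by simp [hc, hfac]) ?_
    have h1 : ∀ n : ℕ, ‖c n.succ‖ / ‖c n‖ = ((2 * n + 1 : ℕ) : ℝ)⁻¹ * ((2 * n + 2 : ℕ) : ℝ)⁻¹ := by
      intro n
      have : (2 * n.succ).factorial = (2 * n + 2) * ((2 * n + 1) * (2 * n).factorial) := by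
        rw [show 2 * n.succ = 2 * n + 1 + 1 by omega, Nat.factorial_succ, Nat.factorial_succ]
      simp only [hc, norm_div, norm_pow, norm_neg, norm_one, one_pow, this, Nat.cast_mul,
        norm_mul, RCLike.norm_natCast]
      have h2 := hfac n
      have h3 : ((2 * n + 1 : ℕ) : ℝ) ≠ 0 := by positivity
      field_simp
    simp_rw [h1]
    have h2 : Tendsto (fun n : ℕ => ((2 * n + 1 : ℕ) : ℝ)⁻¹) atTop (𝓝 0) :=
      tendsto_inv_atTop_zero.comp (tendsto_natCast_atTop_atTop.comp
        (tendsto_atTop_mono (fun n => by simp only [id]; omega) tendsto_id))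
    have h3 : Tendsto (fun n : ℕ => ((2 * n + 2 : ℕ) : ℝ)⁻¹) atTop (𝓝 0) :=
      tendsto_inv_atTop_zero.comp (tendsto_natCast_atTop_atTop.comp
        (tendsto_atTop_mono (fun n => by simp only [id]; omega) tendsto_id))
    simpa using h2.mul h3
  have hball := p.hasFPowerSeriesOnBall (by simp [hrad])
  refine ⟨p.sum, ?_, fun r => ?_⟩
  · have h1 := hball.analyticOnNhd
    rw [hrad, Metric.eball_top] at h1
    exact contDiffOn_univ.1 h1.contDiffOn_of_completeSpace
  · have h1 := hball.hasSum (y := r ^ 2) (by simp [hrad])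
    rw [zero_add] at h1
    refine h1.unique ?_
    refine (Real.hasSum_cos r).congr_fun ?_
    intro n
    rw [hp, FormalMultilinearSeries.ofScalars_apply_eq, hc]
    simp only [smul_eq_mul]
    ring

/-- Differentiating `f (r ^ 2) = cos r` twice gives `4 t f'' + 2 f' + f = 0` at `t = r ^ 2`, and
each further differentiation in `t` adds `4` to the middle coefficient. The recursion bounds each
derivative for large `t` by the two preceding ones. -/
theorem iteratedDeriv_cos_sqrt_ode {f : ℝ → ℝ} (hf : ContDiff ℝ ∞ f)
    (hcos : ∀ r, f (r ^ 2) = Real.cos r) (k : ℕ) {t : ℝ} (ht : 0 < t) :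
    4 * t * iteratedDeriv (k + 2) f t + (4 * k + 2) * iteratedDeriv (k + 1) f t
      + iteratedDeriv k f t = 0 := by
  have hd : ∀ k t, HasDerivAt (iteratedDeriv k f) (iteratedDeriv (k + 1) f t) t := by
    intro k t
    rw [iteratedDeriv_succ]
    exact (hf.differentiable_iteratedDeriv k (by exact_mod_cast WithTop.coe_lt_top _)
      t).hasDerivAt
  induction k generalizing t with
  | zero =>
    have hr2 : ∀ r : ℝ, HasDerivAt (fun r : ℝ => r ^ 2) (2 * r) r := fun r => by
      simpa using hasDerivAt_pow 2 r
    have h1 : ∀ r : ℝ, iteratedDeriv 1 f (r ^ 2) * (2 * r) = -Real.sin r := by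
      intro r
      have h2 := (hd 0 (r ^ 2)).comp r (hr2 r)
      have h3 : iteratedDeriv 0 f ∘ (fun r => r ^ 2) = Real.cos := by
        ext r; simp [hcos]
      rw [h3] at h2
      exact h2.unique (Real.hasDerivAt_cos r)
    have h4 := ((hd 1 ((√t) ^ 2)).comp (√t) (hr2 _)).mul ((hasDerivAt_id (√t)).const_mul 2)
    have h5 : HasDerivAt (fun r => -Real.sin r) (-Real.cos (√t)) (√t) :=
      (Real.hasDerivAt_sin _).neg
    have h6 := h4.unique (h5.congr_of_eventuallyEq (Eventually.of_forall h1))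
    rw [← hcos, Real.sq_sqrt ht.le] at h6
    simp only [Function.comp_apply, Real.sq_sqrt ht.le, id] at h6
    have h7 : √t * √t = t := Real.mul_self_sqrt ht.le
    simp only [iteratedDeriv_zero, CharP.cast_eq_zero] at h6 ⊢
    linear_combination h6 - 4 * iteratedDeriv 2 f t * h7
  | succ k ih =>
    have h1 := ((((hasDerivAt_id t).const_mul 4).mul (hd (k + 2) t)).add
      ((hd (k + 1) t).const_mul (4 * (k : ℝ) + 2))).add (hd k t)
    have h2 := h1.unique ((hasDerivAt_const t (0 : ℝ)).congr_of_eventuallyEq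
      (by filter_upwards [lt_mem_nhds ht] with s hs using ih hs))
    push_cast
    simp only [id] at h2
    linear_combination h2

/-- A smooth function on the whole line with bounded derivatives, equal to `cos √t` for
`t ≥ 0`. -/
theorem exists_bounded_cos_sqrt :
    ∃ κ : ℝ → ℝ, ContDiff ℝ ∞ κ ∧ (∀ r, κ (r ^ 2) = Real.cos r) ∧
      ∀ k, ∃ C, ∀ t, ‖iteratedDeriv k κ t‖ ≤ C := by
  obtain ⟨f, hf, hcos⟩ := exists_contDiff_cos_sqrt
  have hbd : ∀ k, ∃ C, ∀ t, 1 ≤ t → |iteratedDeriv k f t| ≤ C := by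
    -- Two consecutive orders are carried along, since the recursion for order `k + 2` uses orders
    -- `k` and `k + 1`; for `t ≥ 1` one may divide by `4 t`.
    have hstep : ∀ k, (∃ C, ∀ t, 1 ≤ t → |iteratedDeriv k f t| ≤ C) ∧
        (∃ C, ∀ t, 1 ≤ t → |iteratedDeriv (k + 1) f t| ≤ C) := by
      intro k
      induction k with
      | zero =>
        have h0 : ∀ t : ℝ, 1 ≤ t → |iteratedDeriv 0 f t| ≤ 1 := fun t ht => by
          rw [iteratedDeriv_zero, ← Real.sq_sqrt (zero_le_one.trans ht), hcos]
          exact Real.abs_cos_le_one _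
        refine ⟨⟨1, h0⟩, ⟨1, fun t ht => ?_⟩⟩
        have ht0 : 0 < t := by linarith
        have h1 : deriv f t * (2 * √t) = -Real.sin (√t) := by
          have h2 : HasDerivAt f (deriv f ((√t) ^ 2)) ((√t) ^ 2) :=
            ((hf.differentiable (by simp)) _).hasDerivAt
          have h3 : HasDerivAt (fun r : ℝ => r ^ 2) (2 * √t) (√t) := by
            simpa using hasDerivAt_pow 2 (√t)
          have h4 := HasDerivAt.comp (h := fun r : ℝ => r ^ 2) (√t) h2 h3
          rw [show f ∘ (fun r => r ^ 2) = Real.cos by ext r; simp [hcos],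
            Real.sq_sqrt ht0.le] at h4
          exact h4.unique (Real.hasDerivAt_cos _)
        have hs : 1 ≤ √t := Real.one_le_sqrt.2 ht
        have h5 : |deriv f t| * (2 * √t) ≤ 1 := by
          have : |deriv f t * (2 * √t)| ≤ 1 := by
            rw [h1, abs_neg]; exact Real.abs_sin_le_one _
          rwa [abs_mul, abs_of_pos (show (0 : ℝ) < 2 * √t by linarith)] at this
        rw [zero_add, iteratedDeriv_one]
        nlinarith [abs_nonneg (deriv f t)]
      | succ k ih =>
        obtain ⟨⟨C, hC⟩, ⟨C', hC'⟩⟩ := ih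
        refine ⟨⟨C', hC'⟩, ⟨(4 * k + 2) * C' + C, fun t ht => ?_⟩⟩
        have h1 := iteratedDeriv_cos_sqrt_ode hf hcos k (show 0 < t by linarith)
        have h2 : 4 * t * iteratedDeriv (k + 2) f t =
          -((4 * k + 2) * iteratedDeriv (k + 1) f t + iteratedDeriv k f t) := by linarith
        have h3 : 4 * t * |iteratedDeriv (k + 2) f t| ≤ (4 * k + 2) * C' + C := by
          rw [← abs_of_pos (show (0 : ℝ) < 4 * t by linarith), ← abs_mul, h2, abs_neg]
          refine (abs_add_le _ _).trans (add_le_add ?_ (hC t ht))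
          rw [abs_mul, abs_of_nonneg (by positivity)]
          exact mul_le_mul_of_nonneg_left (hC' t ht) (by positivity)
        have h4 := abs_nonneg (iteratedDeriv (k + 2) f t)
        show |iteratedDeriv (k + 2) f t| ≤ _
        nlinarith
    exact fun k => (hstep k).1
  -- On the negative axis `f` grows like `cosh √|t|`. The factor is `0` for `t ≤ -2` and `1` for `t
  -- ≥ -1`, so it removes this growth without touching `t ≥ 0`.
  have hχ : ContDiff ℝ ∞ (fun t : ℝ => Real.smoothTransition (t + 2)) :=
    Real.smoothTransition.contDiff.comp (by fun_prop)
  have hκ : ContDiff ℝ ∞ (fun t => Real.smoothTransition (t + 2) * f t) := hχ.mul hf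
  refine ⟨_, hκ, fun r => ?_, fun k => ?_⟩
  · rw [Real.smoothTransition.one_of_one_le (by nlinarith [sq_nonneg r]), one_mul, hcos]
  · obtain ⟨C, hC⟩ := hbd k
    obtain ⟨C', hC'⟩ := (isCompact_Icc (a := (-2 : ℝ)) (b := 1)).exists_bound_of_continuousOn
      (hκ.continuous_iteratedDeriv k (by exact_mod_cast le_top)).continuousOn
    refine ⟨max C (max C' 0), fun t => ?_⟩
    rcases lt_or_ge t (-2) with h | h
    · have : (fun t => Real.smoothTransition (t + 2) * f t) =ᶠ[𝓝 t] fun _ => 0 := by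
        filter_upwards [gt_mem_nhds h] with s hs
        rw [Real.smoothTransition.zero_of_nonpos (by linarith), zero_mul]
      rw [this.iteratedDeriv_eq k, iteratedDeriv_fun_const_zero]
      simp
    · rcases le_or_gt t 1 with h1 | h1
      · exact (hC' t ⟨h, h1⟩).trans ((le_max_left _ _).trans (le_max_right _ _))
      · have : (fun t => Real.smoothTransition (t + 2) * f t) =ᶠ[𝓝 t] f := by
          filter_upwards [lt_mem_nhds h1] with s hs
          rw [Real.smoothTransition.one_of_one_le (by linarith), one_mul]
        rw [this.iteratedDeriv_eq k]
        exact (hC t h1.le).trans (le_max_left _ _)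

end CosSqrt

end GRT

namespace GRT

/-! ### Cosine series of smooth families and their substitution `r² = t` -/

section EvenFunctions

variable {E F : Type} [NormedAddCommGroup E] [NormedSpace ℝ E]
  [NormedAddCommGroup F] [NormedSpace ℝ F]

/-- Smooth families of functions of one real variable, of compact support with respect to all
variables, and supported in `[-1, 1]` with respect to the first one. -/
structure IsTestFamily (M : ℝ × E → F) : Prop where
  smooth : ContDiff ℝ ∞ M
  compact : HasCompactSupport M
  support : tsupport M ⊆ {p | |p.1| ≤ 1}

/-- The partial derivative in the first variable. -/
noncomputable def derivFst (M : ℝ × E → F) (p : ℝ × E) : F := fderiv ℝ M p (1, 0)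

/-- The partial derivative in the second variable. -/
noncomputable def fderivSnd (M : ℝ × E → F) (p : ℝ × E) : E →L[ℝ] F :=
  (fderiv ℝ M p).comp (ContinuousLinearMap.inr ℝ ℝ E)

/-- Both partial derivatives are fixed linear images of the total derivative, so a single closure
property serves both. -/
theorem IsTestFamily.of_fderiv {G : Type} [NormedAddCommGroup G] [NormedSpace ℝ G]
    {M : ℝ × E → F} (hM : IsTestFamily M) (L : ((ℝ × E) →L[ℝ] F) →L[ℝ] G) :
    IsTestFamily (fun p => L (fderiv ℝ M p)) := by
  refine ⟨L.contDiff.comp (hM.smooth.fderiv_right (by simp)),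
    (hM.compact.fderiv (𝕜 := ℝ)).comp_left (map_zero L), ?_⟩
  refine Subset.trans ?_ hM.support
  refine closure_minimal ?_ (isClosed_tsupport M)
  refine Subset.trans (fun p hp => ?_) (support_fderiv_subset ℝ)
  intro h0
  exact hp (by simp [h0])

theorem IsTestFamily.derivFst {M : ℝ × E → F} (hM : IsTestFamily M) :
    IsTestFamily (derivFst M) :=
  hM.of_fderiv (ContinuousLinearMap.apply ℝ F ((1, 0) : ℝ × E))

theorem IsTestFamily.fderivSnd {M : ℝ × E → F} (hM : IsTestFamily M) :
    IsTestFamily (fderivSnd M) :=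
  hM.of_fderiv ((ContinuousLinearMap.compL ℝ E (ℝ × E) F).flip (ContinuousLinearMap.inr ℝ ℝ E))

theorem IsTestFamily.neg {M : ℝ × E → F} (hM : IsTestFamily M) :
    IsTestFamily (fun p => -M p) := by
  refine ⟨hM.smooth.neg, hM.compact.comp_left neg_zero, ?_⟩
  refine Subset.trans (closure_mono fun p (hp : -M p ≠ 0) => ?_) hM.support
  exact neg_ne_zero.1 hp

theorem IsTestFamily.eq_zero {M : ℝ × E → F} (hM : IsTestFamily M) {r : ℝ} (hr : 1 < |r|)
    (y : E) : M (r, y) = 0 := by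
  by_contra h
  exact absurd (hM.support (subset_tsupport _ h)) (by simpa using hr)

theorem IsTestFamily.hasDerivAt {M : ℝ × E → F} (hM : IsTestFamily M) (r : ℝ) (y : E) :
    HasDerivAt (fun r => M (r, y)) (GRT.derivFst M (r, y)) r := by
  have h1 : HasFDerivAt M (fderiv ℝ M (r, y)) (r, y) :=
    (hM.smooth.differentiable (by simp) _).hasFDerivAt
  have h2 : HasDerivAt (fun r : ℝ => (r, y)) ((1 : ℝ), (0 : E)) r :=
    (hasDerivAt_id _).prodMk (hasDerivAt_const _ _)
  exact h1.comp_hasDerivAt r h2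

theorem IsTestFamily.hasFDerivAt {M : ℝ × E → F} (hM : IsTestFamily M) (r : ℝ) (y : E) :
    HasFDerivAt (fun y => M (r, y)) (GRT.fderivSnd M (r, y)) y := by
  have h1 : HasFDerivAt M (fderiv ℝ M (r, y)) (r, y) :=
    (hM.smooth.differentiable (by simp) _).hasFDerivAt
  exact h1.comp y (hasFDerivAt_prodMk_right r y)

/-- The Fourier cosine integral in the first variable. -/
noncomputable def cosCoeff (M : ℝ × E → F) (n : ℤ) (y : E) : F :=
  ∫ r in (-Real.pi)..Real.pi, Real.cos (n * r) • M (r, y)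

theorem IsTestFamily.exists_bound {M : ℝ × E → F} (hM : IsTestFamily M) :
    ∃ C, 0 ≤ C ∧ ∀ p, ‖M p‖ ≤ C := by
  obtain ⟨C, hC⟩ := hM.compact.exists_bound_of_continuous hM.smooth.continuous
  exact ⟨C, (norm_nonneg _).trans (hC 0), hC⟩

theorem IsTestFamily.exists_bound_cosCoeff {M : ℝ × E → F} (hM : IsTestFamily M) :
    ∃ C, 0 ≤ C ∧ ∀ n y, ‖cosCoeff M n y‖ ≤ C := by
  obtain ⟨C, hC0, hC⟩ := hM.exists_bound
  refine ⟨C * |Real.pi - -Real.pi|, by positivity, fun n y => ?_⟩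
  refine intervalIntegral.norm_integral_le_of_norm_le_const fun r _ => ?_
  rw [norm_smul]
  calc ‖Real.cos (n * r)‖ * ‖M (r, y)‖ ≤ 1 * C :=
        mul_le_mul (Real.abs_cos_le_one _) (hC _) (norm_nonneg _) zero_le_one
    _ = C := one_mul C

/-- Two integrations by parts, done at once with the antiderivative `n sin (n r) M + cos (n r) M'`.
The boundary terms vanish because the support lies in `|r| ≤ 1 < π`. -/
theorem IsTestFamily.cosCoeff_derivFst [CompleteSpace F] {M : ℝ × E → F} (hM : IsTestFamily M)
    (n : ℤ) (y : E) :
    ((n : ℝ) ^ 2) • cosCoeff M n y = -cosCoeff (GRT.derivFst (GRT.derivFst M)) n y := by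
  have h1 : ∀ r : ℝ, HasDerivAt (fun r : ℝ => ((n : ℝ) * Real.sin (n * r)) • M (r, y)
      + Real.cos (n * r) • GRT.derivFst M (r, y))
      (((n : ℝ) ^ 2) • (Real.cos (n * r) • M (r, y))
        + Real.cos (n * r) • GRT.derivFst (GRT.derivFst M) (r, y)) r := by
    intro r
    have hl : HasDerivAt (fun r : ℝ => (n : ℝ) * r) n r := by
      simpa using (hasDerivAt_id r).const_mul (n : ℝ)
    have h2 := (((hl.sin).const_mul (n : ℝ)).smul (hM.hasDerivAt r y)).add
      ((hl.cos).smul (hM.derivFst.hasDerivAt r y))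
    refine HasDerivAt.congr_deriv h2 ?_
    module
  have hpi : 1 < |Real.pi| := by
    rw [abs_of_pos Real.pi_pos]; linarith [Real.pi_gt_three]
  have hpi' : 1 < |(-Real.pi)| := by rwa [abs_neg]
  have hc : Continuous fun r : ℝ => Real.cos (n * r) • M (r, y) :=
    (Real.continuous_cos.comp (continuous_const.mul continuous_id)).smul
      (hM.smooth.continuous.comp (by fun_prop))
  have hc2 : Continuous fun r : ℝ => ((n : ℝ) ^ 2) • (Real.cos (n * r) • M (r, y)) :=
    hc.const_smul _
  have hc' : Continuous fun r : ℝ => Real.cos (n * r) • GRT.derivFst (GRT.derivFst M) (r, y) :=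
    (Real.continuous_cos.comp (continuous_const.mul continuous_id)).smul
      (hM.derivFst.derivFst.smooth.continuous.comp (by fun_prop))
  have h3 := intervalIntegral.integral_eq_sub_of_hasDerivAt (a := -Real.pi) (b := Real.pi)
    (fun r _ => h1 r) ((hc2.add hc').intervalIntegrable _ _)
  rw [intervalIntegral.integral_add (hc2.intervalIntegrable _ _)
    (hc'.intervalIntegrable _ _), intervalIntegral.integral_smul, hM.eq_zero hpi,
    hM.eq_zero hpi', hM.derivFst.eq_zero hpi, hM.derivFst.eq_zero hpi'] at h3
  simp only [smul_zero, add_zero, sub_zero] at h3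
  exact eq_neg_of_add_eq_zero_left h3

/-- Adding the bounds for the coefficients of `M` and of its second derivative controls `(1 + n²) •
cosCoeff M n`. Quadratic decay, uniform in `y`, is all that the summations below need, because each
derivative is again a series of the same kind. -/
theorem IsTestFamily.exists_bound_cosCoeff_sq [CompleteSpace F] {M : ℝ × E → F}
    (hM : IsTestFamily M) :
    ∃ C, 0 ≤ C ∧ ∀ (n : ℤ) y, ‖cosCoeff M n y‖ ≤ C * (1 + (n : ℝ) ^ 2)⁻¹ := by
  obtain ⟨C, hC0, hC⟩ := hM.exists_bound_cosCoeff
  obtain ⟨C', hC0', hC'⟩ := hM.derivFst.derivFst.exists_bound_cosCoeff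
  refine ⟨C + C', by positivity, fun n y => ?_⟩
  have h1 : (1 + (n : ℝ) ^ 2) • cosCoeff M n y
      = cosCoeff M n y - cosCoeff (GRT.derivFst (GRT.derivFst M)) n y := by
    rw [add_smul, one_smul, hM.cosCoeff_derivFst, sub_eq_add_neg]
  have h2 : (1 + (n : ℝ) ^ 2) * ‖cosCoeff M n y‖ ≤ C + C' := by
    have h3 : ‖(1 + (n : ℝ) ^ 2) • cosCoeff M n y‖ ≤ C + C' := by
      rw [h1]
      exact (norm_sub_le _ _).trans (add_le_add (hC n y) (hC' n y))
    rwa [norm_smul, Real.norm_of_nonneg (by positivity)] at h3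
  rw [← div_eq_mul_inv, le_div_iff₀ (by positivity)]
  linarith

theorem summable_inv_one_add_int_sq : Summable fun n : ℤ => (1 + (n : ℝ) ^ 2)⁻¹ := by
  refine (Real.summable_one_div_int_pow.2 one_lt_two).of_norm_bounded_eventually ?_
  filter_upwards [(Set.finite_singleton (0 : ℤ)).compl_mem_cofinite] with n hn
  have hn0 : (0 : ℝ) < (n : ℝ) ^ 2 := by
    have : (n : ℝ) ≠ 0 := by exact_mod_cast hn
    positivity
  rw [Real.norm_of_nonneg (by positivity), one_div]
  exact inv_anti₀ hn0 (by linarith)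

theorem IsTestFamily.hasFDerivAt_cosCoeff {M : ℝ × E → F} (hM : IsTestFamily M) (n : ℤ) (y : E) :
    HasFDerivAt (cosCoeff M n) (cosCoeff (GRT.fderivSnd M) n y) y := by
  obtain ⟨C, hC0, hC⟩ := hM.fderivSnd.exists_bound
  have hcos : Continuous fun r : ℝ => Real.cos (n * r) :=
    Real.continuous_cos.comp (continuous_const.mul continuous_id)
  have hc : ∀ y, Continuous fun r : ℝ => Real.cos (n * r) • M (r, y) := fun y =>
    hcos.smul (hM.smooth.continuous.comp (by fun_prop))
  have hc' : Continuous fun r : ℝ => Real.cos (n * r) • GRT.fderivSnd M (r, y) :=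
    hcos.smul (hM.fderivSnd.smooth.continuous.comp (by fun_prop))
  refine intervalIntegral.hasFDerivAt_integral_of_dominated_of_fderiv_le (bound := fun _ => C)
    univ_mem (Eventually.of_forall fun y => (hc y).aestronglyMeasurable)
    ((hc y).intervalIntegrable _ _) hc'.aestronglyMeasurable
    (Eventually.of_forall fun r _ x _ => ?_) intervalIntegrable_const
    (Eventually.of_forall fun r _ x _ => (hM.hasFDerivAt r x).const_smul _)
  rw [norm_smul]
  calc ‖Real.cos (n * r)‖ * ‖GRT.fderivSnd M (r, x)‖ ≤ 1 * C :=
        mul_le_mul (Real.abs_cos_le_one _) (hC _) (norm_nonneg _) zero_le_one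
    _ = C := one_mul C

/-- If `κ (r ^ 2) = cos r` and `M` is even in the first variable, then this is (up to the factor
`2π`) a function `H` with `H (r ^ 2, y) = M (r, y)`. -/
noncomputable def evenExt (κ : ℝ → ℝ) (M : ℝ × E → F) (q : ℝ × E) : F :=
  ∑' n : ℤ, κ ((n : ℝ) ^ 2 * q.1) • cosCoeff M n q.2

/-- Differentiating `κ(n² t)` in `t` produces a factor `n²`, and this factor is absorbed by the
coefficient: `n²` times the coefficient of `M` is the coefficient of `-∂²M/∂r²`. Thus both partial
derivatives of the series are again series of the type `evenExt`, for the pairs `(κ', -∂²M/∂r²)` and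
`(κ, ∂M/∂y)`, and term-by-term differentiation is justified by the quadratic decay. -/
theorem hasFDerivAt_evenExt [CompleteSpace F] {κ : ℝ → ℝ} (hκ : ContDiff ℝ ∞ κ)
    (hκb : ∀ k, ∃ C, ∀ t, ‖iteratedDeriv k κ t‖ ≤ C) {M : ℝ × E → F} (hM : IsTestFamily M)
    (q : ℝ × E) :
    HasFDerivAt (evenExt κ M)
      (ContinuousLinearMap.smulRightL ℝ (ℝ × E) F (ContinuousLinearMap.fst ℝ ℝ E)
          (evenExt (deriv κ) (fun p => -derivFst (derivFst M) p) q) +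
        (ContinuousLinearMap.compL ℝ (ℝ × E) E F).flip (ContinuousLinearMap.snd ℝ ℝ E)
          (evenExt κ (fderivSnd M) q)) q := by
  obtain ⟨C0, hC0⟩ := hκb 0
  obtain ⟨C1, hC1⟩ := hκb 1
  simp only [iteratedDeriv_zero, iteratedDeriv_one] at hC0 hC1
  have hM1 := hM.derivFst.derivFst.neg
  obtain ⟨B0, hB00, hB0⟩ := hM.exists_bound_cosCoeff_sq
  obtain ⟨B1, hB10, hB1⟩ := hM1.exists_bound_cosCoeff_sq
  obtain ⟨B2, hB20, hB2⟩ := hM.fderivSnd.exists_bound_cosCoeff_sq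
  set L1 := ContinuousLinearMap.smulRightL ℝ (ℝ × E) F (ContinuousLinearMap.fst ℝ ℝ E) with hL1
  set L2 := (ContinuousLinearMap.compL ℝ (ℝ × E) E F).flip (ContinuousLinearMap.snd ℝ ℝ E)
    with hL2
  have hC0' : 0 ≤ C0 := (norm_nonneg _).trans (hC0 0)
  have hC1' : 0 ≤ C1 := (norm_nonneg _).trans (hC1 0)
  -- The target is arbitrary because the estimates are applied both with values in `F` and with
  -- values in `E →L[ℝ] F`.
  have hb : ∀ {G : Type} [NormedAddCommGroup G] [NormedSpace ℝ G] (κ' : ℝ → ℝ) (M' : ℝ × E → G)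
      (C B : ℝ), (∀ t, ‖κ' t‖ ≤ C) → (∀ (n : ℤ) y, ‖cosCoeff M' n y‖ ≤ B * (1 + (n : ℝ) ^ 2)⁻¹) →
      ∀ (n : ℤ) (q : ℝ × E), ‖κ' ((n : ℝ) ^ 2 * q.1) • cosCoeff M' n q.2‖
        ≤ C * B * (1 + (n : ℝ) ^ 2)⁻¹ := by
    intro G _ _ κ' M' C B h1 h2 n q
    rw [norm_smul, mul_assoc]
    exact mul_le_mul (h1 _) (h2 n q.2) (norm_nonneg _) ((norm_nonneg _).trans (h1 0))
  have hs : ∀ {G : Type} [NormedAddCommGroup G] [NormedSpace ℝ G] [CompleteSpace G] (κ' : ℝ → ℝ)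
      (M' : ℝ × E → G)
      (C B : ℝ), (∀ t, ‖κ' t‖ ≤ C) → (∀ (n : ℤ) y, ‖cosCoeff M' n y‖ ≤ B * (1 + (n : ℝ) ^ 2)⁻¹) →
      ∀ (q : ℝ × E), Summable fun n : ℤ => κ' ((n : ℝ) ^ 2 * q.1) • cosCoeff M' n q.2 := by
    intro G _ _ _ κ' M' C B h1 h2 q
    exact (summable_inv_one_add_int_sq.mul_left (C * B)).of_norm_bounded
      fun n => hb κ' M' C B h1 h2 n q
  have hcoeff : ∀ (n : ℤ) y, ((n : ℝ) ^ 2) • cosCoeff M n y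
      = cosCoeff (fun p => -derivFst (derivFst M) p) n y := by
    intro n y
    rw [hM.cosCoeff_derivFst]
    simp [cosCoeff]
  have hterm : ∀ (n : ℤ) (q : ℝ × E), HasFDerivAt
      (fun q : ℝ × E => κ ((n : ℝ) ^ 2 * q.1) • cosCoeff M n q.2)
      (L1 (deriv κ ((n : ℝ) ^ 2 * q.1) • cosCoeff (fun p => -derivFst (derivFst M) p) n q.2)
        + L2 (κ ((n : ℝ) ^ 2 * q.1) • cosCoeff (fderivSnd M) n q.2)) q := by
    intro n q
    have h1 : HasFDerivAt (fun q : ℝ × E => (n : ℝ) ^ 2 * q.1)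
        (((n : ℝ) ^ 2) • ContinuousLinearMap.fst ℝ ℝ E) q := hasFDerivAt_fst.const_mul _
    have h2 : HasDerivAt κ (deriv κ ((n : ℝ) ^ 2 * q.1)) ((n : ℝ) ^ 2 * q.1) :=
      (hκ.differentiable (by simp) _).hasDerivAt
    have h3 := (h2.comp_hasFDerivAt q h1).smul
      ((hM.hasFDerivAt_cosCoeff n q.2).comp q hasFDerivAt_snd)
    refine h3.congr_fderiv ?_
    ext w
    · rw [← hcoeff]
      simp [hL1, hL2, smul_smul, mul_comm]
    · simp [hL1, hL2]
  have key := hasFDerivAt_tsum (𝕜 := ℝ)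
    (u := fun n : ℤ => ‖L1‖ * (C1 * B1 * (1 + (n : ℝ) ^ 2)⁻¹)
      + ‖L2‖ * (C0 * B2 * (1 + (n : ℝ) ^ 2)⁻¹))
    (((summable_inv_one_add_int_sq.mul_left _).mul_left _).add
      ((summable_inv_one_add_int_sq.mul_left _).mul_left _)) hterm
    (fun n q => (norm_add_le _ _).trans (add_le_add
      ((L1.le_opNorm _).trans (mul_le_mul_of_nonneg_left (hb _ _ _ _ hC1 hB1 n q)
        (norm_nonneg _)))
      ((L2.le_opNorm _).trans (mul_le_mul_of_nonneg_left (hb _ _ _ _ hC0 hB2 n q)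
        (norm_nonneg _)))))
    (x₀ := q) (hs κ M C0 B0 hC0 hB0 q) q
  refine key.congr_fderiv ?_
  have hs1 := hs _ _ _ _ hC1 hB1 q
  have hs2 := hs _ _ _ _ hC0 hB2 q
  rw [Summable.tsum_add (L1.summable hs1) (L2.summable hs2), ← L1.map_tsum hs1,
    ← L2.map_tsum hs2]
  rfl

/-- Induction on the order, using that the derivative is built from two series of the same type. The
target, `κ` and `M` are quantified inside the induction: the derivative in `y` takes values in `E
→L[ℝ] F`, and the derivative in `t` replaces `κ` by `κ'`. -/
theorem contDiff_evenExt_nat (k : ℕ) : ∀ {F : Type} [NormedAddCommGroup F] [NormedSpace ℝ F]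
    [CompleteSpace F] {κ : ℝ → ℝ} (_ : ContDiff ℝ ∞ κ)
    (_ : ∀ k, ∃ C, ∀ t, ‖iteratedDeriv k κ t‖ ≤ C) {M : ℝ × E → F} (_ : IsTestFamily M),
    ContDiff ℝ k (evenExt κ M) := by
  induction k with
  | zero =>
    intro F _ _ _ κ hκ hκb M hM
    rw [Nat.cast_zero, contDiff_zero]
    exact continuous_iff_continuousAt.2 fun q => (hasFDerivAt_evenExt hκ hκb hM q).continuousAt
  | succ k ih =>
    intro F _ _ _ κ hκ hκb M hM
    rw [Nat.cast_succ, contDiff_succ_iff_fderiv]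
    refine ⟨fun q => (hasFDerivAt_evenExt hκ hκb hM q).differentiableAt, by simp, ?_⟩
    have h1 : fderiv ℝ (evenExt κ M) = _ :=
      funext fun q => (hasFDerivAt_evenExt hκ hκb hM q).fderiv
    rw [h1]
    refine ((ContinuousLinearMap.contDiff _).comp (ih ?_ ?_ hM.derivFst.derivFst.neg)).add
      ((ContinuousLinearMap.contDiff _).comp (ih hκ hκb hM.fderivSnd))
    · exact (contDiff_infty_iff_deriv.1 hκ).2
    · intro k
      obtain ⟨C, hC⟩ := hκb (k + 1)
      exact ⟨C, fun t => by rw [← iteratedDeriv_succ']; exact hC t⟩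

theorem contDiff_evenExt [CompleteSpace F] {κ : ℝ → ℝ} (hκ : ContDiff ℝ ∞ κ)
    (hκb : ∀ k, ∃ C, ∀ t, ‖iteratedDeriv k κ t‖ ≤ C) {M : ℝ × E → F} (hM : IsTestFamily M) :
    ContDiff ℝ ∞ (evenExt κ M) :=
  contDiff_infty.2 fun k => contDiff_evenExt_nat k hκ hκb hM

end EvenFunctions

end GRT

namespace GRT

/-! ### Whitney's theorem on even functions -/

section EvenFunctions

variable {E : Type} [NormedAddCommGroup E] [NormedSpace ℝ E]

/-- The `2π`-periodic extension is continuous because `f (-π) = f π`, and its Fourier coefficients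
are the cosine integrals divided by `2π`, the sine integrals vanishing by parity. Summability of the
coefficients gives pointwise convergence, and the real part of the series is taken. -/
theorem hasSum_cos_of_even {f : ℝ → ℝ} (hf : Continuous f) (heven : ∀ r, f (-r) = f r)
    {c : ℤ → ℝ} (hc : ∀ n, c n = ∫ r in (-Real.pi)..Real.pi, Real.cos (n * r) * f r)
    (hs : Summable c) {r : ℝ} (hr : |r| ≤ 1) :
    HasSum (fun n : ℤ => (2 * Real.pi)⁻¹ * (c n * Real.cos (n * r))) (f r) := by
  have : Fact (0 < 2 * Real.pi) := ⟨Real.two_pi_pos⟩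
  have hpi := Real.pi_gt_three
  set fc : ℝ → ℂ := fun r => (f r : ℂ) with hfc
  have hfcc : Continuous fc := Complex.continuous_ofReal.comp hf
  set g : C(AddCircle (2 * Real.pi), ℂ) :=
    ⟨AddCircle.liftIoc (2 * Real.pi) (-Real.pi) fc, AddCircle.liftIoc_continuous
      (by rw [show -Real.pi + 2 * Real.pi = Real.pi by ring]; simp [hfc, heven])
      hfcc.continuousOn⟩ with hg
  have hexp : ∀ (n : ℤ) (x : ℝ), (fourier n (x : AddCircle (2 * Real.pi)) : ℂ)
      = Real.cos (n * x) + Real.sin (n * x) * Complex.I := by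
    intro n x
    rw [fourier_coe_apply, Complex.ofReal_cos, Complex.ofReal_sin, ← Complex.exp_mul_I]
    congr 1
    push_cast
    field_simp
  have hsin : ∀ n : ℤ, ∫ r in (-Real.pi)..Real.pi, Real.sin (n * r) * f r = 0 := by
    intro n
    have h1 := intervalIntegral.integral_comp_neg (a := -Real.pi) (b := Real.pi)
      (fun r => Real.sin (n * r) * f r)
    simp only [neg_neg, heven, mul_neg, Real.sin_neg, neg_mul,
      intervalIntegral.integral_neg] at h1
    linarith
  have hcoef : ∀ n, fourierCoeff g n = (((2 * Real.pi)⁻¹ * c n : ℝ) : ℂ) := by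
    intro n
    have h1 := fourierCoeff_liftIoc_eq (T := 2 * Real.pi) (a := -Real.pi) fc n
    change fourierCoeff (AddCircle.liftIoc (2 * Real.pi) (-Real.pi) fc) n = _
    rw [h1, fourierCoeffOn_eq_integral]
    have h2 : -Real.pi + 2 * Real.pi = Real.pi := by ring
    have h3 : -Real.pi + 2 * Real.pi - -Real.pi = 2 * Real.pi := by ring
    have h4 : ∀ x : ℝ, (fourier (-n) (x : AddCircle (-Real.pi + 2 * Real.pi - -Real.pi)) : ℂ) • fc x
        = ((Real.cos (n * x) * f x : ℝ) : ℂ) - ((Real.sin (n * x) * f x : ℝ) : ℂ) * Complex.I := by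
      intro x
      rw [h3, hexp]
      simp only [hfc, Int.cast_neg, neg_mul, Real.cos_neg, Real.sin_neg, smul_eq_mul]
      push_cast
      ring
    simp_rw [h4]
    have hc1 : Continuous fun x : ℝ => ((Real.cos (n * x) * f x : ℝ) : ℂ) :=
      Complex.continuous_ofReal.comp
        ((Real.continuous_cos.comp (continuous_const.mul continuous_id)).mul hf)
    have hc2 : Continuous fun x : ℝ => ((Real.sin (n * x) * f x : ℝ) : ℂ) :=
      Complex.continuous_ofReal.comp
        ((Real.continuous_sin.comp (continuous_const.mul continuous_id)).mul hf)
    have hc3 : Continuous fun x : ℝ => ((Real.sin (n * x) * f x : ℝ) : ℂ) * Complex.I :=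
      hc2.mul continuous_const
    rw [intervalIntegral.integral_sub (hc1.intervalIntegrable _ _)
      (hc3.intervalIntegrable _ _), intervalIntegral.integral_mul_const,
      intervalIntegral.integral_ofReal, intervalIntegral.integral_ofReal, h2, hsin, ← hc]
    rw [show Real.pi - -Real.pi = 2 * Real.pi by ring, one_div]
    simp
  have hsum : Summable (fourierCoeff g) := by
    rw [show fourierCoeff g = fun n => (((2 * Real.pi)⁻¹ * c n : ℝ) : ℂ) from funext hcoef]
    exact Complex.hasSum_ofReal.2 (hs.mul_left _).hasSum |>.summable
  have key := has_pointwise_sum_fourier_series_of_summable hsum (r : AddCircle (2 * Real.pi))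
  have hgr : g (r : AddCircle (2 * Real.pi)) = (f r : ℂ) := by
    change AddCircle.liftIoc (2 * Real.pi) (-Real.pi) fc r = _
    rw [AddCircle.liftIoc_coe_apply]
    obtain ⟨h1, h2⟩ := abs_le.1 hr
    exact ⟨by linarith, by linarith⟩
  rw [hgr] at key
  have key2 := Complex.hasSum_re key
  rw [Complex.ofReal_re] at key2
  refine key2.congr_fun fun n => ?_
  rw [hcoef, hexp, smul_eq_mul, Complex.re_ofReal_mul]
  simp only [Complex.add_re, Complex.ofReal_re, Complex.mul_re, Complex.I_re, Complex.I_im,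
    Complex.ofReal_im]
  ring

/-- Whitney's theorem on even functions, with parameters. -/
theorem exists_contDiff_comp_sq {M : ℝ × E → ℝ} (hM : IsTestFamily M)
    (heven : ∀ r y, M (-r, y) = M (r, y)) :
    ∃ H : ℝ × E → ℝ, ContDiff ℝ ∞ H ∧ ∀ r y, |r| ≤ 1 → H (r ^ 2, y) = M (r, y) := by
  obtain ⟨κ, hκ, hcos, hκb⟩ := exists_bounded_cos_sqrt
  refine ⟨fun q => (2 * Real.pi)⁻¹ * evenExt κ M q, contDiff_const.mul
    (contDiff_evenExt hκ hκb hM), fun r y hr => ?_⟩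
  obtain ⟨C, -, hC⟩ := hM.exists_bound_cosCoeff_sq
  have hs : Summable fun n => cosCoeff M n y :=
    (summable_inv_one_add_int_sq.mul_left C).of_norm_bounded fun n => hC n y
  have h1 := hasSum_cos_of_even (f := fun r => M (r, y)) (hM.smooth.continuous.comp (by fun_prop))
    (fun r => heven r y) (c := fun n => cosCoeff M n y) (fun n => rfl) hs hr
  rw [← h1.tsum_eq, tsum_mul_left]
  change (2 * Real.pi)⁻¹ * ∑' n : ℤ, κ ((n : ℝ) ^ 2 * r ^ 2) • cosCoeff M n y = _
  congr 2
  ext n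
  rw [← mul_pow, hcos, smul_eq_mul, mul_comm]

end EvenFunctions

end GRT

/-! ### Integrals over discs as functions of the squared radius -/

namespace GRT

/-- The Euclidean plane. -/
abbrev Plane : Type := EuclideanSpace ℝ (Fin 2)

variable {E : Type} [NormedAddCommGroup E] [NormedSpace ℝ E]

/-- The integral over discs of a smooth family of functions of compact support in the plane is a
smooth function of the square of the radius. -/
theorem exists_contDiff_integral_disc {C : Plane × E → ℝ} (hC : ContDiff ℝ ∞ C)
    (hCc : HasCompactSupport C) :
    ∃ H : ℝ × E → ℝ, ContDiff ℝ ∞ H ∧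
      (∀ v y, v ≤ 1 / 2 → ∫ u in {u : Plane | ‖u‖ ^ 2 < v}, C (u, y) = max v 0 * H (v, y)) ∧
      ∀ y, H (0, y) = Real.pi * C (0, y) := by
  -- This cutoff is `1` for `r² ≤ 1/2` and `0` for `|r| ≥ 1`, which makes `η A` a test family. The
  -- restriction `v ≤ 1 / 2` in the statement comes from here.
  set η : ℝ → ℝ := fun r => Real.smoothTransition (2 - 2 * r ^ 2) with hη
  have hηs : ContDiff ℝ ∞ η := Real.smoothTransition.contDiff.comp (by fun_prop)
  -- The substitution `u = r w` turns the integral over the disc of radius `r > 0` into `r² A (r,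
  -- y)`. The function `A` makes sense for every real `r`, and it is even by the reflection `w ↦
  -- -w`.
  set A : ℝ × E → ℝ := fun p => ∫ w in Metric.ball (0 : Plane) 1, C (p.1 • w, p.2) with hA
  have hAs : ContDiff ℝ ∞ A := by
    refine contDiff_setIntegral_param (f := fun (p : ℝ × E) (w : Plane) => C (p.1 • w, p.2)) ?_
      Metric.isBounded_ball measurableSet_ball
    exact hC.comp (f := fun q : (ℝ × E) × Plane => (q.1.1 • q.2, q.1.2)) (by fun_prop)
  have hAeven : ∀ r y, A (-r, y) = A (r, y) := by
    intro r y
    simp only [hA]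
    rw [← integral_indicator measurableSet_ball, ← integral_indicator measurableSet_ball,
      ← integral_neg_eq_self]
    congr 1
    ext w
    by_cases hw : w ∈ Metric.ball (0 : Plane) 1
    · rw [indicator_of_mem hw, indicator_of_mem (by simpa using hw)]
      simp
    · rw [indicator_of_notMem hw, indicator_of_notMem (by simpa using hw)]
  have hM : IsTestFamily (fun p : ℝ × E => η p.1 * A p) := by
    have hsupp : Function.support (fun p : ℝ × E => η p.1 * A p)
        ⊆ Icc (-1) 1 ×ˢ (Prod.snd '' tsupport C) := by
      intro p hp
      have hp' : η p.1 * A p ≠ 0 := hp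
      have h1 : η p.1 ≠ 0 := left_ne_zero_of_mul hp'
      have h2 : A p ≠ 0 := right_ne_zero_of_mul hp'
      constructor
      · by_contra h
        refine h1 (Real.smoothTransition.zero_of_nonpos ?_)
        have : 1 < |p.1| := by
          by_contra h3
          exact h (abs_le.1 (not_lt.1 h3))
        nlinarith [sq_abs p.1]
      · by_contra h
        refine h2 ?_
        simp only [hA]
        have : ∀ w : Plane, C (p.1 • w, p.2) = 0 := fun w => by
          by_contra h3
          exact h ⟨_, subset_tsupport _ h3, rfl⟩
        simp [this]
    have hcpt : IsCompact (Icc (-1 : ℝ) 1 ×ˢ (Prod.snd '' tsupport C)) :=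
      isCompact_Icc.prod (IsCompact.image hCc continuous_snd)
    refine ⟨(hηs.comp contDiff_fst).mul hAs,
      HasCompactSupport.of_support_subset_isCompact hcpt hsupp, ?_⟩
    refine (closure_minimal hsupp hcpt.isClosed).trans fun p hp => ?_
    exact abs_le.2 hp.1
  obtain ⟨H, hH, hH1⟩ := exists_contDiff_comp_sq hM (fun r y => by
    simp only [hAeven, hη, neg_sq])
  refine ⟨H, hH, fun v y hv => ?_, fun y => ?_⟩
  · rcases le_or_gt v 0 with h0 | h0
    · have : {u : Plane | ‖u‖ ^ 2 < v} = ∅ := by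
        ext u
        simpa using h0.trans (sq_nonneg _)
      rw [this, max_eq_right h0]
      simp
    · have hs : 0 < √v := Real.sqrt_pos.2 h0
      have hsq : √v ^ 2 = v := Real.sq_sqrt h0.le
      have h1 := hH1 (√v) y (by
        rw [abs_of_pos hs]
        exact Real.sqrt_le_one.2 (by linarith))
      have hη1 : η (√v) = 1 := by
        simp only [hη, hsq]
        exact Real.smoothTransition.one_of_one_le (by linarith)
      rw [hsq, hη1, one_mul] at h1
      rw [max_eq_left h0.le, h1]
      simp only [hA]
      rw [Measure.setIntegral_comp_smul_of_pos volume (fun u : Plane => C (u, y)) _ hs,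
        smul_unitBall_of_pos hs, finrank_euclideanSpace_fin, hsq, smul_eq_mul, ← mul_assoc,
        mul_inv_cancel₀ h0.ne', one_mul]
      congr 2
      ext u
      simp only [mem_ofPred_eq, mem_ball_zero_iff]
      rw [← Real.lt_sqrt (norm_nonneg u)]
  · have h1 := hH1 0 y (by simp)
    rw [zero_pow two_ne_zero] at h1
    rw [h1]
    have hη1 : η 0 = 1 := Real.smoothTransition.one_of_one_le (by norm_num)
    simp only [hA, hη1, zero_smul, integral_const, one_mul, smul_eq_mul]
    congr 1
    simp [Measure.real, EuclideanSpace.volume_ball_fin_two, Real.pi_pos.le]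

end GRT

namespace GRT

/-! ### The area formula for parametrized surfaces -/

section Area

open scoped NNReal ENNReal

/-- Comparison of the Hausdorff measures of two images of the same set. -/
theorem euclideanHausdorffMeasure_image_le_of_edist_le {X Y Z : Type*} [Nonempty X]
    [MetricSpace Y] [MeasurableSpace Y] [BorelSpace Y] [MetricSpace Z]
    [MeasurableSpace Z] [BorelSpace Z] {f : X → Y} {g : X → Z} {s : Set X} {K : ℝ≥0}
    (hg : InjOn g s)
    (h : ∀ x ∈ s, ∀ y ∈ s, edist (f x) (f y) ≤ K * edist (g x) (g y)) (d : ℕ) :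
    (μHE[d] : Measure Y) (f '' s) ≤ (K : ℝ≥0∞) ^ d * (μHE[d] : Measure Z) (g '' s) := by
  -- The hypothesis says that `f` factors through `g` on `s` by a `K`-Lipschitz map, and such a map
  -- multiplies the `d`-dimensional measure by at most `K ^ d`.
  have h1 : LipschitzOnWith K (f ∘ Function.invFunOn g s) (g '' s) := by
    rintro _ ⟨x, hx, rfl⟩ _ ⟨y, hy, rfl⟩
    simp only [Function.comp_apply, hg.leftInvOn_invFunOn hx, hg.leftInvOn_invFunOn hy]
    exact h x hx y hy
  have h2 : (f ∘ Function.invFunOn g s) '' (g '' s) = f '' s := by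
    rw [image_comp, hg.leftInvOn_invFunOn.image_image]
  have h3 := h1.hausdorffMeasure_image_le (d := d) (Nat.cast_nonneg d)
  rw [h2, ENNReal.rpow_natCast] at h3
  simp only [Measure.euclideanHausdorffMeasure_def, Measure.smul_apply, ENNReal.smul_def,
    smul_eq_mul]
  calc _ ≤ _ := mul_le_mul_right h3 _
    _ = _ := by ring

/-- Comparison of two countably subadditive set functions which can be compared locally. -/
theorem le_of_locally_le {α : Type*} [TopologicalSpace α] [SecondCountableTopology α]
    [MeasurableSpace α] [OpensMeasurableSpace α] {m₁ m₂ : Set α → ℝ≥0∞} {A : Set α}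
    (h₀ : m₁ ∅ = 0) (h₁ : ∀ s : ℕ → Set α, m₁ (⋃ n, s n) ≤ ∑' n, m₁ (s n))
    (h₂ : ∀ s : ℕ → Set α, (∀ n, MeasurableSet (s n)) → (∀ n, s n ⊆ A) →
      Pairwise (fun i j => Disjoint (s i) (s j)) → ∑' n, m₂ (s n) ≤ m₂ (⋃ n, s n))
    {K : ℝ≥0∞} (hloc : ∀ a ∈ A, ∃ N, IsOpen N ∧ a ∈ N ∧
      ∀ s, MeasurableSet s → s ⊆ N → s ⊆ A → m₁ s ≤ K * m₂ s)
    {s : Set α} (hs : MeasurableSet s) (hsA : s ⊆ A) : m₁ s ≤ K * m₂ s := by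
  choose! N hN haN hNle using hloc
  obtain ⟨T, hTA, hT, hcov⟩ := TopologicalSpace.countable_cover_nhdsWithin
    (s := A) (f := N) (fun a ha => mem_nhdsWithin_of_mem_nhds ((hN a ha).mem_nhds (haN a ha)))
  rcases T.eq_empty_or_nonempty with hT0 | hT0
  · have hsE : s = ∅ := subset_empty_iff.1 (hsA.trans (by simpa [hT0] using hcov))
    simp [hsE, h₀]
  · obtain ⟨t, rfl⟩ := hT.exists_eq_range hT0
    -- A countable subcover is made disjoint. Subadditivity of `m₁` and superadditivity of `m₂` on
    -- disjoint measurable pieces then sum the local inequalities.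
    set p : ℕ → Set α := fun n => s ∩ disjointed (fun n => N (t n)) n with hp
    have hsp : s = ⋃ n, p n := by
      rw [hp, ← inter_iUnion, iUnion_disjointed]
      refine (inter_eq_left.2 (hsA.trans (hcov.trans ?_))).symm
      simp
    have htA : ∀ n, t n ∈ A := fun n => hTA (mem_range_self n)
    have hpm : ∀ n, MeasurableSet (p n) := fun n =>
      hs.inter (MeasurableSet.disjointed (fun n => (hN _ (htA n)).measurableSet) n)
    have hpA : ∀ n, p n ⊆ A := fun n => inter_subset_left.trans hsA
    calc m₁ s = m₁ (⋃ n, p n) := by rw [← hsp]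
      _ ≤ ∑' n, m₁ (p n) := h₁ p
      _ ≤ ∑' n, K * m₂ (p n) := ENNReal.tsum_le_tsum fun n =>
          hNle _ (htA n) _ (hpm n) (inter_subset_right.trans (disjointed_subset _ n)) (hpA n)
      _ = K * ∑' n, m₂ (p n) := ENNReal.tsum_mul_left
      _ ≤ K * m₂ (⋃ n, p n) := mul_le_mul_right (h₂ p hpm hpA fun i j hij =>
          (disjoint_disjointed _ hij).mono inter_subset_right inter_subset_right) _
      _ = K * m₂ s := by rw [← hsp]

variable {V : Type*} [NormedAddCommGroup V] [InnerProductSpace ℝ V]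

/-- The factor by which a linear map multiplies the area. -/
noncomputable def areaFactor (L : Plane →L[ℝ] V) : ℝ := (L : Plane →ₗ[ℝ] V).normDet

/-- The Gram determinant of the images of the basis vectors. -/
noncomputable def gramDet (L : Plane →L[ℝ] V) : ℝ :=
  (Matrix.gram ℝ fun i => L (EuclideanSpace.basisFun (Fin 2) ℝ i)).det

theorem areaFactor_sq (L : Plane →L[ℝ] V) : areaFactor L ^ 2 = gramDet L :=
  LinearMap.normDet_sq_eq_det_gram _ (EuclideanSpace.basisFun (Fin 2) ℝ)

theorem areaFactor_nonneg (L : Plane →L[ℝ] V) : 0 ≤ areaFactor L := LinearMap.normDet_nonneg _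

theorem areaFactor_eq_sqrt (L : Plane →L[ℝ] V) : areaFactor L = √(gramDet L) := by
  rw [← areaFactor_sq, Real.sqrt_sq (areaFactor_nonneg L)]

theorem areaFactor_pos {L : Plane →L[ℝ] V} (hL : Function.Injective L) : 0 < areaFactor L :=
  have h : (L : Plane →ₗ[ℝ] V).normDet ≠ 0 ↔ Function.Injective L :=
    (LinearMap.normDet_ne_zero_tfae (L : Plane →ₗ[ℝ] V)).out 0 4
  lt_of_le_of_ne (areaFactor_nonneg L) (h.2 hL).symm

theorem contDiff_gramDet : ContDiff ℝ ∞ (gramDet : (Plane →L[ℝ] V) → ℝ) := by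
  unfold gramDet
  simp only [Matrix.det_fin_two, Matrix.gram_apply]
  have h : ∀ i, ContDiff ℝ ∞ fun L : Plane →L[ℝ] V => L (EuclideanSpace.basisFun (Fin 2) ℝ i) :=
    fun i => (ContinuousLinearMap.apply ℝ V (EuclideanSpace.basisFun (Fin 2) ℝ i)).contDiff
  exact (((h 0).inner ℝ (h 0)).mul ((h 1).inner ℝ (h 1))).sub
    (((h 0).inner ℝ (h 1)).mul ((h 1).inner ℝ (h 0)))

theorem continuous_areaFactor : Continuous (areaFactor : (Plane →L[ℝ] V) → ℝ) := by
  rw [show (areaFactor : (Plane →L[ℝ] V) → ℝ) = fun L => √(gramDet L) from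
    funext areaFactor_eq_sqrt]
  exact Real.continuous_sqrt.comp contDiff_gramDet.continuous

/-- Near a point, an immersion is almost isometric to its derivative. -/
theorem exists_bilipschitz {φ : Plane → V} {a : Plane} {L : Plane →L[ℝ] V}
    (h : HasStrictFDerivAt φ L a) (hL : Function.Injective L) {k : ℝ≥0} (hk : 1 < k) :
    ∃ N, IsOpen N ∧ a ∈ N ∧ ∀ x ∈ N, ∀ y ∈ N,
      edist (φ x) (φ y) ≤ k * edist (L x) (L y) ∧ edist (L x) (L y) ≤ k * edist (φ x) (φ y) := by
  obtain ⟨c, hc, hLc⟩ := L.exists_antilipschitzWith (LinearMap.ker_eq_bot.2 hL)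
  have hk1 : (1 : ℝ) < k := hk
  have hk0 : (0 : ℝ) < k := zero_lt_one.trans hk1
  have hc0 : (0 : ℝ) < c := hc
  -- With this `ε` the antilipschitz bound for `L` makes the linearization error at most `(1 - 1/k)
  -- ‖L (x - y)‖`. The two estimates then follow with the factors `2 - 1/k ≤ k` and `1/k`.
  set ε : ℝ := (1 - (k : ℝ)⁻¹) / c with hε
  have hkinv : (k : ℝ)⁻¹ < 1 := inv_lt_one_of_one_lt₀ hk1
  have hε0 : 0 < ε := div_pos (by linarith) hc0
  have h1 := h.isLittleO.def hε0
  rw [nhds_prod_eq] at h1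
  obtain ⟨t, ht, ht'⟩ := (Filter.eventually_prod_self_iff (r := fun x y : Plane =>
    ‖φ x - φ y - L (x - y)‖ ≤ ε * ‖x - y‖)).1 h1
  obtain ⟨N, hNt, hN, haN⟩ := mem_nhds_iff.1 ht
  refine ⟨N, hN, haN, fun x hx y hy => ?_⟩
  have h2 : ‖φ x - φ y - L (x - y)‖ ≤ ε * ‖x - y‖ := ht' x (hNt hx) y (hNt hy)
  have h3 : ‖x - y‖ ≤ c * ‖L (x - y)‖ := by
    have := hLc.le_mul_dist x y
    rwa [dist_eq_norm, dist_eq_norm, ← map_sub] at this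
  have h4 : ‖φ x - φ y - L (x - y)‖ ≤ (1 - (k : ℝ)⁻¹) * ‖L (x - y)‖ := by
    calc _ ≤ ε * ‖x - y‖ := h2
      _ ≤ ε * (c * ‖L (x - y)‖) := mul_le_mul_of_nonneg_left h3 hε0.le
      _ = _ := by rw [hε]; field_simp
  have h5 : (k : ℝ) * (k : ℝ)⁻¹ = 1 := mul_inv_cancel₀ hk0.ne'
  have h6 := norm_nonneg (L (x - y))
  have h7 : ‖φ x - φ y‖ ≤ k * ‖L (x - y)‖ := by
    have h8 : ‖φ x - φ y‖ ≤ ‖φ x - φ y - L (x - y)‖ + ‖L (x - y)‖ := norm_le_norm_sub_add _ _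
    have h9 : 2 - (k : ℝ)⁻¹ ≤ k := by
      have : 0 ≤ (k : ℝ)⁻¹ * (k - 1) ^ 2 := by positivity
      nlinarith
    nlinarith
  have h8 : ‖L (x - y)‖ ≤ k * ‖φ x - φ y‖ := by
    have h9 : ‖L (x - y)‖ ≤ ‖φ x - φ y - L (x - y)‖ + ‖φ x - φ y‖ := by
      rw [norm_sub_rev (φ x - φ y)]
      exact norm_le_norm_sub_add _ _
    have h10 : (k : ℝ)⁻¹ * ‖L (x - y)‖ ≤ ‖φ x - φ y‖ := by linarith
    calc ‖L (x - y)‖ = k * ((k : ℝ)⁻¹ * ‖L (x - y)‖) := by rw [← mul_assoc, h5, one_mul]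
      _ ≤ _ := mul_le_mul_of_nonneg_left h10 hk0.le
  rw [map_sub] at h7 h8
  simp only [edist_eq_enorm_sub, enorm_eq_nnnorm]
  exact ⟨by exact_mod_cast h7, by exact_mod_cast h8⟩

theorem aemeasurable_areaFactor_fderiv {φ : Plane → V} {A : Set Plane} (hA : IsOpen A)
    (hφ : ContDiffOn ℝ ∞ φ A) : AEMeasurable
    (fun x => (areaFactor (fderiv ℝ φ x)).toNNReal) ((volume : Measure Plane).restrict A) := by
  have hJc : ContinuousOn (fun x => areaFactor (fderiv ℝ φ x)) A :=
    continuous_areaFactor.comp_continuousOn (hφ.continuousOn_fderiv_of_isOpen hA (by simp))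
  exact (hJc.aemeasurable hA.measurableSet).real_toNNReal

variable [MeasurableSpace V] [BorelSpace V]

theorem area_image_linear (L : Plane →L[ℝ] V) (s : Set Plane) :
    (μHE[2] : Measure V) (L '' s) = ENNReal.ofReal (areaFactor L) * volume s := by
  have := LinearMap.euclideanHausdorffMeasure_image_eq_normDet_mul_volume (L : Plane →ₗ[ℝ] V) s
  rwa [finrank_euclideanSpace_fin] at this

/-- The area formula for measurable sets. -/
theorem area_image_eq_lintegral {φ : Plane → V} {A : Set Plane} (hA : IsOpen A)
    (hφ : ContDiffOn ℝ ∞ φ A) (hinj : InjOn φ A)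
    (himm : ∀ x ∈ A, Function.Injective (fderiv ℝ φ x)) {s : Set Plane} (hs : MeasurableSet s)
    (hsA : s ⊆ A) :
    (μHE[2] : Measure V) (φ '' s) = ∫⁻ x in s, ENNReal.ofReal (areaFactor (fderiv ℝ φ x)) := by
  set J : Plane → ℝ := fun x => areaFactor (fderiv ℝ φ x) with hJ
  have hJc : ContinuousOn J A :=
    continuous_areaFactor.comp_continuousOn (hφ.continuousOn_fderiv_of_isOpen hA (by simp))
  have hJpos : ∀ x ∈ A, 0 < J x := fun x hx => areaFactor_pos (himm x hx)
  -- Near `a` the map is `k`-bilipschitz to its linear part, which costs `k ^ 2` in two-dimensional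
  -- measure, and the area factor varies by at most the factor `k`; together this is `k ^ 3`. The
  -- local inequalities are then globalized, and `k → 1`.
  have hlocal : ∀ k : ℝ≥0, 1 < k → ∀ a ∈ A, ∃ N, IsOpen N ∧ a ∈ N ∧
      ∀ s, MeasurableSet s → s ⊆ N → s ⊆ A →
        (μHE[2] : Measure V) (φ '' s) ≤ (k : ℝ≥0∞) ^ 3 * ∫⁻ x in s, ENNReal.ofReal (J x) ∧
        ∫⁻ x in s, ENNReal.ofReal (J x) ≤ (k : ℝ≥0∞) ^ 3 * (μHE[2] : Measure V) (φ '' s) := by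
    intro k hk a ha
    have hstrict : HasStrictFDerivAt φ (fderiv ℝ φ a) a :=
      (hφ.contDiffAt (hA.mem_nhds ha)).hasStrictFDerivAt (by simp)
    obtain ⟨N, hN, haN, hNb⟩ := exists_bilipschitz hstrict (himm a ha) hk
    have hJa := hJpos a ha
    have hca : ContinuousAt J a := hJc.continuousAt (hA.mem_nhds ha)
    have h1 : ∀ᶠ x in 𝓝 a, J x < k * J a ∧ J a < k * J x := by
      refine (hca.eventually (gt_mem_nhds (by nlinarith))).and ?_
      exact (hca.const_mul (k : ℝ)).eventually (lt_mem_nhds (by nlinarith))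
    obtain ⟨N', hN'1, hN', haN'⟩ := eventually_nhds_iff.1 h1
    refine ⟨N ∩ N', hN.inter hN', ⟨haN, haN'⟩, fun s hs hsN hsA => ?_⟩
    have hofk : ENNReal.ofReal (k : ℝ) = k := ENNReal.ofReal_coe_nnreal
    have hvol1 : ENNReal.ofReal (J a) * volume s ≤ k * ∫⁻ x in s, ENNReal.ofReal (J x) := by
      rw [← setLIntegral_const, ← lintegral_const_mul' _ _ ENNReal.coe_ne_top]
      refine setLIntegral_mono' hs fun x hx => ?_
      rw [← hofk, ← ENNReal.ofReal_mul k.coe_nonneg]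
      exact ENNReal.ofReal_le_ofReal (hN'1 x (hsN hx).2).2.le
    have hvol2 : ∫⁻ x in s, ENNReal.ofReal (J x) ≤ k * (ENNReal.ofReal (J a) * volume s) := by
      rw [← mul_assoc, ← hofk, ← ENNReal.ofReal_mul k.coe_nonneg, ← setLIntegral_const]
      refine setLIntegral_mono' hs fun x hx => ?_
      exact ENNReal.ofReal_le_ofReal (hN'1 x (hsN hx).2).1.le
    have hH1 := euclideanHausdorffMeasure_image_le_of_edist_le (s := s)
      ((himm a ha).injOn) (fun x hx y hy => (hNb x (hsN hx).1 y (hsN hy).1).1) 2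
    have hH2 := euclideanHausdorffMeasure_image_le_of_edist_le (s := s)
      (hinj.mono hsA) (fun x hx y hy => (hNb x (hsN hx).1 y (hsN hy).1).2) 2
    rw [area_image_linear] at hH1 hH2
    constructor
    · calc _ ≤ _ := hH1
        _ ≤ (k : ℝ≥0∞) ^ 2 * (k * ∫⁻ x in s, ENNReal.ofReal (J x)) := mul_le_mul_right hvol1 _
        _ = _ := by ring
    · calc _ ≤ _ := hvol2
        _ ≤ k * ((k : ℝ≥0∞) ^ 2 * (μHE[2] : Measure V) (φ '' s)) := mul_le_mul_right hH2 _
        _ = _ := by ring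
  have hsub1 : ∀ s : ℕ → Set Plane, (μHE[2] : Measure V) (φ '' ⋃ n, s n)
      ≤ ∑' n, (μHE[2] : Measure V) (φ '' s n) := fun s => by
    rw [image_iUnion]; exact measure_iUnion_le _
  have hsub2 : ∀ s : ℕ → Set Plane, ∫⁻ x in ⋃ n, s n, ENNReal.ofReal (J x)
      ≤ ∑' n, ∫⁻ x in s n, ENNReal.ofReal (J x) := fun s => lintegral_iUnion_le _ _
  have hglobal : ∀ k : ℝ≥0, 1 < k →
      (μHE[2] : Measure V) (φ '' s) ≤ (k : ℝ≥0∞) ^ 3 * ∫⁻ x in s, ENNReal.ofReal (J x) ∧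
      ∫⁻ x in s, ENNReal.ofReal (J x) ≤ (k : ℝ≥0∞) ^ 3 * (μHE[2] : Measure V) (φ '' s) := by
    intro k hk
    constructor
    · refine le_of_locally_le (m₁ := fun s => (μHE[2] : Measure V) (φ '' s))
        (m₂ := fun s => ∫⁻ x in s, ENNReal.ofReal (J x)) (by simp) hsub1
        (fun s hs _ hd => (lintegral_iUnion hs hd _).ge) (fun a ha => ?_) hs hsA
      obtain ⟨N, hN, haN, h⟩ := hlocal k hk a ha
      exact ⟨N, hN, haN, fun s hs hsN hsA => (h s hs hsN hsA).1⟩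
    · refine le_of_locally_le (m₂ := fun s => (μHE[2] : Measure V) (φ '' s))
        (m₁ := fun s => ∫⁻ x in s, ENNReal.ofReal (J x)) (by simp) hsub2
        (fun s hs hsA hd => ?_) (fun a ha => ?_) hs hsA
      · rw [image_iUnion, measure_iUnion]
        · intro i j hij
          refine disjoint_iff_inter_eq_empty.2 ?_
          rw [← hinj.image_inter (hsA i) (hsA j), (hd hij).inter_eq, image_empty]
        · exact fun n => (hs n).image_of_continuousOn_injOn
            (hφ.continuousOn.mono (hsA n)) (hinj.mono (hsA n))
      · obtain ⟨N, hN, haN, h⟩ := hlocal k hk a ha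
        exact ⟨N, hN, haN, fun s hs hsN hsA => (h s hs hsN hsA).2⟩
  have hlim : ∀ a b : ℝ≥0∞, (∀ k : ℝ≥0, 1 < k → a ≤ (k : ℝ≥0∞) ^ 3 * b) → a ≤ b := by
    intro a b h
    by_cases hb : b = ⊤
    · simp [hb]
    have h1 : Tendsto (fun k : ℝ≥0 => (k : ℝ≥0∞) ^ 3 * b) (𝓝[>] 1) (𝓝 ((1 : ℝ≥0∞) ^ 3 * b)) := by
      refine ENNReal.Tendsto.mul_const ?_ (Or.inr hb)
      have h2 : Tendsto (fun k : ℝ≥0 => ((k ^ 3 : ℝ≥0) : ℝ≥0∞)) (𝓝 1)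
          (𝓝 (((1 : ℝ≥0) ^ 3 : ℝ≥0) : ℝ≥0∞)) :=
        ENNReal.tendsto_coe.2 ((continuous_pow 3).tendsto 1)
      simpa using h2.mono_left nhdsWithin_le_nhds
    rw [one_pow, one_mul] at h1
    exact ge_of_tendsto h1 (eventually_mem_nhdsWithin.mono fun k hk => h k hk)
  exact le_antisymm (hlim _ _ fun k hk => (hglobal k hk).1) (hlim _ _ fun k hk => (hglobal k hk).2)

section AreaIntegral

variable {φ : Plane → V} {A : Set Plane} (hA : IsOpen A) (hφ : ContDiffOn ℝ ∞ φ A)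
  (hinj : InjOn φ A) (himm : ∀ x ∈ A, Function.Injective (fderiv ℝ φ x))
include hA hφ hinj

theorem measurableEmbedding_domRestrict : MeasurableEmbedding (A.domRestrict φ) :=
  hφ.continuousOn.measurableEmbedding hA.measurableSet hinj

include himm

/-- The area formula, tested on Borel sets, is an identity of measures. It is stated on the subtype
`A` because only the restriction of `φ` is an embedding; both the value of integrals and
integrability then transfer by change of variables. -/
theorem map_withDensity_areaFactor :
    Measure.map (A.domRestrict φ) (Measure.comap (↑) ((volume : Measure Plane).withDensity
      fun x => ENNReal.ofReal (areaFactor (fderiv ℝ φ x)))) =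
      (μHE[2] : Measure V).restrict (φ '' A) := by
  have hemb := measurableEmbedding_domRestrict hA hφ hinj
  ext t ht
  have hset : (Subtype.val '' (A.domRestrict φ ⁻¹' t)) = A ∩ φ ⁻¹' t := by
    rw [domRestrict_eq, preimage_comp, Subtype.image_preimage_coe]
  have hm : MeasurableSet (A ∩ φ ⁻¹' t) := by
    rw [← hset]
    exact hA.measurableSet.subtype_image (hemb.measurable ht)
  rw [hemb.map_apply, (MeasurableEmbedding.subtype_coe hA.measurableSet).comap_apply, hset,
    withDensity_apply _ hm, ← area_image_eq_lintegral hA hφ hinj himm hm inter_subset_left,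
    Measure.restrict_apply ht, image_inter_preimage, inter_comm]

/-- The area formula for parametrized surfaces. -/
theorem setIntegral_image_area (g : V → ℝ) :
    ∫ x in φ '' A, g x ∂(μHE[2] : Measure V) = ∫ u in A, areaFactor (fderiv ℝ φ u) * g (φ u) := by
  rw [← map_withDensity_areaFactor hA hφ hinj himm,
    (measurableEmbedding_domRestrict hA hφ hinj).integral_map]
  simp only [Set.domRestrict_apply, ← Function.comp_apply (f := g), ENNReal.ofReal]
  rw [← (MeasurableEmbedding.subtype_coe hA.measurableSet).integral_map,
    map_comap_subtype_coe hA.measurableSet, setIntegral_withDensity_eq_setIntegral_smul₀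
      (aemeasurable_areaFactor_fderiv hA hφ) _ hA.measurableSet]
  congr with x
  rw [NNReal.smul_def, Real.coe_toNNReal _ (areaFactor_nonneg _), smul_eq_mul]

theorem integrableOn_image_area_iff (g : V → ℝ) :
    IntegrableOn g (φ '' A) (μHE[2] : Measure V) ↔
      IntegrableOn (fun u => areaFactor (fderiv ℝ φ u) * g (φ u)) A := by
  rw [IntegrableOn, ← map_withDensity_areaFactor hA hφ hinj himm,
    (measurableEmbedding_domRestrict hA hφ hinj).integrable_map_iff]
  simp only [Set.domRestrict_eq, ← Function.comp_assoc, ENNReal.ofReal]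
  rw [← (MeasurableEmbedding.subtype_coe hA.measurableSet).integrable_map_iff,
    map_comap_subtype_coe hA.measurableSet, restrict_withDensity hA.measurableSet,
    integrable_withDensity_iff_integrable_coe_smul₀]
  · simp_rw [IntegrableOn, Real.coe_toNNReal _ (areaFactor_nonneg _), Function.comp_apply,
      smul_eq_mul]
  · exact aemeasurable_areaFactor_fderiv hA hφ

end AreaIntegral

end Area

end GRT

namespace GRT

/-! ### The smooth implicit function theorem on a neighborhood -/

section Implicit

theorem isInvertible_of_injective {E F : Type*} [NormedAddCommGroup E] [NormedSpace ℝ E]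
    [FiniteDimensional ℝ E] [NormedAddCommGroup F] [NormedSpace ℝ F] [FiniteDimensional ℝ F]
    (h : Module.finrank ℝ E = Module.finrank ℝ F) {L : E →L[ℝ] F}
    (hL : ∀ x, L x = 0 → x = 0) : L.IsInvertible := by
  have hinj : Function.Injective (L : E →ₗ[ℝ] F) :=
    (injective_iff_map_eq_zero (L : E →ₗ[ℝ] F)).2 hL
  refine ⟨(LinearEquiv.ofInjectiveOfFinrankEq (L : E →ₗ[ℝ] F) hinj h).toContinuousLinearEquiv, ?_⟩
  ext x
  rfl

variable {E₁ E₂ F : Type*} [NormedAddCommGroup E₁] [NormedSpace ℝ E₁] [CompleteSpace E₁]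
  [NormedAddCommGroup E₂] [NormedSpace ℝ E₂] [CompleteSpace E₂]
  [NormedAddCommGroup F] [NormedSpace ℝ F] [CompleteSpace F]

/-- The smooth implicit function theorem. -/
theorem exists_contDiffOn_implicit {f : E₁ × E₂ → F} {Ω : Set (E₁ × E₂)} (hΩ : IsOpen Ω)
    (hf : ContDiffOn ℝ ∞ f Ω) {a : E₁} {b : E₂} (hab : (a, b) ∈ Ω) (h0 : f (a, b) = 0)
    (hinv : (fderiv ℝ f (a, b) ∘L .inr ℝ E₁ E₂).IsInvertible) :
    ∃ (φ : E₁ → E₂) (W : Set E₁) (V : Set E₂), IsOpen W ∧ a ∈ W ∧ IsOpen V ∧ b ∈ V ∧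
      W ×ˢ V ⊆ Ω ∧ ContDiffOn ℝ ∞ φ W ∧ φ a = b ∧ MapsTo φ W V ∧
      ∀ x ∈ W, ∀ y ∈ V, f (x, y) = 0 ↔ y = φ x := by
  have hn : (∞ : ℕ∞ω) ≠ 0 := by simp
  have hat : ∀ p ∈ Ω, ContDiffAt ℝ ∞ f p := fun p hp => hf.contDiffAt (hΩ.mem_nhds hp)
  set φ := (hat _ hab).implicitFunction hn hinv with hφ
  have hφa : φ a = b := (hat _ hab).implicitFunction_apply_self hn hinv
  have hiff := (hat _ hab).eventually_apply_eq_iff_implicitFunction hn hinv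
  have hcont : ContinuousAt φ a :=
    ((hat _ hab).contDiffAt_implicitFunction hn hinv).continuousAt
  have hinvopen : ∀ᶠ p in 𝓝 (a, b), (fderiv ℝ f p ∘L .inr ℝ E₁ E₂).IsInvertible := by
    have h1 : ContinuousAt (fun p => fderiv ℝ f p ∘L .inr ℝ E₁ E₂) (a, b) := by
      have := (hf.continuousOn_fderiv_of_isOpen hΩ (by simp)).continuousAt (hΩ.mem_nhds hab)
      exact (continuous_id.clm_comp continuous_const).continuousAt.comp this
    obtain ⟨e, he⟩ := hinv
    have h2 : range ((↑) : (E₂ ≃L[ℝ] F) → (E₂ →L[ℝ] F)) ∈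
        𝓝 (fderiv ℝ f (a, b) ∘L .inr ℝ E₁ E₂) := by
      rw [← he]; exact e.nhds
    filter_upwards [h1 h2] with p hp
    exact hp
  obtain ⟨W₀, hW₀, V, hV, hWV⟩ := mem_nhds_prod_iff.1
    (hiff.and (hinvopen.and (hΩ.mem_nhds hab)))
  obtain ⟨V', hV'V, hV', hbV'⟩ := mem_nhds_iff.1 hV
  have hW1 : W₀ ∩ φ ⁻¹' V' ∈ 𝓝 a :=
    inter_mem hW₀ (hcont (by rw [hφa]; exact hV'.mem_nhds hbV'))
  obtain ⟨W, hWsub, hW, haW⟩ := mem_nhds_iff.1 hW1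
  have hall : ∀ x ∈ W, ∀ y ∈ V', (f (x, y) = 0 ↔ y = φ x) ∧
      (fderiv ℝ f (x, y) ∘L .inr ℝ E₁ E₂).IsInvertible ∧ (x, y) ∈ Ω := by
    intro x hx y hy
    obtain ⟨h1, h2, h3⟩ := hWV (mk_mem_prod (hWsub hx).1 (hV'V hy))
    refine ⟨?_, h2, h3⟩
    rw [h0] at h1
    exact h1.trans eq_comm
  have hmaps : MapsTo φ W V' := fun x hx => (hWsub hx).2
  refine ⟨φ, W, V', hW, haW, hV', hbV', fun p hp => (hall _ hp.1 _ hp.2).2.2, ?_, hφa, hmaps,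
    fun x hx y hy => (hall x hx y hy).1⟩
  -- At another point `x` of `W` the partial derivative is still invertible. The implicit function
  -- based at `(x, φ x)` is smooth at `x`, and by the uniqueness in `hall` it coincides with `φ`
  -- near `x`.
  intro x hx
  obtain ⟨h1, h2, h3⟩ := hall x hx _ (hmaps hx)
  have hx0 : f (x, φ x) = 0 := h1.2 rfl
  have hsm := (hat _ h3).contDiffAt_implicitFunction hn h2
  have hval := (hat _ h3).implicitFunction_apply_self hn h2
  have hev := (hat _ h3).eventually_apply_implicitFunction hn h2
  set φ' := (hat _ h3).implicitFunction hn h2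
  have hsm' : ContDiffAt ℝ ∞ φ' x := hsm
  have hval' : φ' x = φ x := hval
  have h4 : φ =ᶠ[𝓝 x] φ' := by
    have h5 : φ' ⁻¹' V' ∈ 𝓝 x :=
      hsm'.continuousAt (by rw [hval']; exact hV'.mem_nhds (hmaps hx))
    filter_upwards [hev, h5, hW.mem_nhds hx] with x' h6 h7 h8
    rw [hx0] at h6
    exact ((hall x' h8 _ h7).1.1 h6).symm
  exact (hsm'.congr_of_eventuallyEq h4).contDiffWithinAt

end Implicit

end GRT

namespace GRT

/-! ### The Morse lemma with parameters in the plane -/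

section Morse

variable {E : Type*} [NormedAddCommGroup E] [NormedSpace ℝ E]

/-- Taylor's formula of order two with integral remainder. -/
theorem taylor_two_integral {g g' g'' : ℝ → ℝ} (h1 : ∀ t, HasDerivAt g (g' t) t)
    (h2 : ∀ t, HasDerivAt g' (g'' t) t) (hc : Continuous g'') :
    g 1 = g 0 + g' 0 + ∫ t in (0 : ℝ)..1, (1 - t) * g'' t := by
  have h3 : ∀ t ∈ uIcc (0 : ℝ) 1, HasDerivAt (fun t => (1 - t) * g' t + g t)
      ((1 - t) * g'' t) t := by
    intro t _
    have h4 : HasDerivAt (fun t : ℝ => 1 - t) (-1) t := by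
      simpa using (hasDerivAt_id t).const_sub 1
    refine HasDerivAt.congr_deriv ((h4.mul (h2 t)).add (h1 t)) ?_
    ring
  have h5 : Continuous fun t => (1 - t) * g'' t := by fun_prop
  rw [intervalIntegral.integral_eq_sub_of_hasDerivAt h3 (h5.intervalIntegrable _ _)]
  ring

variable {ψ : Plane × E → ℝ}

theorem plane_decomp (w : Plane) : w = w 0 • EuclideanSpace.basisFun (Fin 2) ℝ 0
    + w 1 • EuclideanSpace.basisFun (Fin 2) ℝ 1 := by
  ext i
  fin_cases i <;> simp

theorem plane_decomp_inl (w : Plane) : ((w, 0) : Plane × E)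
    = w 0 • ((EuclideanSpace.basisFun (Fin 2) ℝ 0, 0) : Plane × E)
      + w 1 • ((EuclideanSpace.basisFun (Fin 2) ℝ 1, 0) : Plane × E) := by
  rw [Prod.smul_mk, Prod.smul_mk, Prod.mk_add_mk, ← plane_decomp]
  simp

/-- The second derivative in the first variable. -/
noncomputable def hessFst (ψ : Plane × E → ℝ) (p : Plane × E) (a b : Plane) : ℝ :=
  fderiv ℝ (fderiv ℝ ψ) p (a, 0) (b, 0)

theorem contDiff_hessFst (hψ : ContDiff ℝ ∞ ψ) (a b : Plane) :
    ContDiff ℝ ∞ (fun p => hessFst ψ p a b) :=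
  ((((hψ.fderiv_right (m := ∞) (by simp)).fderiv_right (m := ∞) (by simp)).clm_apply
    contDiff_const).clm_apply contDiff_const)

theorem hessFst_symm (hψ : ContDiff ℝ ∞ ψ) (p : Plane × E) (a b : Plane) :
    hessFst ψ p a b = hessFst ψ p b a :=
  (hψ.contDiffAt.isSymmSndFDerivAt (by
    simp only [minSmoothness_of_isRCLikeNormedField]
    exact WithTop.coe_le_coe.2 le_top)) _ _

theorem hessFst_diag (hψ : ContDiff ℝ ∞ ψ) (p : Plane × E) (w : Plane) :
    hessFst ψ p w w = w 0 ^ 2 * hessFst ψ p (EuclideanSpace.basisFun (Fin 2) ℝ 0)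
        (EuclideanSpace.basisFun (Fin 2) ℝ 0)
      + 2 * (w 0 * w 1) * hessFst ψ p (EuclideanSpace.basisFun (Fin 2) ℝ 0)
        (EuclideanSpace.basisFun (Fin 2) ℝ 1)
      + w 1 ^ 2 * hessFst ψ p (EuclideanSpace.basisFun (Fin 2) ℝ 1)
        (EuclideanSpace.basisFun (Fin 2) ℝ 1) := by
  have hs := hessFst_symm hψ p (EuclideanSpace.basisFun (Fin 2) ℝ 0)
    (EuclideanSpace.basisFun (Fin 2) ℝ 1)
  set e₀ := EuclideanSpace.basisFun (Fin 2) ℝ 0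
  set e₁ := EuclideanSpace.basisFun (Fin 2) ℝ 1
  have h : ((w, 0) : Plane × E) = w 0 • ((e₀, 0) : Plane × E) + w 1 • ((e₁, 0) : Plane × E) := plane_decomp_inl w
  unfold hessFst at hs ⊢
  rw [h]
  simp only [map_add, map_smul, add_apply,
    smul_apply, smul_eq_mul]
  rw [← hs]
  ring

/-- The derivative of second order along segments, averaged as in Taylor's formula. -/
theorem eq_add_integral_hessFst (hψ : ContDiff ℝ ∞ ψ) (c w : Plane) (y : E) :
    ψ (c + w, y) = ψ (c, y) + fderiv ℝ ψ (c, y) (w, 0)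
      + ∫ t in (0 : ℝ)..1, (1 - t) * hessFst ψ (c + t • w, y) w w := by
  have hγ : ∀ t : ℝ, HasDerivAt (fun t : ℝ => ((c + t • w, y) : Plane × E)) ((w, 0) : Plane × E) t := by
    intro t
    have h1 : HasDerivAt (fun t : ℝ => c + t • w) w t := by
      simpa using ((hasDerivAt_id t).smul_const w).const_add c
    exact h1.prodMk (hasDerivAt_const _ _)
  have h1 : ∀ t : ℝ, HasDerivAt (fun t : ℝ => ψ (c + t • w, y))
      (fderiv ℝ ψ (c + t • w, y) (w, 0)) t := fun t =>
    ((hψ.differentiable (by simp) _).hasFDerivAt).comp_hasDerivAt t (hγ t)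
  have h2 : ∀ t : ℝ, HasDerivAt (fun t : ℝ => fderiv ℝ ψ (c + t • w, y) (w, 0))
      (hessFst ψ (c + t • w, y) w w) t := fun t => by
    have h3 : HasDerivAt (fun t : ℝ => fderiv ℝ ψ (c + t • w, y))
        (fderiv ℝ (fderiv ℝ ψ) (c + t • w, y) (w, 0)) t :=
      ((((hψ.fderiv_right (m := ∞) (by simp)).differentiable (by simp) _).hasFDerivAt).comp_hasDerivAt
        t (hγ t))
    simpa [hessFst] using h3.clm_apply (hasDerivAt_const t ((w, 0) : Plane × E))
  have h3 := taylor_two_integral h1 h2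
    ((contDiff_hessFst hψ w w).continuous.comp (by fun_prop))
  simpa using h3

variable [FiniteDimensional ℝ E]

/-- Smooth dependence of a nondegenerate critical point on parameters. -/
theorem exists_critical_point (hψ : ContDiff ℝ ∞ ψ) {y₀ : E}
    (h1 : ∀ a, fderiv ℝ ψ (0, y₀) (a, 0) = 0) (h2 : ∀ a, a ≠ 0 → hessFst ψ (0, y₀) a a < 0) :
    ∃ c : E → Plane, ContDiff ℝ ∞ c ∧ c y₀ = 0 ∧
      ∀ᶠ y in 𝓝 y₀, ∀ a, fderiv ℝ ψ (c y, y) (a, 0) = 0 := by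
  set e := EuclideanSpace.basisFun (Fin 2) ℝ with he
  set f : E × Plane → Plane := fun q =>
    WithLp.toLp 2 fun i => fderiv ℝ ψ (q.2, q.1) (e i, 0) with hf
  have hfs : ContDiff ℝ ∞ f := by
    rw [contDiff_euclidean]
    intro i
    have h3 : ContDiff ℝ ∞ fun p => fderiv ℝ ψ p (e i, 0) :=
      (hψ.fderiv_right (m := ∞) (by simp)).clm_apply contDiff_const
    exact h3.comp (f := fun q : E × Plane => (q.2, q.1)) (by fun_prop)
  have hzero : ∀ y w, f (y, w) = 0 ↔ ∀ a, fderiv ℝ ψ (w, y) (a, 0) = 0 := by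
    intro y w
    constructor
    · intro h a
      have h3 : ∀ i, fderiv ℝ ψ (w, y) (e i, 0) = 0 := fun i => by
        have := congrArg (fun v : Plane => v i) h
        simpa [hf] using this
      have h4 : ((a, 0) : Plane × E) = a 0 • ((e 0, 0) : Plane × E) + a 1 • ((e 1, 0) : Plane × E) :=
        plane_decomp_inl a
      rw [h4, map_add, map_smul, map_smul, h3, h3]
      simp
    · intro h
      ext i
      simp [hf, h]
  have hder : ∀ a i, (fderiv ℝ f (y₀, 0) (0, a)) i = hessFst ψ (0, y₀) a (e i) := by
    intro a i
    have h3 : HasFDerivAt (fun q : E × Plane => f q i)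
        ((EuclideanSpace.proj i).comp (fderiv ℝ f (y₀, 0))) (y₀, 0) :=
      (EuclideanSpace.proj (𝕜 := ℝ) i).hasFDerivAt.comp _
        (hfs.differentiable (by simp) _).hasFDerivAt
    have h4 : HasFDerivAt (fun p => fderiv ℝ ψ p) (fderiv ℝ (fderiv ℝ ψ) (0, y₀)) (0, y₀) :=
      ((hψ.fderiv_right (m := ∞) (by simp)).differentiable (by simp) _).hasFDerivAt
    have h5 : HasFDerivAt (fun q : E × Plane => (q.2, q.1))
        ((ContinuousLinearMap.snd ℝ E Plane).prod (ContinuousLinearMap.fst ℝ E Plane)) (y₀, 0) :=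
      hasFDerivAt_snd.prodMk hasFDerivAt_fst
    have h6 := (HasFDerivAt.comp (f := fun q : E × Plane => (q.2, q.1)) (y₀, (0 : Plane))
      h4 h5).clm_apply (hasFDerivAt_const ((e i, 0) : Plane × E) _)
    have h7 := congrArg (fun L => L (0, a)) (h3.unique h6)
    simpa [hessFst] using h7
  -- The derivative of the gradient in the plane variable is the Hessian, and a kernel vector of it
  -- would contradict negativity.
  have hinv : (fderiv ℝ f (y₀, 0) ∘L .inr ℝ E Plane).IsInvertible := by
    refine isInvertible_of_injective rfl fun a ha => ?_
    by_contra ha0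
    have h3 := h2 a ha0
    have h4 : ∀ i, hessFst ψ (0, y₀) a (e i) = 0 := fun i => by
      rw [← hder]
      have := congrArg (fun v : Plane => v i) ha
      simpa using this
    have h5 : hessFst ψ (0, y₀) a a = 0 := by
      have h4' : ((a, 0) : Plane × E) = a 0 • ((e 0, 0) : Plane × E) + a 1 • ((e 1, 0) : Plane × E) :=
        plane_decomp_inl a
      have : hessFst ψ (0, y₀) a a = a 0 * hessFst ψ (0, y₀) a (e 0)
          + a 1 * hessFst ψ (0, y₀) a (e 1) := by
        unfold hessFst
        conv_lhs => rw [show fderiv ℝ (fderiv ℝ ψ) (0, y₀) (a, 0) (a, 0)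
          = fderiv ℝ (fderiv ℝ ψ) (0, y₀) (a, 0)
            (a 0 • ((e 0, 0) : Plane × E) + a 1 • ((e 1, 0) : Plane × E)) by rw [← h4']]
        rw [map_add, map_smul, map_smul, smul_eq_mul, smul_eq_mul]
      rw [this, h4, h4]
      ring
    exact h3.ne h5
  have : CompleteSpace E := FiniteDimensional.complete ℝ E
  obtain ⟨φ, W, V, hW, haW, hV, hbV, -, hφ, hφ0, hmaps, hiff⟩ := exists_contDiffOn_implicit
    isOpen_univ hfs.contDiffOn (mem_univ (y₀, 0)) ((hzero _ _).2 h1) hinv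
  obtain ⟨c, hc, -, N, hN, hyN, hNW, hcN⟩ := exists_smooth_extension
    (isCompact_singleton (x := y₀)) hW (singleton_subset_iff.2 haW) hφ
  refine ⟨c, hc, ?_, ?_⟩
  · rw [hcN _ (hyN rfl), hφ0]
  · filter_upwards [hN.mem_nhds (hyN rfl)] with y hy
    rw [hcN y hy]
    exact (hzero _ _).1 ((hiff y (hNW hy) _ (hmaps (hNW hy))).2 rfl)

/-- The Morse lemma with parameters, at a nondegenerate maximum in the plane. -/
theorem exists_morse_normal_form (hψ : ContDiff ℝ ∞ ψ) {y₀ : E}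
    (h1 : ∀ a, fderiv ℝ ψ (0, y₀) (a, 0) = 0) (h2 : ∀ a, a ≠ 0 → hessFst ψ (0, y₀) a a < 0) :
    ∃ (v : E → ℝ) (β : Plane × E → Plane) (N : Set (Plane × E)), IsOpen N ∧ (0, y₀) ∈ N ∧
      ContDiffOn ℝ ∞ β N ∧ (∀ p ∈ N, ψ p = v p.2 - ‖β p‖ ^ 2) ∧ β (0, y₀) = 0 ∧
      ∀ a, fderiv ℝ β (0, y₀) (a, 0) = 0 → a = 0 := by
  obtain ⟨c, hc, hc0, hcrit⟩ := exists_critical_point hψ h1 h2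
  set e := EuclideanSpace.basisFun (Fin 2) ℝ with he
  -- At the critical point `c y` the linear term of Taylor's formula vanishes, so `ψ` is its
  -- critical value minus a quadratic form in `w - c y`. The coefficients of this form are the
  -- averaged negative Hessians `A i j`.
  set A : Fin 2 → Fin 2 → Plane × E → ℝ := fun i j p =>
    -∫ t in (0 : ℝ)..1, (1 - t) * hessFst ψ (c p.2 + t • (p.1 - c p.2), p.2) (e i) (e j) with hA
  have hAs : ∀ i j, ContDiff ℝ ∞ (A i j) := by
    intro i j
    refine (contDiff_intervalIntegral_param (f := fun (p : Plane × E) (t : ℝ) =>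
      (1 - t) * hessFst ψ (c p.2 + t • (p.1 - c p.2), p.2) (e i) (e j)) ?_ zero_le_one).neg
    have h3 : ContDiff ℝ ∞ fun q : (Plane × E) × ℝ =>
        ((c q.1.2 + q.2 • (q.1.1 - c q.1.2), q.1.2) : Plane × E) := by
      have h4 : ContDiff ℝ ∞ fun q : (Plane × E) × ℝ => c q.1.2 := hc.comp (by fun_prop)
      exact (h4.add (contDiff_snd.smul ((contDiff_fst.comp contDiff_fst).sub h4))).prodMk
        (by fun_prop)
    exact ContDiff.mul (by fun_prop) ((contDiff_hessFst hψ (e i) (e j)).comp h3)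
  have hA0 : ∀ i j, A i j (0, y₀) = -(hessFst ψ (0, y₀) (e i) (e j) / 2) := by
    intro i j
    have h3 : ∫ t in (0 : ℝ)..1, (1 - t) = 1 / 2 := by
      rw [intervalIntegral.integral_sub (by simp) (by simp)]
      simp
      norm_num
    simp only [hA, hc0, sub_zero, smul_zero, add_zero, intervalIntegral.integral_mul_const, h3]
    ring
  have hexp : ∀ᶠ y in 𝓝 y₀, ∀ w, ψ (w, y) = ψ (c y, y) -
      ((w 0 - c y 0) ^ 2 * A 0 0 (w, y) + 2 * ((w 0 - c y 0) * (w 1 - c y 1)) * A 0 1 (w, y)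
        + (w 1 - c y 1) ^ 2 * A 1 1 (w, y)) := by
    filter_upwards [hcrit] with y hy w
    have h3 := eq_add_integral_hessFst hψ (c y) (w - c y) y
    rw [add_sub_cancel, hy, add_zero] at h3
    rw [h3]
    have hcont : ∀ i j, Continuous fun t : ℝ =>
        (1 - t) * hessFst ψ (c y + t • (w - c y), y) (e i) (e j) := fun i j =>
      (by fun_prop : Continuous fun t : ℝ => 1 - t).mul
        ((contDiff_hessFst hψ (e i) (e j)).continuous.comp (by fun_prop))
    have h4 : ∀ t : ℝ, (1 - t) * hessFst ψ (c y + t • (w - c y), y) (w - c y) (w - c y) =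
        (w 0 - c y 0) ^ 2 * ((1 - t) * hessFst ψ (c y + t • (w - c y), y) (e 0) (e 0))
        + 2 * ((w 0 - c y 0) * (w 1 - c y 1)) *
          ((1 - t) * hessFst ψ (c y + t • (w - c y), y) (e 0) (e 1))
        + (w 1 - c y 1) ^ 2 * ((1 - t) * hessFst ψ (c y + t • (w - c y), y) (e 1) (e 1)) := by
      intro t
      rw [hessFst_diag hψ _ (w - c y)]
      simp only [PiLp.sub_apply]
      ring
    simp_rw [h4]
    have hi : ∀ (k : ℝ) i j, IntervalIntegrable (fun t : ℝ =>
        k * ((1 - t) * hessFst ψ (c y + t • (w - c y), y) (e i) (e j))) volume 0 1 :=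
      fun k i j => (continuous_const.mul (hcont i j)).intervalIntegrable _ _
    rw [intervalIntegral.integral_add ((hi _ _ _).add (hi _ _ _)) (hi _ _ _),
      intervalIntegral.integral_add (hi _ _ _) (hi _ _ _)]
    simp only [intervalIntegral.integral_const_mul, hA]
    ring
  obtain ⟨N', hN'exp, hN', hyN'⟩ := eventually_nhds_iff.1 hexp
  -- `Δ` is the Schur complement of the entry `A 0 0`; on `N` the matrix `A` is positive definite,
  -- so both pivots are positive.
  set Δ : Plane × E → ℝ := fun p => A 1 1 p - A 0 1 p ^ 2 / A 0 0 p with hΔ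
  set N : Set (Plane × E) := {p | 0 < A 0 0 p ∧ 0 < A 0 0 p * A 1 1 p - A 0 1 p ^ 2} ∩
    (univ ×ˢ N') with hN
  have hNo : IsOpen N := by
    refine IsOpen.inter (IsOpen.inter ?_ ?_) (isOpen_univ.prod hN')
    · exact isOpen_lt continuous_const (hAs 0 0).continuous
    · exact isOpen_lt continuous_const
        (((hAs 0 0).continuous.mul (hAs 1 1).continuous).sub ((hAs 0 1).continuous.pow 2))
  have hΔpos : ∀ p ∈ N, 0 < Δ p := by
    intro p hp
    have h3 : Δ p = (A 0 0 p * A 1 1 p - A 0 1 p ^ 2) / A 0 0 p := by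
      have := hp.1.1.ne'
      simp only [hΔ]
      field_simp
    rw [h3]
    exact div_pos hp.1.2 hp.1.1
  have hN0 : ((0 : Plane), y₀) ∈ N := by
    refine ⟨?_, mem_univ _, hyN'⟩
    simp only [mem_ofPred_eq, hA0]
    have he0 : e 0 ≠ 0 := e.orthonormal.ne_zero 0
    have h3 := h2 (e 0) he0
    refine ⟨by linarith, ?_⟩
    set x := hessFst ψ (0, y₀) (e 0) (e 0)
    set y := hessFst ψ (0, y₀) (e 0) (e 1)
    set z := hessFst ψ (0, y₀) (e 1) (e 1)
    -- On this test vector the Hessian form takes the value `x (x z - y²)`. As `x < 0`, its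
    -- negativity gives a positive determinant.
    have h4 : (y • e 0 - x • e 1 : Plane) ≠ 0 := by
      intro h
      have := congrArg (fun v : Plane => v 1) h
      simp [he] at this
      exact h3.ne this
    have h5 := h2 _ h4
    rw [hessFst_diag hψ] at h5
    have h6 : (y • e 0 - x • e 1 : Plane) 0 = y := by simp [he]
    have h7 : (y • e 0 - x • e 1 : Plane) 1 = -x := by simp [he]
    rw [h6, h7] at h5
    have h8 : x * (x * z - y ^ 2) < 0 := by
      have : y ^ 2 * x + 2 * (y * -x) * y + (-x) ^ 2 * z = x * (x * z - y ^ 2) := by ring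
      rw [← this]
      exact h5
    have h9 : 0 < x * z - y ^ 2 := by
      by_contra h10
      have : 0 ≤ x * (x * z - y ^ 2) := mul_nonneg_of_nonpos_of_nonpos h3.le (not_lt.1 h10)
      linarith
    have : -(x / 2) * -(z / 2) - (-(y / 2)) ^ 2 = (x * z - y ^ 2) / 4 := by ring
    rw [this]
    linarith
  -- These are the entries of the Cholesky factor of `A`: completing the square gives `A 0 0 (ℓ₀ +
  -- (A 0 1 / A 0 0) ℓ₁)² + Δ ℓ₁²`. They are smooth because only positive functions are under the
  -- roots.
  set s₀ : Plane × E → ℝ := fun p => √(A 0 0 p) with hs₀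
  set s₁ : Plane × E → ℝ := fun p => √(A 0 0 p) * (A 0 1 p / A 0 0 p) with hs₁
  set s₂ : Plane × E → ℝ := fun p => √(Δ p) with hs₂
  have hA0ne : ∀ p ∈ N, A 0 0 p ≠ 0 := fun p hp => hp.1.1.ne'
  have hs₀s : ContDiffOn ℝ ∞ s₀ N := (hAs 0 0).contDiffOn.sqrt hA0ne
  have hs₁s : ContDiffOn ℝ ∞ s₁ N :=
    hs₀s.mul ((hAs 0 1).contDiffOn.div (hAs 0 0).contDiffOn hA0ne)
  have hs₂s : ContDiffOn ℝ ∞ s₂ N :=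
    ((hAs 1 1).contDiffOn.sub (((hAs 0 1).contDiffOn.pow 2).div (hAs 0 0).contDiffOn
      hA0ne)).sqrt fun p hp => (hΔpos p hp).ne'
  set ℓ : Fin 2 → Plane × E → ℝ := fun i p => p.1 i - c p.2 i with hℓ
  have hℓs : ∀ i, ContDiff ℝ ∞ (ℓ i) := by
    intro i
    have h3 : ContDiff ℝ ∞ fun p : Plane × E => p.1 i :=
      (contDiff_euclidean.1 contDiff_id i).comp contDiff_fst
    have h4 : ContDiff ℝ ∞ fun p : Plane × E => c p.2 i :=
      (contDiff_euclidean.1 hc i).comp contDiff_snd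
    exact h3.sub h4
  have hℓ0 : ∀ i, ℓ i (0, y₀) = 0 := fun i => by simp [hℓ, hc0]
  have hℓd : ∀ i a, fderiv ℝ (ℓ i) (0, y₀) (a, 0) = a i := by
    intro i a
    have h3 : HasDerivAt (fun t : ℝ => ((t • a, y₀) : Plane × E)) (a, 0) 0 := by
      have h4 : HasDerivAt (fun t : ℝ => t • a) a 0 := by
        simpa using (hasDerivAt_id (0 : ℝ)).smul_const a
      exact h4.prodMk (hasDerivAt_const _ _)
    have h5 : HasFDerivAt (ℓ i) (fderiv ℝ (ℓ i) (0, y₀)) ((0 : ℝ) • a, y₀) := by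
      rw [zero_smul]
      exact ((hℓs i).differentiable (by simp) _).hasFDerivAt
    have h6 := h5.comp_hasDerivAt (0 : ℝ) h3
    have h7 : HasDerivAt (fun t : ℝ => t * a i - c y₀ i) (a i) 0 := by
      simpa using ((hasDerivAt_id (0 : ℝ)).mul_const (a i)).sub_const (c y₀ i)
    exact h6.unique h7
  set β : Plane × E → Plane := fun p =>
    !₂[s₀ p * ℓ 0 p + s₁ p * ℓ 1 p, s₂ p * ℓ 1 p] with hβ
  have hb0 : ContDiffOn ℝ ∞ (fun p => s₀ p * ℓ 0 p + s₁ p * ℓ 1 p) N :=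
    (hs₀s.mul (hℓs 0).contDiffOn).add (hs₁s.mul (hℓs 1).contDiffOn)
  have hb1 : ContDiffOn ℝ ∞ (fun p => s₂ p * ℓ 1 p) N := hs₂s.mul (hℓs 1).contDiffOn
  have hβs : ContDiffOn ℝ ∞ β N := by
    rw [contDiffOn_euclidean]
    intro i
    fin_cases i
    · exact hb0
    · exact hb1
  refine ⟨fun y => ψ (c y, y), β, N, hNo, hN0, hβs, ?_, ?_, ?_⟩
  · intro p hp
    have h3 := hN'exp p.2 hp.2.2 p.1
    rw [EuclideanSpace.norm_sq_eq]
    simp only [hβ, Fin.sum_univ_two, Real.norm_eq_abs, sq_abs]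
    have h4 : s₀ p ^ 2 = A 0 0 p := Real.sq_sqrt hp.1.1.le
    have h5 : s₂ p ^ 2 = Δ p := Real.sq_sqrt (hΔpos p hp).le
    have h6 : s₁ p = s₀ p * (A 0 1 p / A 0 0 p) := rfl
    have h7 := hA0ne p hp
    have h8 : ψ p = ψ (p.1, p.2) := rfl
    rw [h8, h3]
    change _ = _ - ((s₀ p * ℓ 0 p + s₁ p * ℓ 1 p) ^ 2 + (s₂ p * ℓ 1 p) ^ 2)
    have h9 : (s₀ p * ℓ 0 p + s₁ p * ℓ 1 p) ^ 2 + (s₂ p * ℓ 1 p) ^ 2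
        = s₀ p ^ 2 * (ℓ 0 p + A 0 1 p / A 0 0 p * ℓ 1 p) ^ 2 + s₂ p ^ 2 * ℓ 1 p ^ 2 := by
      rw [h6]; ring
    rw [h9, h4, h5]
    simp only [hΔ, hℓ]
    field_simp
    ring
  · simp only [hβ, hℓ0]
    ext i
    fin_cases i <;> simp
  · intro a ha
    have hnhds : N ∈ 𝓝 ((0 : Plane), y₀) := hNo.mem_nhds hN0
    have hdiff : ∀ {s : Plane × E → ℝ}, ContDiffOn ℝ ∞ s N →
        HasFDerivAt s (fderiv ℝ s (0, y₀)) (0, y₀) := fun h =>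
      ((h.contDiffAt hnhds).differentiableAt (by simp)).hasFDerivAt
    -- The coordinates `ℓ i` vanish at the base point, so the derivatives of the Cholesky entries
    -- drop out. The derivative of `β` in the plane variable is the triangular Cholesky matrix with
    -- nonzero diagonal.
    have hmul : ∀ {s : Plane × E → ℝ} (i : Fin 2), ContDiffOn ℝ ∞ s N →
        HasFDerivAt (fun p => s p * ℓ i p) (s (0, y₀) • fderiv ℝ (ℓ i) (0, y₀)) (0, y₀) := by
      intro s i hs
      refine ((hdiff hs).mul (hdiff (hℓs i).contDiffOn)).congr_fderiv ?_
      rw [hℓ0, zero_smul, add_zero]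
    have hβd : HasFDerivAt β (fderiv ℝ β (0, y₀)) (0, y₀) :=
      ((hβs.contDiffAt hnhds).differentiableAt (by simp)).hasFDerivAt
    have hcomp : ∀ i, HasFDerivAt (fun p => β p i)
        ((EuclideanSpace.proj i).comp (fderiv ℝ β (0, y₀))) (0, y₀) := fun i =>
      (EuclideanSpace.proj (𝕜 := ℝ) i).hasFDerivAt.comp _ hβd
    have h3 := congrArg (fun L => L (a, 0)) ((hcomp 0).unique ((hmul 0 hs₀s).add (hmul 1 hs₁s)))
    have h4 := congrArg (fun L => L (a, 0)) ((hcomp 1).unique (hmul 1 hs₂s))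
    simp only [ContinuousLinearMap.comp_apply, ha, map_zero, add_apply,
      smul_apply, hℓd, smul_eq_mul] at h3 h4
    have h5 : s₂ (0, y₀) ≠ 0 := (Real.sqrt_pos.2 (hΔpos _ hN0)).ne'
    have h6 : s₀ (0, y₀) ≠ 0 := (Real.sqrt_pos.2 hN0.1.1).ne'
    have h7 : a 1 = 0 := by
      rcases mul_eq_zero.1 h4.symm with h | h
      · exact absurd h h5
      · exact h
    have h8 : a 0 = 0 := by
      rw [h7, mul_zero, add_zero] at h3
      rcases mul_eq_zero.1 h3.symm with h | h
      · exact absurd h h6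
      · exact h
    ext i
    fin_cases i
    · exact h8
    · exact h7

end Morse

end GRT

namespace GRT

/-! ### Second fundamental forms and the form `N` -/

section Geometry

theorem inner_gradient {φ : Space → ℝ} (x v : Space) :
    inner ℝ (gradient φ x) v = fderiv ℝ φ x v := by
  rw [gradient, InnerProductSpace.toDual_symm_apply]

theorem contDiffAt_gradient {φ : Space → ℝ} {x : Space} (h : ContDiffAt ℝ ∞ φ x) :
    ContDiffAt ℝ ∞ (gradient φ) x := by
  have h1 : ContDiffAt ℝ ∞ (fderiv ℝ φ) x := h.fderiv_right (by simp)
  exact (InnerProductSpace.toDual ℝ Space).symm.contDiff.contDiffAt.comp x h1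

theorem norm_unitNormal {φ : Space → ℝ} {x : Space} (h : gradient φ x ≠ 0) :
    ‖unitNormal φ x‖ = 1 := by
  rw [unitNormal, norm_smul, norm_inv, norm_norm, inv_mul_cancel₀ (norm_ne_zero_iff.2 h)]

theorem norm_smul_unitNormal {φ : Space → ℝ} {x : Space} (h : gradient φ x ≠ 0) :
    ‖gradient φ x‖ • unitNormal φ x = gradient φ x := by
  rw [unitNormal, smul_smul, mul_inv_cancel₀ (norm_ne_zero_iff.2 h), one_smul]

theorem contDiffAt_unitNormal {φ : Space → ℝ} {x : Space} (h : ContDiffAt ℝ ∞ φ x)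
    (h0 : gradient φ x ≠ 0) : ContDiffAt ℝ ∞ (unitNormal φ) x := by
  have h1 := contDiffAt_gradient h
  exact ((h1.norm ℝ h0).inv (norm_ne_zero_iff.2 h0)).smul h1

/-- The second fundamental form of a level surface in terms of the second derivative of the
defining function. -/
theorem secondFundamentalForm_eq {φ : Space → ℝ} {ν x : Space} (h : ContDiffAt ℝ ∞ φ x)
    (h0 : gradient φ x ≠ 0) {u v : Space} (hv : fderiv ℝ φ x v = 0) :
    secondFundamentalForm φ ν x u v =
      -(Real.sign (inner ℝ (gradient φ x) ν) * ‖gradient φ x‖⁻¹ * fderiv ℝ (fderiv ℝ φ) x u v) := by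
  set r : Space → ℝ := fun x' => ‖gradient φ x'‖⁻¹ with hr
  have hrd : HasFDerivAt r (fderiv ℝ r x) x :=
    ((((contDiffAt_gradient h).norm ℝ h0).inv (norm_ne_zero_iff.2 h0)).differentiableAt
      (by simp)).hasFDerivAt
  set s := Real.sign (inner ℝ (gradient φ x) ν) with hs
  have hn : HasFDerivAt (fun x' => s • unitNormal φ x')
      (fderiv ℝ (fun x' => s • unitNormal φ x') x) x :=
    ((((contDiffAt_unitNormal h h0).differentiableAt (by simp)).const_smul s)).hasFDerivAt
  have h1 := hn.inner ℝ (hasFDerivAt_const v x)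
  have hd : HasFDerivAt (fun x' => fderiv ℝ φ x') (fderiv ℝ (fderiv ℝ φ) x) x :=
    ((h.fderiv_right (m := ∞) (by simp)).differentiableAt (by simp)).hasFDerivAt
  have h2 : HasFDerivAt (fun x' => s * (r x' * fderiv ℝ φ x' v)) _ x :=
    (hrd.mul (hd.clm_apply (hasFDerivAt_const v x))).const_mul s
  have h3 : (fun x' => inner ℝ (s • unitNormal φ x') v) = fun x' => s * (r x' * fderiv ℝ φ x' v) := by
    ext x'
    rw [unitNormal, inner_smul_left, inner_smul_left, inner_gradient]
    simp [hr]
  rw [h3] at h1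
  -- The derivative of the normalizing factor `1/|∇φ|` is multiplied by the derivative of `φ` along
  -- the tangent vector `v`, which is zero.
  have h4 := congrArg (fun L => L u) (h1.unique h2)
  simp [hv] at h4
  unfold secondFundamentalForm
  rw [← hs]
  simp only [hr] at h4
  linarith

/-- The chain rule of second order. -/
theorem fderiv_fderiv_comp {φ : Space → ℝ} {X : Plane → Space} {u₀ : Plane}
    (hX : ContDiffAt ℝ ∞ X u₀) (hφ : ContDiffAt ℝ ∞ φ (X u₀)) (a b : Plane) :
    fderiv ℝ (fderiv ℝ (φ ∘ X)) u₀ a b =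
      fderiv ℝ (fderiv ℝ φ) (X u₀) (fderiv ℝ X u₀ a) (fderiv ℝ X u₀ b)
        + fderiv ℝ φ (X u₀) (fderiv ℝ (fderiv ℝ X) u₀ a b) := by
  have hφ' : ∀ᶠ x in 𝓝 (X u₀), DifferentiableAt ℝ φ x :=
    ((hφ.of_le (m := 1) (by simp)).eventually (by simp)).mono
      fun x hx => hx.differentiableAt (by simp)
  have hX' : ∀ᶠ u in 𝓝 u₀, DifferentiableAt ℝ X u :=
    ((hX.of_le (m := 1) (by simp)).eventually (by simp)).mono
      fun x hx => hx.differentiableAt (by simp)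
  have h1 : fderiv ℝ (φ ∘ X) =ᶠ[𝓝 u₀] fun u => (fderiv ℝ φ (X u)).comp (fderiv ℝ X u) := by
    filter_upwards [hX', hX.continuousAt.eventually hφ'] with u hu hu'
    exact fderiv_comp u hu' hu
  have h2 : HasFDerivAt (fderiv ℝ φ) (fderiv ℝ (fderiv ℝ φ) (X u₀)) (X u₀) :=
    ((hφ.fderiv_right (m := ∞) (by simp)).differentiableAt (by simp)).hasFDerivAt
  have h3 : HasFDerivAt (fderiv ℝ X) (fderiv ℝ (fderiv ℝ X) u₀) u₀ :=
    ((hX.fderiv_right (m := ∞) (by simp)).differentiableAt (by simp)).hasFDerivAt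
  have h4 : HasFDerivAt X (fderiv ℝ X u₀) u₀ := (hX.differentiableAt (by simp)).hasFDerivAt
  have h6 : HasFDerivAt (fun u => fderiv ℝ φ (X u))
      ((fderiv ℝ (fderiv ℝ φ) (X u₀)).comp (fderiv ℝ X u₀)) u₀ := h2.comp u₀ h4
  have h5 := h6.clm_comp h3
  rw [h1.fderiv_eq, h5.fderiv]
  simp only [add_apply, ContinuousLinearMap.comp_apply, ContinuousLinearMap.compL_apply,
    ContinuousLinearMap.flip_apply]
  exact add_comm _ _

/-- The difference of the second fundamental forms of two tangent surfaces is the Hessian of the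
defining function of one of them along the other one. -/
theorem formN_eq_hessian {Φ : Space → Space → ℝ} {ρ : Space → ℝ} {y z : Space} {X : Plane → Space}
    {u₀ : Plane} (hX : ContDiffAt ℝ ∞ X u₀) (hXz : X u₀ = z)
    (hΦ : ContDiffAt ℝ ∞ (fun x => Φ x y) z) (hρ : ContDiffAt ℝ ∞ ρ z)
    (hρ0 : gradient ρ z ≠ 0) {l : ℝ} (hl : l ≠ 0) (hgrad : gradX Φ z y = l • unitNormal ρ z)
    (hzero : ∀ᶠ u in 𝓝 u₀, Φ (X u) y = 0) :
    (∀ a, inner ℝ (unitNormal ρ z) (fderiv ℝ X u₀ a) = 0) ∧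
    ∀ a b, formN Φ ρ y z (fderiv ℝ X u₀ a) (fderiv ℝ X u₀ b) =
      ‖gradient ρ z‖⁻¹ * fderiv ℝ (fderiv ℝ (ρ ∘ X)) u₀ a b := by
  subst hXz
  set n := unitNormal ρ (X u₀) with hn
  have hn1 : ‖n‖ = 1 := norm_unitNormal hρ0
  have hgn : ‖gradient ρ (X u₀)‖ ≠ 0 := norm_ne_zero_iff.2 hρ0
  have hDρ : ∀ v, fderiv ℝ ρ (X u₀) v = ‖gradient ρ (X u₀)‖ * inner ℝ n v := fun v => by
    rw [← inner_gradient, ← norm_smul_unitNormal hρ0, inner_smul_left, norm_smul_unitNormal hρ0]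
    rfl
  have hgrad' : gradient (fun x => Φ x y) (X u₀) = l • n := hgrad
  have hDΦ : ∀ v, fderiv ℝ (fun x => Φ x y) (X u₀) v = l * inner ℝ n v := fun v => by
    rw [← inner_gradient, hgrad', inner_smul_left]
    rfl
  have hgΦ0 : gradient (fun x => Φ x y) (X u₀) ≠ 0 := by
    rw [hgrad']
    exact smul_ne_zero hl (norm_ne_zero_iff.1 (by rw [hn1]; exact one_ne_zero))
  have hcomp0 : ((fun x => Φ x y) ∘ X) =ᶠ[𝓝 u₀] fun _ => 0 := hzero
  have htan : ∀ a, inner ℝ n (fderiv ℝ X u₀ a) = 0 := by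
    intro a
    have h1 : HasFDerivAt ((fun x => Φ x y) ∘ X) _ u₀ :=
      ((hΦ.differentiableAt (by simp)).hasFDerivAt).comp u₀
        ((hX.differentiableAt (by simp)).hasFDerivAt)
    have h2 := congrArg (fun L => L a)
      ((h1.congr_of_eventuallyEq hcomp0.symm).unique (hasFDerivAt_const (0 : ℝ) u₀))
    simp only [ContinuousLinearMap.comp_apply, hDΦ, zero_apply] at h2
    exact (mul_eq_zero.1 h2).resolve_left hl
  refine ⟨htan, fun a b => ?_⟩
  -- Since `Φ(·, y)` vanishes along `X`, its second derivative on tangent vectors is `-l ⟨n, D²X(a,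
  -- b)⟩`, so that `II_{S_y}` equals `⟨n, D²X(a, b)⟩`. In the chain rule for `ρ ∘ X` the same term
  -- appears with the factor `|∇ρ|`, next to the second derivative of `ρ` that gives `-|∇ρ| II_S`.
  have h1 := fderiv_fderiv_comp hX hΦ a b
  have h2 := fderiv_fderiv_comp hX hρ a b
  have h3 : fderiv ℝ (fderiv ℝ ((fun x => Φ x y) ∘ X)) u₀ a b = 0 := by
    rw [hcomp0.fderiv.fderiv_eq]
    simp
  rw [h3, hDΦ] at h1
  rw [hDρ] at h2
  have hnn : inner ℝ n n = (1 : ℝ) := by rw [real_inner_self_eq_norm_sq, hn1, one_pow]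
  unfold formN
  rw [secondFundamentalForm_eq hΦ hgΦ0 (by rw [hDΦ, htan, mul_zero]),
    secondFundamentalForm_eq hρ hρ0 (by rw [hDρ, htan, mul_zero]), ← hn, h2]
  have h4 : inner ℝ (gradient ρ (X u₀)) n = ‖gradient ρ (X u₀)‖ := by
    rw [inner_gradient, hDρ, hnn, mul_one]
  have h5 : inner ℝ (gradient (fun x => Φ x y) (X u₀)) n = l := by
    rw [inner_gradient, hDΦ, hnn, mul_one]
  have h6 : ‖gradient (fun x => Φ x y) (X u₀)‖ = |l| := by
    rw [hgrad', norm_smul, hn1, mul_one, Real.norm_eq_abs]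
  -- The orientation sign in the second fundamental form compensates the sign of `l`, so the
  -- direction of the gradient of `Φ` plays no role.
  have h7 : l.sign * |l|⁻¹ = l⁻¹ := by
    rcases lt_or_gt_of_ne hl with h | h
    · rw [Real.sign_of_neg h, abs_of_neg h, inv_neg]; ring
    · rw [Real.sign_of_pos h, abs_of_pos h, one_mul]
  rw [h4, h5, h6, h7, Real.sign_of_pos (lt_of_le_of_ne (norm_nonneg _) hgn.symm)]
  field_simp
  linear_combination ‖gradient ρ (X u₀)‖ * h1

/-- The range of `L` lies in the plane orthogonal to `n`, and both are two-dimensional. -/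
theorem exists_eq_of_inner_eq_zero {L : Plane →L[ℝ] Space} (hL : Function.Injective L) {n : Space}
    (hn : ‖n‖ = 1) (ht : ∀ a, inner ℝ n (L a) = 0) {v : Space} (hv : inner ℝ n v = 0) :
    ∃ a, L a = v := by
  have hn0 : n ≠ 0 := norm_ne_zero_iff.1 (by rw [hn]; exact one_ne_zero)
  have h1 : (L : Plane →ₗ[ℝ] Space).range ≤ (ℝ ∙ n)ᗮ := by
    rintro _ ⟨a, rfl⟩
    exact (Submodule.mem_orthogonal_singleton_iff_inner_right).2 (ht a)
  have hfact : Fact (Module.finrank ℝ Space = 2 + 1) := ⟨by simp⟩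
  have h2 : (L : Plane →ₗ[ℝ] Space).range = (ℝ ∙ n)ᗮ := by
    refine Submodule.eq_of_le_of_finrank_eq h1 ?_
    rw [Submodule.finrank_orthogonal_span_singleton (n := 2) hn0,
      LinearMap.finrank_range_of_inj hL, finrank_euclideanSpace_fin]
  have h3 : v ∈ (L : Plane →ₗ[ℝ] Space).range := by
    rw [h2]
    exact (Submodule.mem_orthogonal_singleton_iff_inner_right).2 hv
  exact h3

/-- The matrix of the form `N` in an orthonormal basis, if this form is conformal in some
parametrization of the tangent plane. -/
theorem matrixN_of_conformal {Φ : Space → Space → ℝ} {ρ : Space → ℝ} {y z : Space}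
    {L : Plane →L[ℝ] Space} (hL : Function.Injective L) {n : Space} (hn : ‖n‖ = 1)
    (ht : ∀ a, inner ℝ n (L a) = 0) {k : ℝ} (hk : 0 < k)
    (hN : ∀ a b, formN Φ ρ y z (L a) (L b) = -(k * inner ℝ a b)) {e : Fin 2 → Space}
    (he : Orthonormal ℝ e) (hne : ∀ i, inner ℝ n (e i) = 0) :
    (matrixN Φ ρ y z e).IsSymm ∧ (-matrixN Φ ρ y z e).PosDef ∧
      √(matrixN Φ ρ y z e).det = k / areaFactor L := by
  choose a ha using fun i => exists_eq_of_inner_eq_zero hL hn ht (hne i)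
  have hM : matrixN Φ ρ y z e = -(k • Matrix.gram ℝ a) := by
    ext i j
    simp [matrixN, ← ha, hN]
  have hlin : LinearIndependent ℝ a := by
    have h1 : LinearIndependent ℝ ((L : Plane →ₗ[ℝ] Space) ∘ a) := by
      rw [show (L : Plane →ₗ[ℝ] Space) ∘ a = e from funext ha]
      exact he.linearIndependent
    exact h1.of_comp _
  refine ⟨?_, ?_, ?_⟩
  · rw [hM]
    ext i j
    simp [real_inner_comm]
  · rw [hM, neg_neg]
    exact (Matrix.posDef_gram_of_linearIndependent hlin).smul hk
  -- The rows of `P` are the coordinates of the `L`-preimages of the orthonormal vectors.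
  -- Orthonormality reads `P · Gram(L) · Pᵀ = 1`, so `(det P)²` is the inverse of `gramDet L`, while
  -- `det N = k² (det P)²`.
  · set P : Matrix (Fin 2) (Fin 2) ℝ := Matrix.of fun i j => a i j with hP
    have h1 : (Matrix.gram ℝ a).det = P.det ^ 2 := by
      have : Matrix.gram ℝ a = P * P.transpose := by
        ext i j
        simp [Matrix.mul_apply, hP, PiLp.inner_apply, mul_comm]
      rw [this, Matrix.det_mul, Matrix.det_transpose, sq]
    have h2 : P.det ^ 2 * gramDet L = 1 := by
      have h3 : P * (Matrix.gram ℝ fun i => L (EuclideanSpace.basisFun (Fin 2) ℝ i)) * P.transpose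
          = 1 := by
        rw [← Matrix.gram_eq_one_iff_orthonormal.2 he]
        ext i j
        have h4 : ∀ i, e i = a i 0 • L (EuclideanSpace.basisFun (Fin 2) ℝ 0)
            + a i 1 • L (EuclideanSpace.basisFun (Fin 2) ℝ 1) := fun i => by
          rw [← L.map_smul, ← L.map_smul, ← L.map_add, ← plane_decomp, ha]
        rw [Matrix.gram_apply, h4 i, h4 j]
        simp only [Matrix.mul_apply, Fin.sum_univ_two, hP, Matrix.of_apply, Matrix.transpose_apply,
          Matrix.gram_apply, inner_add_left, inner_add_right, inner_smul_left, inner_smul_right,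
          conj_trivial]
        ring
      have h4 := congrArg Matrix.det h3
      rw [Matrix.det_mul, Matrix.det_mul, Matrix.det_transpose, Matrix.det_one] at h4
      rw [gramDet]
      linarith
    have hpos := areaFactor_pos hL
    rw [← areaFactor_sq] at h2
    have h3 : (matrixN Φ ρ y z e).det = (k / areaFactor L) ^ 2 := by
      rw [hM, Matrix.det_neg, Matrix.det_smul, h1]
      simp only [Fintype.card_fin]
      field_simp
      linear_combination h2
    rw [h3, Real.sqrt_sq (by positivity)]

end Geometry

end GRT

namespace GRT

/-! ### Morse charts on the surfaces `S_y` -/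

section Chart

theorem fderiv_slice_fst {E₁ E₂ F : Type*} [NormedAddCommGroup E₁] [NormedSpace ℝ E₁]
    [NormedAddCommGroup E₂] [NormedSpace ℝ E₂] [NormedAddCommGroup F] [NormedSpace ℝ F]
    {f : E₁ × E₂ → F} {x : E₁} {y : E₂} (h : DifferentiableAt ℝ f (x, y)) (a : E₁) :
    fderiv ℝ (fun x' => f (x', y)) x a = fderiv ℝ f (x, y) (a, 0) := by
  have h1 : HasFDerivAt (fun x' : E₁ => (x', y)) (ContinuousLinearMap.inl ℝ E₁ E₂) x :=
    (hasFDerivAt_id x).prodMk (hasFDerivAt_const y x)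
  have h2 : HasFDerivAt (fun x' => f (x', y)) _ x := h.hasFDerivAt.comp x h1
  rw [h2.fderiv]
  rfl

theorem fderiv_slice_snd {E₁ E₂ F : Type*} [NormedAddCommGroup E₁] [NormedSpace ℝ E₁]
    [NormedAddCommGroup E₂] [NormedSpace ℝ E₂] [NormedAddCommGroup F] [NormedSpace ℝ F]
    {f : E₁ × E₂ → F} {x : E₁} {y : E₂} (h : DifferentiableAt ℝ f (x, y)) (b : E₂) :
    fderiv ℝ (fun y' => f (x, y')) y b = fderiv ℝ f (x, y) (0, b) := by
  have h1 : HasFDerivAt (fun y' : E₂ => (x, y')) (ContinuousLinearMap.inr ℝ E₁ E₂) y :=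
    (hasFDerivAt_const x y).prodMk (hasFDerivAt_id y)
  have h2 : HasFDerivAt (fun y' => f (x, y')) _ y := h.hasFDerivAt.comp y h1
  rw [h2.fderiv]
  rfl

theorem hessFst_eq_slice {ψ : Plane × Space → ℝ} (hψ : ContDiff ℝ ∞ ψ) (w : Plane) (y : Space)
    (a b : Plane) :
    hessFst ψ (w, y) a b = fderiv ℝ (fderiv ℝ fun w' => ψ (w', y)) w a b := by
  have hd : ∀ p, DifferentiableAt ℝ ψ p := fun p => hψ.differentiable (by simp) p
  have h1 : (fderiv ℝ fun w' => ψ (w', y)) =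
      fun w' => (fderiv ℝ ψ (w', y)).comp (ContinuousLinearMap.inl ℝ Plane Space) := by
    funext w'
    ext c
    rw [fderiv_slice_fst (hd _)]
    rfl
  have h2 : DifferentiableAt ℝ (fderiv ℝ ψ) (w, y) :=
    (hψ.fderiv_right (m := ∞) (by simp)).differentiable (by simp) _
  have h3 : HasFDerivAt (fun w' : Plane => (w', y)) (ContinuousLinearMap.inl ℝ Plane Space) w :=
    (hasFDerivAt_id w).prodMk (hasFDerivAt_const y w)
  have h4 : HasFDerivAt (fun w' : Plane => fderiv ℝ ψ (w', y))
      ((fderiv ℝ (fderiv ℝ ψ) (w, y)).comp (ContinuousLinearMap.inl ℝ Plane Space)) w :=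
    h2.hasFDerivAt.comp w h3
  have h5 := h4.clm_comp (hasFDerivAt_const (ContinuousLinearMap.inl ℝ Plane Space) w)
  rw [h1, h5.fderiv]
  simp [hessFst]

/-- An isometric parametrization `ι` of the plane orthogonal to a unit vector `n`, together with
the orthogonal projection `κ`. -/
structure IsPlaneFrame (n : Space) (ι : Plane →L[ℝ] Space) (κ : Space →L[ℝ] Plane) : Prop where
  norm_eq_one : ‖n‖ = 1
  inner_eq_zero : ∀ w, inner ℝ n (ι w) = 0
  left_inv : ∀ w, κ (ι w) = w
  map_normal : κ n = 0
  decomp : ∀ x, ι (κ x) + inner ℝ n x • n = x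

theorem exists_isPlaneFrame {n : Space} (hn : ‖n‖ = 1) : ∃ ι κ, IsPlaneFrame n ι κ := by
  have hn0 : n ≠ 0 := norm_ne_zero_iff.1 (by rw [hn]; exact one_ne_zero)
  have hfact : Fact (Module.finrank ℝ Space = 2 + 1) := ⟨by simp⟩
  set e := OrthonormalBasis.fromOrthogonalSpanSingleton 2 hn0 (𝕜 := ℝ) with he
  set ι : Plane →L[ℝ] Space := (ℝ ∙ n)ᗮ.subtypeL ∘L
    (e.repr.symm.toContinuousLinearEquiv : Plane →L[ℝ] (ℝ ∙ n)ᗮ) with hι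
  set κ : Space →L[ℝ] Plane := (e.repr.toContinuousLinearEquiv : (ℝ ∙ n)ᗮ →L[ℝ] Plane) ∘L
    (ℝ ∙ n)ᗮ.orthogonalProjectionOnto with hκ
  refine ⟨ι, κ, hn, fun w => ?_, fun w => ?_, ?_, fun x => ?_⟩
  · exact Submodule.mem_orthogonal_singleton_iff_inner_right.1 (e.repr.symm w).2
  · simp [hι, hκ]
  · simp [hκ]
  · have h1 := Submodule.starProjection_add_starProjection_orthogonal (K := ℝ ∙ n) x
    rw [Submodule.starProjection_singleton, hn] at h1
    have h2 : ι (κ x) = (ℝ ∙ n)ᗮ.starProjection x := by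
      simp [hι, hκ]
    rw [h2, add_comm]
    simpa using h1

theorem IsPlaneFrame.inner_self {n : Space} {ι κ} (h : IsPlaneFrame n ι κ) :
    inner ℝ n n = (1 : ℝ) := by
  rw [real_inner_self_eq_norm_sq, h.norm_eq_one, one_pow]

theorem fderiv_slice_eq_inner {U V : Set Space} (hU : IsOpen U) (hV : IsOpen V)
    {Φ : Space → Space → ℝ} (hΦ : ContDiffOn ℝ ∞ (Function.uncurry Φ) (U ×ˢ V)) {x y : Space}
    (hx : x ∈ U) (hy : y ∈ V) (a : Space) :
    fderiv ℝ (Function.uncurry Φ) (x, y) (a, 0) = inner ℝ (gradX Φ x y) a := by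
  have h : DifferentiableAt ℝ (Function.uncurry Φ) (x, y) :=
    (hΦ.contDiffAt ((hU.prod hV).mem_nhds ⟨hx, hy⟩)).differentiableAt (by simp)
  rw [gradX, inner_gradient, ← fderiv_slice_fst h]
  rfl

/-- The surfaces `S_y` as graphs over a common plane. -/
theorem exists_graph {U V : Set Space} (hU : IsOpen U) (hV : IsOpen V)
    {Φ : Space → Space → ℝ} (hΦ : ContDiffOn ℝ ∞ (Function.uncurry Φ) (U ×ˢ V)) {x₀ y₀ : Space}
    (hx₀ : x₀ ∈ U) (hy₀ : y₀ ∈ V) (h0 : Φ x₀ y₀ = 0) {n : Space} {ι κ} (hn : IsPlaneFrame n ι κ)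
    {l : ℝ} (hl : l ≠ 0) (hgrad : gradX Φ x₀ y₀ = l • n) :
    ∃ (ξ : Plane × Space → Space) (W : Set (Plane × Space)) (A : Set Space), IsOpen W ∧
      (0, y₀) ∈ W ∧ A ∈ 𝓝 x₀ ∧ ContDiffOn ℝ ∞ ξ W ∧ ξ (0, y₀) = x₀ ∧
      (∀ p ∈ W, ξ p ∈ U ∧ p.2 ∈ V ∧ Φ (ξ p) p.2 = 0 ∧ κ (ξ p - x₀) = p.1) ∧
      ∀ x ∈ A, ∀ y, (κ (x - x₀), y) ∈ W → Φ x y = 0 → x = ξ (κ (x - x₀), y) := by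
  -- In the coordinates `x₀ + ι w + t n` the derivative of `Φ` in the height `t` at the base point
  -- is `⟨l n, n⟩ = l ≠ 0`, so the equation of `S_y` can be solved for `t`.
  set A : (Plane × Space) × ℝ → Space × Space :=
    fun q => (x₀ + ι q.1.1 + q.2 • n, q.1.2) with hA
  have hAs : ContDiff ℝ ∞ A :=
    ((contDiff_const.add (ι.contDiff.comp (contDiff_fst.comp contDiff_fst))).add
      (contDiff_snd.smul contDiff_const)).prodMk (contDiff_snd.comp contDiff_fst)
  have hUV : IsOpen (U ×ˢ V) := hU.prod hV
  have hΩ : IsOpen (A ⁻¹' (U ×ˢ V)) := hUV.preimage hAs.continuous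
  have hA0 : A ((0, y₀), 0) = (x₀, y₀) := by simp [hA]
  have hfs : ContDiffOn ℝ ∞ (fun q => Function.uncurry Φ (A q)) (A ⁻¹' (U ×ˢ V)) :=
    hΦ.comp hAs.contDiffOn fun q hq => hq
  have hinv : (fderiv ℝ (fun q => Function.uncurry Φ (A q)) ((0, y₀), 0) ∘L
      .inr ℝ (Plane × Space) ℝ).IsInvertible := by
    refine isInvertible_of_injective (by simp) fun t ht => ?_
    have h1 : HasFDerivAt (Function.uncurry Φ) (fderiv ℝ (Function.uncurry Φ) (x₀, y₀))
        (A ((0, y₀), 0)) := by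
      rw [hA0]
      exact ((hΦ.contDiffAt (hUV.mem_nhds ⟨hx₀, hy₀⟩)).differentiableAt (by simp)).hasFDerivAt
    have h2 : HasFDerivAt (fun t : ℝ => A ((0, y₀), t))
        ((ContinuousLinearMap.toSpanSingleton ℝ n).prod 0) 0 := by
      have h3 : HasFDerivAt (fun t : ℝ => x₀ + ι 0 + t • n)
          (ContinuousLinearMap.toSpanSingleton ℝ n) 0 :=
        ((ContinuousLinearMap.toSpanSingleton ℝ n).hasFDerivAt (x := (0 : ℝ))).const_add (x₀ + ι 0)
      exact h3.prodMk (hasFDerivAt_const y₀ (0 : ℝ))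
    have h4 : HasFDerivAt (fun t : ℝ => Function.uncurry Φ (A ((0, y₀), t))) _ 0 :=
      HasFDerivAt.comp (g := Function.uncurry Φ) (f := fun t : ℝ => A ((0, y₀), t)) (0 : ℝ) h1 h2
    have h5 := fderiv_slice_snd ((hfs.contDiffAt (hΩ.mem_nhds (x := ((0, y₀), (0 : ℝ)))
      (by rw [mem_preimage, hA0]; exact ⟨hx₀, hy₀⟩))).differentiableAt (by simp)) t
    rw [h4.fderiv] at h5
    have h6 : fderiv ℝ (Function.uncurry Φ) (x₀, y₀) (t • n, 0) = 0 := by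
      refine Eq.trans ?_ (h5.trans ht)
      simp
    rw [fderiv_slice_eq_inner hU hV hΦ hx₀ hy₀, hgrad, inner_smul_left, inner_smul_right,
      hn.inner_self] at h6
    simpa [hl] using h6
  obtain ⟨τ, W, T, hW, hW0, hT, hT0, hWT, hτ, hτ0, hmaps, hiff⟩ :=
    exists_contDiffOn_implicit (f := fun q => Function.uncurry Φ (A q)) hΩ hfs
      (a := (0, y₀)) (b := (0 : ℝ)) (by rw [mem_preimage, hA0]; exact ⟨hx₀, hy₀⟩)
      (by rw [hA0]; exact h0) hinv
  have hcont : Continuous fun x : Space => (inner ℝ n (x - x₀) : ℝ) := by fun_prop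
  refine ⟨fun p => x₀ + ι p.1 + τ p • n, W, (fun x => inner ℝ n (x - x₀)) ⁻¹' T, hW, hW0,
    hcont.continuousAt (by simpa using hT.mem_nhds hT0), ?_, ?_, fun p hp => ?_, ?_⟩
  · exact (contDiff_const.add (ι.contDiff.comp contDiff_fst)).contDiffOn.add
      (hτ.smul contDiffOn_const)
  · simp [hτ0]
  · have h1 : A (p, τ p) ∈ U ×ˢ V := hWT ⟨hp, hmaps hp⟩
    refine ⟨h1.1, h1.2, (hiff p hp _ (hmaps hp)).2 rfl, ?_⟩
    change κ (x₀ + ι p.1 + τ p • n - x₀) = p.1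
    rw [add_assoc, add_sub_cancel_left, map_add, hn.left_inv, map_smul, hn.map_normal, smul_zero,
      add_zero]
  · intro x hx y hxy h
    have h1 : x₀ + ι (κ (x - x₀)) + (inner ℝ n (x - x₀) : ℝ) • n = x := by
      rw [add_assoc, hn.decomp, add_sub_cancel]
    have h2 := (hiff _ hxy _ hx).1 (by simp only [hA, h1]; exact h)
    change x = x₀ + ι (κ (x - x₀)) + τ (κ (x - x₀), y) • n
    rw [← h2, h1]

/-- A parametrization `X (·, y)` of the surfaces `S_y` near a point, in which the defining function
`ρ` of a tangent surface has the form `v y - ‖u‖ ^ 2`. -/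
structure IsMorseChart (U V : Set Space) (Φ : Space → Space → ℝ) (O : Set Space) (ρ : Space → ℝ)
    (x₀ y₀ : Space) (X : Plane × Space → Space) (v : Space → ℝ) (r : ℝ) (V₂ B₀ : Set Space) :
    Prop where
  pos : 0 < r
  isOpen_param : IsOpen V₂
  mem_param : y₀ ∈ V₂
  param_subset : V₂ ⊆ V
  isOpen_base : IsOpen B₀
  mem_base : x₀ ∈ B₀
  base_subset : B₀ ⊆ U ∩ O
  smooth : ContDiffOn ℝ ∞ X (Metric.ball 0 r ×ˢ V₂)
  apply_zero : X (0, y₀) = x₀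
  injOn : ∀ y ∈ V₂, InjOn (fun u => X (u, y)) (Metric.ball 0 r)
  immersion : ∀ y ∈ V₂, ∀ u ∈ Metric.ball 0 r,
    Function.Injective (fderiv ℝ (fun u' => X (u', y)) u)
  incidence : ∀ y ∈ V₂, ∀ u ∈ Metric.ball 0 r, X (u, y) ∈ U ∩ O ∧ Φ (X (u, y)) y = 0 ∧
    ρ (X (u, y)) = v y - ‖u‖ ^ 2
  surjOn : ∀ y ∈ V₂, ∀ x ∈ B₀, Φ x y = 0 → ∃ u ∈ Metric.ball 0 (r / 2), X (u, y) = x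

/-- In suitable coordinates, the defining function of a surface has a nondegenerate maximum along
the tangent surfaces `S_y`. -/
theorem exists_morse_chart {U V : Set Space} (hU : IsOpen U) (hV : IsOpen V)
    {Φ : Space → Space → ℝ} (hΦ : ContDiffOn ℝ ∞ (Function.uncurry Φ) (U ×ˢ V)) {x₀ y₀ : Space}
    (hx₀ : x₀ ∈ U) (hy₀ : y₀ ∈ V) (h0 : Φ x₀ y₀ = 0) {O : Set Space} (hO : IsOpen O)
    (hxO : x₀ ∈ O) {ρ : Space → ℝ} (hρ : ContDiffOn ℝ ∞ ρ O) (hρ0 : gradient ρ x₀ ≠ 0) {l : ℝ}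
    (hl : l ≠ 0) (hgrad : gradX Φ x₀ y₀ = l • unitNormal ρ x₀)
    (hN : ∀ u : Space, u ≠ 0 → inner ℝ (unitNormal ρ x₀) u = 0 → formN Φ ρ y₀ x₀ u u < 0) :
    ∃ (X : Plane × Space → Space) (v : Space → ℝ) (r : ℝ) (V₂ B₀ : Set Space),
      IsMorseChart U V Φ O ρ x₀ y₀ X v r V₂ B₀ := by
  obtain ⟨ι, κ, hfr⟩ := exists_isPlaneFrame (norm_unitNormal hρ0)
  obtain ⟨ξ, W, A, hW, hW0, hA, hξ, hξ0, hξp, hξu⟩ :=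
    exists_graph hU hV hΦ hx₀ hy₀ h0 hfr hl hgrad
  -- the function `ρ` on the surfaces
  have hW1 : IsOpen (W ∩ ξ ⁻¹' O) := hξ.continuousOn.isOpen_inter_preimage hW hO
  have hW10 : ((0 : Plane), y₀) ∈ W ∩ ξ ⁻¹' O := ⟨hW0, by rw [mem_preimage, hξ0]; exact hxO⟩
  have hψ0 : ContDiffOn ℝ ∞ (fun p => ρ (ξ p)) (W ∩ ξ ⁻¹' O) :=
    hρ.comp (hξ.mono inter_subset_left) fun p hp => hp.2
  obtain ⟨ψ, hψ, -, N₀, hN₀, hN₀0, hN₀W, hψeq⟩ := exists_smooth_extension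
    (isCompact_singleton (x := ((0 : Plane), y₀))) hW1 (singleton_subset_iff.2 hW10) hψ0
  have hN₀0' : ((0 : Plane), y₀) ∈ N₀ := hN₀0 rfl
  have hslice : Continuous fun w : Plane => (w, y₀) := by fun_prop
  have hξat : ContDiffAt ℝ ∞ (fun w : Plane => ξ (w, y₀)) 0 :=
    (hξ.contDiffAt (hW.mem_nhds hW0)).comp (0 : Plane) (contDiff_id.prodMk contDiff_const).contDiffAt
  have hψsl : (fun w => ψ (w, y₀)) =ᶠ[𝓝 0] ρ ∘ fun w => ξ (w, y₀) := by
    filter_upwards [hslice.continuousAt (hN₀.mem_nhds hN₀0')] with w hw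
    exact hψeq _ hw
  have hρat : ContDiffAt ℝ ∞ ρ x₀ := hρ.contDiffAt (hO.mem_nhds hxO)
  have hΦat : ContDiffAt ℝ ∞ (fun x => Φ x y₀) x₀ :=
    ContDiffAt.comp x₀ (g := Function.uncurry Φ) (f := fun x => (x, y₀))
      (hΦ.contDiffAt ((hU.prod hV).mem_nhds ⟨hx₀, hy₀⟩))
      (contDiff_id.prodMk contDiff_const).contDiffAt
  obtain ⟨htan, hform⟩ := formN_eq_hessian (X := fun w => ξ (w, y₀)) (u₀ := 0) hξat hξ0 hΦat hρat
    hρ0 hl hgrad (by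
      filter_upwards [hslice.continuousAt (hW.mem_nhds hW0)] with w hw
      exact (hξp _ hw).2.2.1)
  -- The projection of a graph to its base plane is the identity. Hence the derivative of the graph
  -- map is injective, and the negativity of `N` passes to the Hessian of `ψ`.
  have hκD : ∀ a, κ (fderiv ℝ (fun w => ξ (w, y₀)) 0 a) = a := by
    intro a
    have h1 : HasFDerivAt (fun w => κ (ξ (w, y₀) - x₀)) _ (0 : Plane) :=
      κ.hasFDerivAt.comp (0 : Plane) ((hξat.differentiableAt (by simp)).hasFDerivAt.sub_const x₀)
    have h2 : (fun w => κ (ξ (w, y₀) - x₀)) =ᶠ[𝓝 0] id := by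
      filter_upwards [hslice.continuousAt (hW.mem_nhds hW0)] with w hw
      exact (hξp _ hw).2.2.2
    exact congrArg (fun L => L a) ((h1.congr_of_eventuallyEq h2.symm).unique (hasFDerivAt_id _))
  have hD1 : ∀ a, fderiv ℝ ψ (0, y₀) (a, 0) = 0 := by
    intro a
    rw [← fderiv_slice_fst (hψ.differentiable (by simp) _), hψsl.fderiv_eq,
      fderiv_comp (0 : Plane) (by rw [hξ0]; exact hρat.differentiableAt (by simp))
        (hξat.differentiableAt (by simp)), hξ0, ContinuousLinearMap.comp_apply, ← inner_gradient,
      ← norm_smul_unitNormal hρ0, inner_smul_left, htan, mul_zero]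
  have hD2 : ∀ a, a ≠ 0 → hessFst ψ (0, y₀) a a < 0 := by
    intro a ha
    rw [hessFst_eq_slice hψ, hψsl.fderiv.fderiv_eq]
    have h1 := hN (fderiv ℝ (fun w => ξ (w, y₀)) 0 a)
      (fun h => ha (by rw [← hκD a, h, map_zero])) (htan a)
    rw [hform] at h1
    exact (pos_iff_neg_of_mul_neg h1).1 (inv_pos.2 (norm_pos_iff.2 hρ0))
  obtain ⟨v, β, N, hNo, hN0, hβ, hβψ, hβ0, hβinj⟩ := exists_morse_normal_form hψ hD1 hD2
  -- inversion of `β`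
  set f : (Plane × Space) × Plane → Plane := fun q => β (q.2, q.1.2) - q.1.1 with hf
  set σ : (Plane × Space) × Plane → Plane × Space := fun q => (q.2, q.1.2) with hσ
  have hσs : ContDiff ℝ ∞ σ := contDiff_snd.prodMk (contDiff_snd.comp contDiff_fst)
  set Ω : Set ((Plane × Space) × Plane) := σ ⁻¹' (N ∩ N₀) with hΩdef
  have hΩ : IsOpen Ω := (hNo.inter hN₀).preimage hσs.continuous
  have hfs : ContDiffOn ℝ ∞ f Ω :=
    (hβ.comp hσs.contDiffOn fun q hq => hq.1).sub (contDiff_fst.comp contDiff_fst).contDiffOn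
  have hΩ0 : (((0 : Plane), y₀), (0 : Plane)) ∈ Ω := ⟨hN0, hN₀0'⟩
  have hβd : DifferentiableAt ℝ β (0, y₀) :=
    (hβ.contDiffAt (hNo.mem_nhds hN0)).differentiableAt (by simp)
  have hinv : (fderiv ℝ f ((0, y₀), 0) ∘L .inr ℝ (Plane × Space) Plane).IsInvertible := by
    refine isInvertible_of_injective rfl fun a ha => hβinj a ?_
    refine Eq.trans ?_ ha
    rw [ContinuousLinearMap.comp_apply, ContinuousLinearMap.inr_apply,
      ← fderiv_slice_snd ((hfs.contDiffAt (hΩ.mem_nhds hΩ0)).differentiableAt (by simp)),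
      ← fderiv_slice_fst hβd]
    simp [hf]
  obtain ⟨γ, W₂, T, hW₂, hW₂0, hT, hT0, hWT, hγ, hγ0, hmaps, hiff⟩ :=
    exists_contDiffOn_implicit hΩ hfs hΩ0 (by simp [hf, hβ0]) hinv
  have hγmem : ∀ p ∈ W₂, (γ p, p.2) ∈ N ∧ (γ p, p.2) ∈ N₀ := fun p hp =>
    hWT (mk_mem_prod hp (hmaps hp))
  have hγβ : ∀ p ∈ W₂, β (γ p, p.2) = p.1 := fun p hp =>
    sub_eq_zero.1 ((hiff p hp _ (hmaps hp)).2 rfl)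
  obtain ⟨R₁, hR₁, V', hV', hRV⟩ := mem_nhds_prod_iff.1 (hW₂.mem_nhds hW₂0)
  obtain ⟨r, hr, hrR⟩ := Metric.mem_nhds_iff.1 hR₁
  -- points near `x₀` are in the image of the chart
  have hnear : ∀ᶠ q : Space × Space in 𝓝 (x₀, y₀), (κ (q.1 - x₀), q.2) ∈ N ∩ N₀ ∧
      κ (q.1 - x₀) ∈ T ∧ β (κ (q.1 - x₀), q.2) ∈ Metric.ball 0 (r / 2) ∧ q.1 ∈ A ∧
      q.1 ∈ U ∩ O := by
    have hc : Continuous fun q : Space × Space => (κ (q.1 - x₀), q.2) := by fun_prop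
    have hc' : Continuous fun q : Space × Space => κ (q.1 - x₀) := by fun_prop
    have h1 := hc.continuousAt (x := (x₀, y₀))
    have h2 := hc'.continuousAt (x := (x₀, y₀))
    have h3 : ContinuousAt (fun q : Space × Space => β (κ (q.1 - x₀), q.2)) (x₀, y₀) := by
      refine ContinuousAt.comp (g := β) (f := fun q : Space × Space => (κ (q.1 - x₀), q.2)) ?_ h1
      simpa using hβd.continuousAt
    have e1 : ∀ᶠ q : Space × Space in 𝓝 (x₀, y₀), (κ (q.1 - x₀), q.2) ∈ N ∩ N₀ :=
      h1.eventually_mem (by simpa using And.intro (hNo.mem_nhds hN0) (hN₀.mem_nhds hN₀0'))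
    have e2 : ∀ᶠ q : Space × Space in 𝓝 (x₀, y₀), κ (q.1 - x₀) ∈ T :=
      h2.eventually_mem (by simpa using hT.mem_nhds hT0)
    -- The radius `r / 2` instead of `r` leaves a margin, so that densities supported over `B₀` can
    -- be cut off inside the parameter ball.
    have e3 : ∀ᶠ q : Space × Space in 𝓝 (x₀, y₀),
        β (κ (q.1 - x₀), q.2) ∈ Metric.ball 0 (r / 2) :=
      h3.eventually_mem (by simpa [hβ0] using Metric.ball_mem_nhds (0 : Plane) (half_pos hr))
    have e4 : ∀ᶠ q : Space × Space in 𝓝 (x₀, y₀), q.1 ∈ A :=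
      continuousAt_fst.eventually_mem hA
    have e5 : ∀ᶠ q : Space × Space in 𝓝 (x₀, y₀), q.1 ∈ U ∩ O :=
      continuousAt_fst.eventually_mem ((hU.inter hO).mem_nhds ⟨hx₀, hxO⟩)
    filter_upwards [e1, e2, e3, e4, e5] with q i1 i2 i3 i4 i5
    exact ⟨i1, i2, i3, i4, i5⟩
  obtain ⟨B₁, hB₁, V'', hV'', hBV⟩ := mem_nhds_prod_iff.1 hnear
  obtain ⟨B₀, hB₀sub, hB₀, hB₀0⟩ := mem_nhds_iff.1 hB₁
  obtain ⟨V₂, hV₂sub, hV₂, hV₂0⟩ := mem_nhds_iff.1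
    (inter_mem (inter_mem hV' hV'') (hV.mem_nhds hy₀))
  have hdom : ∀ y ∈ V₂, ∀ u ∈ Metric.ball (0 : Plane) r, (u, y) ∈ W₂ := fun y hy u hu =>
    hRV ⟨hrR hu, (hV₂sub hy).1.1⟩
  have hγs : ContDiffOn ℝ ∞ (fun p => (γ p, p.2)) W₂ := hγ.prodMk contDiff_snd.contDiffOn
  -- The chart is the graph map precomposed with the inverse `γ` of the Morse coordinates: from `β
  -- (γ (u, y), y) = u` one gets `ρ = v y - ‖u‖²` along it.
  refine ⟨fun p => ξ (γ p, p.2), v, r, V₂, B₀, hr, hV₂, hV₂0, fun y hy => (hV₂sub hy).2, hB₀,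
    hB₀0, ?_, ?_, ?_, ?_, ?_, ?_, ?_⟩
  · intro x hx
    exact (hBV (mk_mem_prod (hB₀sub hx) (mem_of_mem_nhds hV''))).2.2.2.2
  · exact (hξ.comp hγs fun p hp => (hN₀W (hγmem p hp).2).1).mono
      fun p hp => hdom _ hp.2 _ hp.1
  · simp only [hγ0, hξ0]
  · intro y hy u hu u' hu' h
    have h1 := (hξp _ (hN₀W (hγmem _ (hdom y hy u hu)).2).1).2.2.2
    have h2 := (hξp _ (hN₀W (hγmem _ (hdom y hy u' hu')).2).1).2.2.2
    have h3 : γ (u, y) = γ (u', y) := by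
      exact h1.symm.trans ((congrArg (fun x => κ (x - x₀)) h).trans h2)
    have h4 := hγβ _ (hdom y hy u hu)
    have h5 := hγβ _ (hdom y hy u' hu')
    simp only [h3] at h4
    exact h4.symm.trans h5
  · intro y hy u hu
    rw [injective_iff_map_eq_zero]
    intro a ha
    have hsl : Continuous fun u' : Plane => (u', y) := by fun_prop
    have hev : ∀ᶠ u' in 𝓝 u, (u', y) ∈ W₂ := hsl.continuousAt (hW₂.mem_nhds (hdom y hy u hu))
    have hγat : ContDiffAt ℝ ∞ (fun u' => γ (u', y)) u :=
      ContDiffAt.comp u (g := γ) (f := fun u' => (u', y))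
        (hγ.contDiffAt (hW₂.mem_nhds (hdom y hy u hu)))
        (contDiff_id.prodMk contDiff_const).contDiffAt
    have hXat : ContDiffAt ℝ ∞ (fun u' => ξ (γ (u', y), y)) u :=
      ContDiffAt.comp u (g := ξ) (f := fun u' => (γ (u', y), y))
        (hξ.contDiffAt (hW.mem_nhds (hN₀W (hγmem _ (hdom y hy u hu)).2).1))
        (hγat.prodMk contDiffAt_const)
    have hβat : HasFDerivAt β (fderiv ℝ β (γ (u, y), y)) (γ (u, y), y) :=
      ((hβ.contDiffAt (hNo.mem_nhds (hγmem _ (hdom y hy u hu)).1)).differentiableAt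
        (by simp)).hasFDerivAt
    -- A vector killed by the derivative of the chart is killed by the derivative of `κ (X - x₀) =
    -- γ`, hence also by that of `β (γ (u, y), y) = u`.
    have h1 : HasFDerivAt (fun u' => κ (ξ (γ (u', y), y) - x₀)) _ u :=
      κ.hasFDerivAt.comp u ((hXat.differentiableAt (by simp)).hasFDerivAt.sub_const x₀)
    have h2 : (fun u' => κ (ξ (γ (u', y), y) - x₀)) =ᶠ[𝓝 u] fun u' => γ (u', y) := by
      filter_upwards [hev] with u' hu'
      exact (hξp _ (hN₀W (hγmem _ hu').2).1).2.2.2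
    have h3 : fderiv ℝ (fun u' => γ (u', y)) u a = 0 := by
      rw [(h1.congr_of_eventuallyEq h2.symm).fderiv, ContinuousLinearMap.comp_apply, ha, map_zero]
    have h4 : HasFDerivAt (fun u' => β (γ (u', y), y)) _ u :=
      HasFDerivAt.comp (g := β) (f := fun u' => (γ (u', y), y)) u hβat
        ((hγat.differentiableAt (by simp)).hasFDerivAt.prodMk (hasFDerivAt_const y u))
    have h5 : (fun u' => β (γ (u', y), y)) =ᶠ[𝓝 u] id := by
      filter_upwards [hev] with u' hu'
      exact hγβ _ hu'
    have h6 := congrArg (fun L => L a)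
      ((h4.congr_of_eventuallyEq h5.symm).unique (hasFDerivAt_id u))
    simp only [ContinuousLinearMap.comp_apply, ContinuousLinearMap.prod_apply, h3,
      zero_apply, ContinuousLinearMap.id_apply] at h6
    rw [← h6]
    exact map_zero _
  · intro y hy u hu
    have h1 := hγmem _ (hdom y hy u hu)
    have h2 := hξp _ (hN₀W h1.2).1
    refine ⟨⟨h2.1, (hN₀W h1.2).2⟩, h2.2.2.1, ?_⟩
    change ρ (ξ (γ (u, y), y)) = _
    rw [← hψeq _ h1.2, hβψ _ h1.1, hγβ _ (hdom y hy u hu)]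
  · intro y hy x hx h
    obtain ⟨h1, h2, h3, h4, h5⟩ := hBV (mk_mem_prod (hB₀sub hx) (hV₂sub hy).1.2)
    refine ⟨β (κ (x - x₀), y), h3, ?_⟩
    have h6 := hdom y hy _ (Metric.ball_subset_ball (half_le_self hr.le) h3)
    have h7 : κ (x - x₀) = γ (β (κ (x - x₀), y), y) := (hiff _ h6 _ h2).1 (by simp [hf])
    change ξ (γ (β (κ (x - x₀), y), y), y) = x
    rw [← h7]
    exact (hξu x h4 y (hN₀W h1.2).1 h).symm

end Chart

end GRT

namespace GRT

/-! ### The surfaces with prescribed normal: the map `yb` -/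

section Contact

theorem contDiffOn_gradX {U V : Set Space} (hU : IsOpen U) (hV : IsOpen V)
    {Φ : Space → Space → ℝ} (hΦ : ContDiffOn ℝ ∞ (Function.uncurry Φ) (U ×ˢ V)) :
    ContDiffOn ℝ ∞ (Function.uncurry (gradX Φ)) (U ×ˢ V) := by
  have hUV : IsOpen (U ×ˢ V) := hU.prod hV
  have h1 : ContDiffOn ℝ ∞ (fderiv ℝ (Function.uncurry Φ)) (U ×ˢ V) :=
    hΦ.fderiv_of_isOpen hUV (by simp)
  have h2 : ContDiffOn ℝ ∞ (fun q => (InnerProductSpace.toDual ℝ Space).symm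
      ((fderiv ℝ (Function.uncurry Φ) q).comp (ContinuousLinearMap.inl ℝ Space Space)))
      (U ×ˢ V) :=
    (InnerProductSpace.toDual ℝ Space).symm.contDiff.comp_contDiffOn
      (h1.clm_comp contDiffOn_const)
  refine h2.congr fun q hq => ?_
  refine ext_inner_right ℝ fun a => ?_
  rw [InnerProductSpace.toDual_symm_apply]
  exact (fderiv_slice_eq_inner hU hV hΦ hq.1 hq.2 a).symm

theorem mixedDeriv_eq_inner {U V : Set Space} (hU : IsOpen U) (hV : IsOpen V)
    {Φ : Space → Space → ℝ} (hΦ : ContDiffOn ℝ ∞ (Function.uncurry Φ) (U ×ˢ V)) {x y : Space}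
    (hx : x ∈ U) (hy : y ∈ V) (u w : Space) :
    mixedDeriv Φ x y u w = inner ℝ (fderiv ℝ (fun y' => gradX Φ x y') y w) u := by
  have h1 : DifferentiableAt ℝ (fun y' => gradX Φ x y') y :=
    (ContDiffAt.comp y (g := Function.uncurry (gradX Φ)) (f := fun y' => (x, y'))
      ((contDiffOn_gradX hU hV hΦ).contDiffAt ((hU.prod hV).mem_nhds ⟨hx, hy⟩))
      (contDiff_const.prodMk contDiff_id).contDiffAt).differentiableAt (by simp)
  have h2 : (fun y' => fderiv ℝ (fun x' => Φ x' y') x u) =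
      fun y' => inner ℝ (gradX Φ x y') u := by
    funext y'
    rw [gradX, inner_gradient]
  rw [mixedDeriv, h2, (h1.hasFDerivAt.inner ℝ (hasFDerivAt_const u y)).fderiv]
  simp

theorem ne_zero_of_isNormalAt {U V : Set Space} {Φ : Space → Space → ℝ}
    (hΦ : IsDefiningFunction U V Φ) {x y ν : Space} (hy : y ∈ V) (h : x ∈ surface U Φ y) {l : ℝ}
    (hl : gradX Φ x y = l • ν) : l ≠ 0 := by
  rintro rfl
  exact (hΦ.nondegenerate x h.1 y hy h.2).1 (by rw [hl, zero_smul])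

/-- By the Bolker condition, the surfaces through a given point close to a given normal direction
are parametrized by their normal direction. -/
theorem eq_zero_of_mixedDeriv {U V : Set Space} (hU : IsOpen U) (hV : IsOpen V)
    {Φ : Space → Space → ℝ} (hΦ : IsDefiningFunction U V Φ) {x y n : Space} (hx : x ∈ U)
    (hy : y ∈ V) (h0 : Φ x y = 0) {ι κ} (hn : IsPlaneFrame n ι κ) {l : ℝ}
    (hl : gradX Φ x y = l • n) {w : Space} (h1 : inner ℝ (gradY Φ x y) w = 0)
    (h2 : κ (fderiv ℝ (fun y' => gradX Φ x y') y w) = 0) : w = 0 := by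
  set e := EuclideanSpace.basisFun (Fin 2) ℝ with he
  have hg := (hΦ.nondegenerate x hx y hy h0).2
  set ν := ‖gradY Φ x y‖⁻¹ • gradY Φ x y with hν
  have hν1 : ‖ν‖ = 1 := by
    rw [hν, norm_smul, norm_inv, norm_norm, inv_mul_cancel₀ (norm_ne_zero_iff.2 hg)]
  have hgν : gradY Φ x y = ‖gradY Φ x y‖ • ν := by
    rw [hν, smul_smul, mul_inv_cancel₀ (norm_ne_zero_iff.2 hg), one_smul]
  obtain ⟨ι', κ', hn'⟩ := exists_isPlaneFrame hν1
  have hli : ∀ {n : Space} {ι κ}, IsPlaneFrame n ι κ → LinearIndependent ℝ fun i => ι (e i) := by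
    intro n ι κ h
    refine LinearIndependent.map' (v := e) e.toBasis.linearIndependent (ι : Plane →ₗ[ℝ] Space) ?_
    exact LinearMap.ker_eq_bot.2 (Function.LeftInverse.injective h.left_inv)
  have hdet := hΦ.bolker x hx y hy h0 (fun i => ι (e i)) (fun i => ι' (e i)) (hli hn)
    (fun i => by rw [hl, inner_smul_left, hn.inner_eq_zero, mul_zero]) (hli hn')
    (fun i => by rw [hgν, inner_smul_left, hn'.inner_eq_zero, mul_zero])
  have hw : ι' (κ' w) = w := by
    have h3 := hn'.decomp w
    rw [hν, inner_smul_left, h1, mul_zero, zero_smul, add_zero] at h3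
    exact h3
  -- The derivative of the `x`-gradient along `w` is normal to `S_y`, so its pairings with tangent
  -- vectors of `S_y` vanish. As `w` is tangent to `T_x`, the DF4 matrix annihilates the coordinates
  -- of `w`.
  have hD : fderiv ℝ (fun y' => gradX Φ x y') y w
      = inner ℝ n (fderiv ℝ (fun y' => gradX Φ x y') y w) • n := by
    conv_lhs => rw [← hn.decomp (fderiv ℝ (fun y' => gradX Φ x y') y w), h2, map_zero, zero_add]
  have hmul : (Matrix.of fun i j => mixedDeriv Φ x y (ι (e i)) (ι' (e j))).mulVec (κ' w) = 0 := by
    funext i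
    have h3 : mixedDeriv Φ x y (ι (e i)) w = 0 := by
      rw [mixedDeriv_eq_inner hU hV hΦ.smooth hx hy, hD, inner_smul_left, hn.inner_eq_zero,
        mul_zero]
    rw [← hw, plane_decomp (κ' w), map_add, map_smul, map_smul,
      mixedDeriv_eq_inner hU hV hΦ.smooth hx hy, map_add, map_smul, map_smul, inner_add_left,
      inner_smul_left, inner_smul_left, ← mixedDeriv_eq_inner hU hV hΦ.smooth hx hy,
      ← mixedDeriv_eq_inner hU hV hΦ.smooth hx hy] at h3
    simp only [Matrix.mulVec, dotProduct, Fin.sum_univ_two, Matrix.of_apply, Pi.zero_apply]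
    simp only [conj_trivial] at h3
    linarith
  have h4 := Matrix.eq_zero_of_mulVec_eq_zero hdet hmul
  have h5 : κ' w = 0 := by
    ext i
    exact congrFun h4 i
  rw [← hw, h5, map_zero]

/-- The surface which is orthogonal to a given normal of a given surface, at a given distance. -/
theorem exists_contact {U V : Set Space} (hU : IsOpen U) (hV : IsOpen V)
    {Φ : Space → Space → ℝ} (hΦ : IsDefiningFunction U V Φ) {x₀ y₀ : Space} (hy₀ : y₀ ∈ V)
    {O : Set Space} (hO : IsOpen O) (hxO : x₀ ∈ O) {ρ : Space → ℝ} (hρ : ContDiffOn ℝ ∞ ρ O)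
    (hρ0 : ∀ x ∈ O, gradient ρ x ≠ 0) (htan : IsNormalAt U Φ y₀ x₀ (unitNormal ρ x₀)) :
    ∃ (yb : Space → ℝ → Space) (V₁ W : Set Space) (δ : ℝ), 0 < δ ∧ IsOpen V₁ ∧ y₀ ∈ V₁ ∧
      V₁ ⊆ V ∧ IsOpen W ∧ x₀ ∈ W ∧ W ⊆ O ∩ U ∧
      ContDiffOn ℝ ∞ (Function.uncurry yb) (W ×ˢ Ioo (-δ) δ) ∧ yb x₀ 0 = y₀ ∧
      ∀ z ∈ W, ∀ p ∈ Ioo (-δ) δ, yb z p ∈ V₁ ∧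
        ∀ y ∈ V₁, IsNormalAt U Φ y (z + p • unitNormal ρ z) (unitNormal ρ z) ↔ y = yb z p := by
  obtain ⟨⟨hx₀, h0⟩, l, hl⟩ := htan
  have hfrn : ‖unitNormal ρ x₀‖ = 1 := norm_unitNormal (hρ0 _ hxO)
  obtain ⟨ι, κ, hn⟩ := exists_isPlaneFrame hfrn
  set n := unitNormal ρ x₀ with hndef
  have hν : ContDiffOn ℝ ∞ (unitNormal ρ) O := fun z hz =>
    (contDiffAt_unitNormal (hρ.contDiffAt (hO.mem_nhds hz)) (hρ0 z hz)).contDiffWithinAt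
  set A : (Space × ℝ) × Space → Space × Space :=
    fun q => (q.1.1 + q.1.2 • unitNormal ρ q.1.1, q.2) with hA
  set Ω₀ : Set ((Space × ℝ) × Space) := (fun q => q.1.1) ⁻¹' O with hΩ₀
  have hΩ₀o : IsOpen Ω₀ := hO.preimage (continuous_fst.comp continuous_fst)
  have hν' : ContDiffOn ℝ ∞ (fun q : (Space × ℝ) × Space => unitNormal ρ q.1.1) Ω₀ :=
    hν.comp (contDiff_fst.comp contDiff_fst).contDiffOn fun q hq => hq
  have hAs : ContDiffOn ℝ ∞ A Ω₀ :=
    ((contDiff_fst.comp contDiff_fst).contDiffOn.add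
      ((contDiff_snd.comp contDiff_fst).contDiffOn.smul hν')).prodMk contDiff_snd.contDiffOn
  have hUV : IsOpen (U ×ˢ V) := hU.prod hV
  set Ω := Ω₀ ∩ A ⁻¹' (U ×ˢ V) with hΩdef
  have hΩ : IsOpen Ω := hAs.continuousOn.isOpen_inter_preimage hΩ₀o hUV
  -- The first component is incidence. The second is the part of the gradient orthogonal to the
  -- normal at `z`, projected to a fixed plane, so that there are three scalar equations for the
  -- three unknowns `y`.
  set f : (Space × ℝ) × Space → ℝ × Plane := fun q =>
    (Function.uncurry Φ (A q), κ (Function.uncurry (gradX Φ) (A q)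
      - (inner ℝ (Function.uncurry (gradX Φ) (A q)) (unitNormal ρ q.1.1) : ℝ)
        • unitNormal ρ q.1.1)) with hf
  have hg : ContDiffOn ℝ ∞ (fun q => Function.uncurry (gradX Φ) (A q)) Ω :=
    (contDiffOn_gradX hU hV hΦ.smooth).comp (hAs.mono inter_subset_left) fun q hq => hq.2
  have hfs : ContDiffOn ℝ ∞ f Ω := by
    refine (hΦ.smooth.comp (hAs.mono inter_subset_left) fun q hq => hq.2).prodMk ?_
    exact κ.contDiff.comp_contDiffOn (hg.sub
      ((hg.inner ℝ (hν'.mono inter_subset_left)).smul (hν'.mono inter_subset_left)))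
  have hA0 : ∀ y, A ((x₀, 0), y) = (x₀, y) := fun y => by simp [hA]
  have hΩ0 : ((x₀, (0 : ℝ)), y₀) ∈ Ω := ⟨hxO, by rw [mem_preimage, hA0]; exact ⟨hx₀, hy₀⟩⟩
  have hfsl : ∀ y, f ((x₀, 0), y) = (Φ x₀ y, κ (gradX Φ x₀ y)) := fun y => by
    simp only [hf, hA0, Function.uncurry_apply_pair]
    rw [← hndef, map_sub, map_smul, hn.map_normal, smul_zero, sub_zero]
  have hinv : (fderiv ℝ f ((x₀, 0), y₀) ∘L .inr ℝ (Space × ℝ) Space).IsInvertible := by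
    refine isInvertible_of_injective (by simp) fun w hw => ?_
    have hΦy : DifferentiableAt ℝ (fun y => Φ x₀ y) y₀ :=
      (ContDiffAt.comp y₀ (g := Function.uncurry Φ) (f := fun y' => (x₀, y'))
        (hΦ.smooth.contDiffAt (hUV.mem_nhds ⟨hx₀, hy₀⟩))
        (contDiff_const.prodMk contDiff_id).contDiffAt).differentiableAt (by simp)
    have hgy : DifferentiableAt ℝ (fun y => gradX Φ x₀ y) y₀ :=
      (ContDiffAt.comp y₀ (g := Function.uncurry (gradX Φ)) (f := fun y' => (x₀, y'))
        ((contDiffOn_gradX hU hV hΦ.smooth).contDiffAt (hUV.mem_nhds ⟨hx₀, hy₀⟩))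
        (contDiff_const.prodMk contDiff_id).contDiffAt).differentiableAt (by simp)
    have h1 : HasFDerivAt (fun y => f ((x₀, 0), y)) ((fderiv ℝ (fun y => Φ x₀ y) y₀).prod
        (κ.comp (fderiv ℝ (fun y => gradX Φ x₀ y) y₀))) y₀ := by
      rw [funext hfsl]
      exact hΦy.hasFDerivAt.prodMk (κ.hasFDerivAt.comp y₀ hgy.hasFDerivAt)
    have h2 := fderiv_slice_snd
      ((hfs.contDiffAt (hΩ.mem_nhds hΩ0)).differentiableAt (by simp)) w
    rw [h1.fderiv] at h2
    have h3 : ((fderiv ℝ (fun y => Φ x₀ y) y₀).prod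
        (κ.comp (fderiv ℝ (fun y => gradX Φ x₀ y) y₀))) w = 0 := h2.trans hw
    rw [ContinuousLinearMap.prod_apply, Prod.mk_eq_zero] at h3
    refine eq_zero_of_mixedDeriv hU hV hΦ hx₀ hy₀ h0 hn hl ?_ h3.2
    rw [gradY, inner_gradient]
    exact h3.1
  have hf0 : f ((x₀, 0), y₀) = 0 := by
    rw [hfsl, h0, hl, map_smul, hn.map_normal, smul_zero]
    rfl
  obtain ⟨φ, W₁, V₁, hW₁, hW₁0, hV₁, hV₁0, hWV, hφ, hφ0, hmaps, hiff⟩ :=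
    exists_contDiffOn_implicit hΩ hfs hΩ0 hf0 hinv
  -- The kernel of `κ` is spanned by `n`. As long as `⟨n, unitNormal ρ z⟩ ≠ 0`, it meets the plane
  -- orthogonal to the normal at `z` only in `0`, and the projected equation still expresses
  -- normality.
  have hev : ∀ᶠ q : Space × ℝ in 𝓝 (x₀, 0), q ∈ W₁ ∧ q.1 ∈ U ∧
      inner ℝ n (unitNormal ρ q.1) ≠ 0 := by
    have h1 : ContinuousAt (fun q : Space × ℝ => unitNormal ρ q.1) (x₀, 0) :=
      ContinuousAt.comp (g := unitNormal ρ) (f := fun q : Space × ℝ => q.1) (x := (x₀, (0 : ℝ)))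
        (hν.continuousOn.continuousAt (hO.mem_nhds hxO)) continuousAt_fst
    have h2 : ContinuousAt (fun q : Space × ℝ => (inner ℝ n (unitNormal ρ q.1) : ℝ)) (x₀, 0) :=
      continuousAt_const.inner h1
    have h3 : (inner ℝ n (unitNormal ρ ((x₀, (0 : ℝ)) : Space × ℝ).1) : ℝ) ≠ 0 := by
      rw [← hndef, hn.inner_self]
      exact one_ne_zero
    have h4 : ∀ᶠ q : Space × ℝ in 𝓝 (x₀, 0), q ∈ W₁ := hW₁.mem_nhds hW₁0
    have h5 : ∀ᶠ q : Space × ℝ in 𝓝 (x₀, 0), q.1 ∈ U :=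
      continuousAt_fst.eventually_mem (hU.mem_nhds hx₀)
    exact h4.and (h5.and (h2.eventually_ne h3))
  obtain ⟨W₂, hW₂, I, hI, hWI⟩ := mem_nhds_prod_iff.1 hev
  obtain ⟨W, hWsub, hW, hW0⟩ := mem_nhds_iff.1 hW₂
  obtain ⟨δ, hδ, hδI⟩ := Metric.mem_nhds_iff.1 hI
  rw [Real.ball_eq_Ioo, zero_sub, zero_add] at hδI
  have hall : ∀ z ∈ W, ∀ p ∈ Ioo (-δ) δ, (z, p) ∈ W₁ ∧ z ∈ U ∧
      inner ℝ n (unitNormal ρ z) ≠ 0 := fun z hz p hp => hWI (mk_mem_prod (hWsub hz) (hδI hp))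
  have h0δ : (0 : ℝ) ∈ Ioo (-δ) δ := ⟨neg_lt_zero.2 hδ, hδ⟩
  have hΩmem : ∀ z ∈ W, ∀ p ∈ Ioo (-δ) δ, ∀ y ∈ V₁, ((z, p), y) ∈ Ω := fun z hz p hp y hy =>
    hWV (mk_mem_prod (hall z hz p hp).1 hy)
  refine ⟨fun z p => φ (z, p), V₁, W, δ, hδ, hV₁, hV₁0, fun y hy => ?_, hW, hW0, fun z hz => ?_,
    ?_, hφ0, fun z hz p hp => ⟨hmaps (hall z hz p hp).1, fun y hy => ?_⟩⟩
  · exact (hΩmem x₀ hW0 0 h0δ y hy).2.2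
  · exact ⟨(hΩmem z hz 0 h0δ y₀ hV₁0).1, (hall z hz 0 h0δ).2.1⟩
  · exact hφ.mono fun q hq => (hall _ hq.1 _ hq.2).1
  · obtain ⟨h1, -, h2⟩ := hall z hz p hp
    have h3 := hΩmem z hz p hp y hy
    have hνν : inner ℝ (unitNormal ρ z) (unitNormal ρ z) = (1 : ℝ) := by
      rw [real_inner_self_eq_norm_sq, norm_unitNormal (hρ0 z h3.1), one_pow]
    rw [← hiff _ h1 _ hy, Prod.ext_iff]
    constructor
    · rintro ⟨⟨h4, h5⟩, k, hk⟩
      refine ⟨h5, ?_⟩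
      change κ (gradX Φ _ y - (inner ℝ (gradX Φ _ y) _ : ℝ) • _) = 0
      rw [hk, inner_smul_left, hνν]
      simp
    · rintro ⟨h5, h6⟩
      refine ⟨⟨h3.2.1, h5⟩, inner ℝ (gradX Φ (z + p • unitNormal ρ z) y) (unitNormal ρ z), ?_⟩
      change κ (gradX Φ (z + p • unitNormal ρ z) y - (inner ℝ (gradX Φ (z + p • unitNormal ρ z) y)
        (unitNormal ρ z) : ℝ) • unitNormal ρ z) = 0 at h6
      set g := gradX Φ (z + p • unitNormal ρ z) y
      have h7 := hn.decomp (g - (inner ℝ g (unitNormal ρ z) : ℝ) • unitNormal ρ z)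
      rw [h6, map_zero, zero_add] at h7
      have h8 : inner ℝ (g - (inner ℝ g (unitNormal ρ z) : ℝ) • unitNormal ρ z) (unitNormal ρ z)
          = (0 : ℝ) := by
        rw [inner_sub_left, inner_smul_left, hνν]
        simp
      rw [← h7, inner_smul_left] at h8
      have h9 := (mul_eq_zero.1 h8).resolve_right h2
      rw [conj_trivial] at h9
      rw [h9, zero_smul] at h7
      exact sub_eq_zero.1 h7.symm

end Contact

end GRT

namespace GRT

/-! ### The two sides of `S` and the jump of `f` -/

section Sides

/-- A set that misses the frontier of `D` is covered by the disjoint open sets interior of `D` and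
complement of its closure, and a preconnected set cannot meet both. -/
theorem _root_.IsPreconnected.subset_or_disjoint_of_disjoint_frontier {X : Type*}
    [TopologicalSpace X] {P D : Set X} (hP : IsPreconnected P) (h : Disjoint P (frontier D)) :
    P ⊆ D ∨ Disjoint P D := by
  by_contra! hcon
  obtain ⟨h1, h2⟩ := hcon
  obtain ⟨x, hx, hxD⟩ := not_subset.1 h1
  obtain ⟨y, hy⟩ := not_disjoint_iff.1 h2
  have hnf : ∀ w ∈ P, w ∈ closure D → w ∈ interior D := fun w hw hwD => by
    by_contra hcon
    exact disjoint_left.1 h hw ⟨hwD, hcon⟩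
  obtain ⟨w, -, hw, hw'⟩ := hP (interior D) (closure D)ᶜ isOpen_interior isClosed_closure.isOpen_compl
    (fun w hw => (em (w ∈ closure D)).imp (hnf w hw) id)
    ⟨y, hy.1, hnf y hy.1 (subset_closure hy.2)⟩
    ⟨x, hx, fun hcl => hxD (interior_subset (hnf x hx hcl))⟩
  exact hw' (interior_subset_closure hw)

/-- A smooth function with non-vanishing gradient has connected positivity and negativity sets in
suitable small neighborhoods of its zeros. -/
theorem exists_isPreconnected_sides {O : Set Space} (hO : IsOpen O) {x₀ : Space} (hxO : x₀ ∈ O)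
    {ρ : Space → ℝ} (hρ : ContDiffOn ℝ ∞ ρ O) (hρ0 : gradient ρ x₀ ≠ 0) (h0 : ρ x₀ = 0)
    {M : Set Space} (hM : M ∈ 𝓝 x₀) : ∃ B : Set Space, IsOpen B ∧ x₀ ∈ B ∧ B ⊆ M ∩ O ∧
      IsPreconnected (B ∩ {x | 0 < ρ x}) ∧ IsPreconnected (B ∩ {x | ρ x < 0}) := by
  obtain ⟨ι, κ, hn⟩ := exists_isPlaneFrame (norm_unitNormal hρ0)
  obtain ⟨M', hM'M, hM', hxM'⟩ := mem_nhds_iff.1 hM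
  -- These are local coordinates with `ρ` as the last one. Over a ball in coordinate space the set
  -- where `ρ` lies in a convex set is the image of a convex set under the inverse, hence
  -- preconnected.
  set Ψ : Space → Plane × ℝ := fun x => (κ (x - x₀), ρ x) with hΨ
  have hΨs : ContDiffOn ℝ ∞ Ψ O :=
    (κ.contDiff.comp (contDiff_id.sub contDiff_const)).contDiffOn.prodMk hρ
  set Ω : Set ((Plane × ℝ) × Space) := Prod.snd ⁻¹' (O ∩ M') with hΩd
  have hΩ : IsOpen Ω := (hO.inter hM').preimage continuous_snd
  have hfs : ContDiffOn ℝ ∞ (fun q : (Plane × ℝ) × Space => Ψ q.2 - q.1) Ω :=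
    (hΨs.comp contDiff_snd.contDiffOn fun q hq => hq.1).sub contDiff_fst.contDiffOn
  have hΩ0 : (((0 : Plane), (0 : ℝ)), x₀) ∈ Ω := ⟨hxO, hxM'⟩
  have hρat : HasFDerivAt ρ (fderiv ℝ ρ x₀) x₀ :=
    ((hρ.contDiffAt (hO.mem_nhds hxO)).differentiableAt (by simp)).hasFDerivAt
  have hinv : (fderiv ℝ (fun q : (Plane × ℝ) × Space => Ψ q.2 - q.1) ((0, 0), x₀) ∘L
      .inr ℝ (Plane × ℝ) Space).IsInvertible := by
    refine isInvertible_of_injective (by simp) fun w hw => ?_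
    have h1 : HasFDerivAt (fun x => Ψ x - ((0 : Plane), (0 : ℝ))) (κ.prod (fderiv ℝ ρ x₀)) x₀ := by
      have h2 : HasFDerivAt (fun x => κ (x - x₀)) κ x₀ :=
        κ.hasFDerivAt.comp x₀ ((hasFDerivAt_id x₀).sub_const x₀)
      exact (h2.prodMk hρat).sub_const _
    have h2 := fderiv_slice_snd
      ((hfs.contDiffAt (hΩ.mem_nhds hΩ0)).differentiableAt (by simp)) w
    rw [h1.fderiv] at h2
    have h3 : (κ.prod (fderiv ℝ ρ x₀)) w = 0 := h2.trans hw
    rw [ContinuousLinearMap.prod_apply, Prod.mk_eq_zero, ← inner_gradient,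
      ← norm_smul_unitNormal hρ0, inner_smul_left] at h3
    have h4 := hn.decomp w
    rw [h3.1, map_zero, zero_add,
      (mul_eq_zero.1 h3.2).resolve_left (by simpa using hρ0), zero_smul] at h4
    exact h4.symm
  obtain ⟨φ, W, T, hW, hW0, hT, hT0, hWT, hφ, hφ0, hmaps, hiff⟩ :=
    exists_contDiffOn_implicit hΩ hfs hΩ0 (by simp [hΨ, h0]) hinv
  obtain ⟨r, hr, hrW⟩ := Metric.isOpen_iff.1 hW _ hW0
  have hTO : T ⊆ M ∩ O := fun x hx => by
    have := hWT (mk_mem_prod hW0 hx)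
    exact ⟨hM'M this.2, this.1⟩
  have himg : ∀ P : Set ℝ, Convex ℝ P →
      IsPreconnected ((T ∩ Ψ ⁻¹' Metric.ball 0 r) ∩ {x | ρ x ∈ P}) := by
    intro P hP
    have h1 : (T ∩ Ψ ⁻¹' Metric.ball 0 r) ∩ {x | ρ x ∈ P} =
        φ '' (Metric.ball 0 r ∩ (univ ×ˢ P)) := by
      ext x
      constructor
      · rintro ⟨⟨hx, hx'⟩, hxP⟩
        refine ⟨Ψ x, ⟨hx', mem_univ _, hxP⟩, ?_⟩
        exact ((hiff _ (hrW hx') x hx).1 (sub_self _)).symm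
      · rintro ⟨q, ⟨hq, hqP⟩, rfl⟩
        have h2 : Ψ (φ q) = q := sub_eq_zero.1 ((hiff _ (hrW hq) _ (hmaps (hrW hq))).2 rfl)
        refine ⟨⟨hmaps (hrW hq), by rw [mem_preimage, h2]; exact hq⟩, ?_⟩
        have h3 : ρ (φ q) = q.2 := congrArg Prod.snd h2
        rw [mem_ofPred_eq, h3]
        exact hqP.2
    rw [h1]
    refine IsPreconnected.image ?_ _ (hφ.continuousOn.mono (inter_subset_left.trans hrW))
    exact ((convex_ball _ _).inter (convex_univ.prod hP)).isPreconnected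
  refine ⟨T ∩ Ψ ⁻¹' Metric.ball 0 r, ?_, ⟨hT0, ?_⟩, inter_subset_left.trans hTO,
    himg (Ioi 0) (convex_Ioi 0), himg (Iio 0) (convex_Iio 0)⟩
  · exact (hΨs.continuousOn.mono fun x hx => (hTO hx).2).isOpen_inter_preimage hT
      Metric.isOpen_ball
  · have : Ψ x₀ = 0 := by simp [hΨ, h0]
    rw [mem_preimage, this]
    exact Metric.mem_ball_self hr

/-- The domains `D j` are locally unions of sides of the surface `ρ = 0`. -/
theorem exists_local_sides {m : ℕ} {D : Fin m → Set Space} {x₀ : Space} {O : Set Space}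
    {ρ : Space → ℝ} (hx₀ : x₀ ∈ boundaryUnion D) (h : IsLocalEquation (boundaryUnion D) x₀ O ρ)
    {M : Set Space} (hM : M ∈ 𝓝 x₀) : ∃ B : Set Space, IsOpen B ∧ x₀ ∈ B ∧ B ⊆ M ∩ O ∧
      ∀ j, (B ∩ {x | 0 < ρ x} ⊆ D j ∨ Disjoint (B ∩ {x | 0 < ρ x}) (D j)) ∧
        (B ∩ {x | ρ x < 0} ⊆ D j ∨ Disjoint (B ∩ {x | ρ x < 0}) (D j)) := by
  have h0 : x₀ ∈ {x | x ∈ O ∧ ρ x = 0} := by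
    rw [← h.inter_eq]
    exact ⟨hx₀, h.mem⟩
  obtain ⟨B, hB, hxB, hBM, hp, hm⟩ := exists_isPreconnected_sides h.isOpen h.mem h.smooth
    (h.gradient_ne_zero _ h.mem) h0.2 hM
  -- Inside `O` the frontiers of the `D j` lie in `ρ = 0`, so neither open side meets a frontier.
  have hdisj : ∀ j, ∀ x ∈ B, x ∈ frontier (D j) → ρ x = 0 := by
    intro j x hx hxj
    have h1 : x ∈ boundaryUnion D ∩ O := ⟨mem_iUnion.2 ⟨j, hxj⟩, (hBM hx).2⟩
    rw [h.inter_eq] at h1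
    exact h1.2
  refine ⟨B, hB, hxB, hBM, fun j => ⟨hp.subset_or_disjoint_of_disjoint_frontier ?_,
    hm.subset_or_disjoint_of_disjoint_frontier ?_⟩⟩
  · exact disjoint_left.2 fun x hx hxj => (ne_of_gt hx.2) (hdisj j x hx.1 hxj)
  · exact disjoint_left.2 fun x hx hxj => (ne_of_lt hx.2) (hdisj j x hx.1 hxj)

/-- A piecewise smooth function near the surface of discontinuity. -/
theorem exists_jump_decomposition {m : ℕ} {D : Fin m → Set Space} {ρ : Space → ℝ} {B K : Set Space}
    (hB : IsOpen B) (hDb : ∀ j, Bornology.IsBounded (D j))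
    (hsides : ∀ j, (B ∩ {x | 0 < ρ x} ⊆ D j ∨ Disjoint (B ∩ {x | 0 < ρ x}) (D j)) ∧
        (B ∩ {x | ρ x < 0} ⊆ D j ∨ Disjoint (B ∩ {x | ρ x < 0}) (D j)))
    (hK : IsCompact K) (hKB : K ⊆ B) {F : Fin m → Space → ℝ}
    (hF : ∀ j, ∃ Ω : Set Space, IsOpen Ω ∧ closure (D j) ⊆ Ω ∧ ContDiffOn ℝ ∞ (F j) Ω)
    (hsupp : tsupport (piecewiseFun D F) ⊆ K) :
    ∃ a c : Space → ℝ, ContDiff ℝ ∞ a ∧ ContDiff ℝ ∞ c ∧ tsupport a ⊆ B ∧ tsupport c ⊆ B ∧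
      ∀ x ∈ B, ρ x ≠ 0 → piecewiseFun D F x = a x + if 0 < ρ x then c x else 0 := by
  classical
  have hext : ∀ j, ∃ g : Space → ℝ, ContDiff ℝ ∞ g ∧ ∀ x ∈ D j, g x = F j x := by
    intro j
    obtain ⟨Ω, hΩ, hDΩ, hFs⟩ := hF j
    obtain ⟨g, hg, -, N, -, hDN, -, hgF⟩ := exists_smooth_extension
      (hDb j).isCompact_closure hΩ hDΩ hFs
    exact ⟨g, hg, fun x hx => hgF x (hDN (subset_closure hx))⟩
  choose g hg hgF using hext
  obtain ⟨χ, hχ, -, hχB, N, -, hKN, -, hχ1⟩ := exists_smooth_cutoff hK hB hKB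
  -- Each `D j` contains the side `P` or misses it, so on `P` the function is a fixed sum of smooth
  -- extensions. This sum is smooth across the surface as well.
  set hside : Set Space → Space → ℝ := fun P x => ∑ j, if P ⊆ D j then g j x else 0 with hhs
  have hside_smooth : ∀ P, ContDiff ℝ ∞ (hside P) := by
    intro P
    refine ContDiff.sum fun j _ => ?_
    by_cases h : P ⊆ D j
    · simpa [h] using hg j
    · simpa [h] using contDiff_const
  have hside_eq : ∀ P : Set Space, (∀ j, P ⊆ D j ∨ Disjoint P (D j)) → ∀ x ∈ P,
      piecewiseFun D F x = hside P x := by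
    intro P hP x hx
    refine Finset.sum_congr rfl fun j _ => ?_
    by_cases h : P ⊆ D j
    · rw [if_pos h, indicator_of_mem (h hx), hgF j x (h hx)]
    · rw [if_neg h, indicator_of_notMem (disjoint_left.1 ((hP j).resolve_left h) hx)]
  have hmul : ∀ x, piecewiseFun D F x = χ x * piecewiseFun D F x := by
    intro x
    by_cases hx : x ∈ K
    · rw [hχ1 x (hKN hx), one_mul]
    · rw [image_eq_zero_of_notMem_tsupport fun h => hx (hsupp h), mul_zero]
  set P := B ∩ {x | 0 < ρ x} with hP
  set Q := B ∩ {x | ρ x < 0} with hQ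
  -- `a` continues the values from the negative side and `c` is the difference of the two
  -- continuations. The cutoff `χ` puts their supports in `B` at no cost, since the function
  -- vanishes off `K`.
  refine ⟨fun x => χ x * hside Q x, fun x => χ x * (hside P x - hside Q x),
    hχ.mul (hside_smooth Q), hχ.mul ((hside_smooth P).sub (hside_smooth Q)),
    (tsupport_mul_subset_left).trans hχB, (tsupport_mul_subset_left).trans hχB, fun x hx h0 => ?_⟩
  rw [hmul]
  rcases lt_or_gt_of_ne h0 with h | h
  · rw [if_neg (not_lt.2 h.le), add_zero, hside_eq Q (fun j => (hsides j).2) x ⟨hx, h⟩]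
  · rw [if_pos h, hside_eq P (fun j => (hsides j).1) x ⟨hx, h⟩]
    ring

theorem eventually_sign_of_hasDerivAt {h : ℝ → ℝ} {d : ℝ} (hd : HasDerivAt h d 0) (h0 : h 0 = 0)
    (hpos : 0 < d) : ∀ᶠ ε in 𝓝[>] (0 : ℝ), 0 < h ε ∧ h (-ε) < 0 := by
  have h1 := (hasDerivAt_iff_tendsto_slope.1 hd).eventually (lt_mem_nhds hpos)
  rw [eventually_nhdsWithin_iff] at h1
  have h2 : ∀ᶠ ε : ℝ in 𝓝 0, -ε ∈ ({0}ᶜ : Set ℝ) → 0 < slope h 0 (-ε) := by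
    have h3 : Tendsto (fun ε : ℝ => -ε) (𝓝 0) (𝓝 0) := by
      simpa using (continuous_neg (G := ℝ)).tendsto 0
    exact h3.eventually h1
  rw [eventually_nhdsWithin_iff]
  filter_upwards [h1, h2] with ε h3 h4 hε
  have hε' : 0 < ε := hε
  have h5 := h3 (ne_of_gt hε')
  have h6 := h4 (neg_ne_zero.2 hε'.ne')
  simp only [slope_def_field, h0, sub_zero] at h5 h6
  refine ⟨(div_pos_iff_of_pos_right hε').1 h5, ?_⟩
  rcases div_pos_iff.1 h6 with h7 | h7
  · linarith [h7.2]
  · exact h7.1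

theorem hasDerivAt_along_normal {ρ : Space → ℝ} {z : Space} (hρ : DifferentiableAt ℝ ρ z)
    (hρ0 : gradient ρ z ≠ 0) :
    HasDerivAt (fun ε : ℝ => ρ (z + ε • unitNormal ρ z)) ‖gradient ρ z‖ 0 := by
  have h1 : HasDerivAt (fun ε : ℝ => z + ε • unitNormal ρ z) (unitNormal ρ z) 0 := by
    simpa using ((hasDerivAt_id (0 : ℝ)).smul_const (unitNormal ρ z)).const_add z
  have h2 : HasFDerivAt ρ (fderiv ℝ ρ z) (z + (0 : ℝ) • unitNormal ρ z) := by
    rw [zero_smul, add_zero]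
    exact hρ.hasFDerivAt
  refine (h2.comp_hasDerivAt (0 : ℝ) h1).congr_deriv ?_
  rw [← inner_gradient]
  nth_rw 1 [← norm_smul_unitNormal hρ0]
  rw [inner_smul_left, real_inner_self_eq_norm_sq, norm_unitNormal hρ0]
  simp

/-- The derivative of `ρ` along its unit normal is `|∇ρ| > 0`, so for small `ε > 0` the two points
lie on opposite sides of the surface. The contributions of the continuous function `a` cancel in the
limit. -/
theorem tendsto_jump {f a c ρ : Space → ℝ} {z : Space} (hρ : DifferentiableAt ℝ ρ z)
    (hρ0 : gradient ρ z ≠ 0) (hz : ρ z = 0) (ha : Continuous a) (hc : Continuous c)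
    (hf : ∀ᶠ x in 𝓝 z, ρ x ≠ 0 → f x = a x + if 0 < ρ x then c x else 0) :
    Tendsto (fun ε : ℝ => f (z + ε • unitNormal ρ z) - f (z - ε • unitNormal ρ z)) (𝓝[>] 0)
      (𝓝 (c z)) := by
  set n := unitNormal ρ z
  have h1 := eventually_sign_of_hasDerivAt (hasDerivAt_along_normal hρ hρ0) (by simpa using hz)
    (norm_pos_iff.2 hρ0)
  have hc1 : Tendsto (fun ε : ℝ => z + ε • n) (𝓝[>] 0) (𝓝 z) := by
    have : Continuous fun ε : ℝ => z + ε • n := by fun_prop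
    simpa using (this.tendsto 0).mono_left nhdsWithin_le_nhds
  have hc2 : Tendsto (fun ε : ℝ => z - ε • n) (𝓝[>] 0) (𝓝 z) := by
    have : Continuous fun ε : ℝ => z - ε • n := by fun_prop
    simpa using (this.tendsto 0).mono_left nhdsWithin_le_nhds
  have h2 : Tendsto (fun ε : ℝ => a (z + ε • n) + c (z + ε • n) - a (z - ε • n)) (𝓝[>] 0)
      (𝓝 (a z + c z - a z)) :=
    (((ha.tendsto z).comp hc1).add ((hc.tendsto z).comp hc1)).sub ((ha.tendsto z).comp hc2)
  rw [add_sub_cancel_left] at h2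
  refine h2.congr' ?_
  filter_upwards [h1, hc1.eventually hf, hc2.eventually hf] with ε h3 h4 h5
  have h6 : ρ (z - ε • n) < 0 := by
    rw [sub_eq_add_neg, ← neg_smul]
    exact h3.2
  rw [h4 h3.1.ne', h5 h6.ne, if_pos h3.1, if_neg (not_lt.2 h6.le), add_zero]

end Sides

end GRT

namespace GRT

/-! ### The transform in the parameters of a Morse chart -/

section SurfaceIntegral

theorem hasFDerivAt_const_sub_norm_sq (c : ℝ) (u : Plane) :
    HasFDerivAt (fun u : Plane => c - ‖u‖ ^ 2) (-((2 : ℝ) • innerSL ℝ u)) u := by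
  refine ((hasStrictFDerivAt_norm_sq u).hasFDerivAt.const_sub c).congr_fderiv ?_
  ext a
  simp

theorem fderiv_fderiv_const_sub_norm_sq (c : ℝ) (u a b : Plane) :
    fderiv ℝ (fderiv ℝ fun u : Plane => c - ‖u‖ ^ 2) u a b = -(2 * inner ℝ a b) := by
  have h1 : (fderiv ℝ fun u : Plane => c - ‖u‖ ^ 2) = -((2 : ℝ) • innerSL ℝ) := by
    funext u
    rw [(hasFDerivAt_const_sub_norm_sq c u).fderiv]
    rfl
  rw [h1, (-((2 : ℝ) • innerSL ℝ) : Plane →L[ℝ] Plane →L[ℝ] ℝ).fderiv]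
  simp
  rfl

variable {U V : Set Space} {Φ : Space → Space → ℝ} {O : Set Space} {ρ : Space → ℝ}
  {x₀ y₀ : Space} {X : Plane × Space → Space} {v : Space → ℝ} {r : ℝ} {V₂ B₀ : Set Space}

theorem IsMorseChart.contDiffOn_slice (h : IsMorseChart U V Φ O ρ x₀ y₀ X v r V₂ B₀) {y : Space}
    (hy : y ∈ V₂) : ContDiffOn ℝ ∞ (fun u => X (u, y)) (Metric.ball 0 r) :=
  h.smooth.comp (contDiff_id.prodMk contDiff_const).contDiffOn fun _ hu => ⟨hu, hy⟩

theorem IsMorseChart.zero_mem (h : IsMorseChart U V Φ O ρ x₀ y₀ X v r V₂ B₀) :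
    (0 : Plane) ∈ Metric.ball (0 : Plane) r := Metric.mem_ball_self h.pos

theorem IsMorseChart.apply_center (h : IsMorseChart U V Φ O ρ x₀ y₀ X v r V₂ B₀) {y : Space}
    (hy : y ∈ V₂) : v y = ρ (X (0, y)) := by
  rw [(h.incidence y hy 0 h.zero_mem).2.2]
  simp

theorem IsMorseChart.contDiffOn_center (h : IsMorseChart U V Φ O ρ x₀ y₀ X v r V₂ B₀) :
    ContDiffOn ℝ ∞ (fun y => X (0, y)) V₂ :=
  h.smooth.comp (contDiff_const.prodMk contDiff_id).contDiffOn fun _ hy => ⟨h.zero_mem, hy⟩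

theorem IsMorseChart.contDiffOn_height (h : IsMorseChart U V Φ O ρ x₀ y₀ X v r V₂ B₀)
    (hρ : ContDiffOn ℝ ∞ ρ O) : ContDiffOn ℝ ∞ v V₂ := by
  refine (hρ.comp h.contDiffOn_center fun y hy => ?_).congr fun y hy => h.apply_center hy
  exact (h.incidence y hy 0 h.zero_mem).1.2

/-- Injectivity of the chart on the whole ball identifies `u` with the parameter in the half ball
that `surjOn` provides. Functions supported in `B₀` thus pull back to densities supported well
inside the ball. -/
theorem IsMorseChart.norm_lt_of_mem (h : IsMorseChart U V Φ O ρ x₀ y₀ X v r V₂ B₀) {y : Space}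
    (hy : y ∈ V₂) {u : Plane} (hu : u ∈ Metric.ball (0 : Plane) r) (hX : X (u, y) ∈ B₀) :
    u ∈ Metric.ball (0 : Plane) (r / 2) := by
  obtain ⟨u', hu', h1⟩ := h.surjOn y hy _ hX (h.incidence y hy u hu).2.1
  have h2 : u' = u := h.injOn y hy (Metric.ball_subset_ball (half_le_self h.pos.le) hu') hu h1
  rwa [← h2]

/-- The density of a smooth function on the surfaces `S_y`, in the parameters of a chart. -/
theorem IsMorseChart.exists_density (h : IsMorseChart U V Φ O ρ x₀ y₀ X v r V₂ B₀)
    {b : Space → Space → ℝ} (hb : ContDiffOn ℝ ∞ (Function.uncurry b) (U ×ˢ V)) {c : Space → ℝ}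
    (hc : ContDiff ℝ ∞ c) (hcB : tsupport c ⊆ B₀) {s : ℝ} (hs : Metric.closedBall y₀ s ⊆ V₂) :
    ∃ C : Plane × Space → ℝ, ContDiff ℝ ∞ C ∧ HasCompactSupport C ∧
      ∀ y ∈ Metric.closedBall y₀ s,
        (∀ u ∈ Metric.ball (0 : Plane) r, C (u, y) =
          areaFactor (fderiv ℝ (fun u' => X (u', y)) u) * (b (X (u, y)) y * c (X (u, y)))) ∧
        ∀ u ∉ Metric.ball (0 : Plane) r, C (u, y) = 0 := by
  set Ω := Metric.ball (0 : Plane) r ×ˢ V₂ with hΩd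
  have hΩ : IsOpen Ω := Metric.isOpen_ball.prod h.isOpen_param
  set L : Plane × Space → Plane →L[ℝ] Space := fun p =>
    (fderiv ℝ X p).comp (ContinuousLinearMap.inl ℝ Plane Space) with hL
  have hLs : ContDiffOn ℝ ∞ L Ω :=
    (h.smooth.fderiv_of_isOpen hΩ (by simp)).clm_comp contDiffOn_const
  have hLeq : ∀ p ∈ Ω, fderiv ℝ (fun u' => X (u', p.2)) p.1 = L p := by
    intro p hp
    ext1 a
    exact fderiv_slice_fst (x := p.1) (y := p.2)
      ((h.smooth.contDiffAt (hΩ.mem_nhds hp)).differentiableAt (by simp)) a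
  have hgram : ∀ p ∈ Ω, gramDet (L p) ≠ 0 := by
    intro p hp
    rw [← areaFactor_sq, ← hLeq p hp]
    exact pow_ne_zero _ (areaFactor_pos (h.immersion p.2 hp.2 p.1 hp.1)).ne'
  set C₀ : Plane × Space → ℝ := fun p =>
    √(gramDet (L p)) * (b (X p) p.2 * c (X p)) with hC₀
  have hC₀s : ContDiffOn ℝ ∞ C₀ Ω := by
    refine ((contDiff_gramDet.comp_contDiffOn hLs).sqrt hgram).mul (ContDiffOn.mul ?_
      (hc.comp_contDiffOn h.smooth))
    exact hb.comp (h.smooth.prodMk contDiff_snd.contDiffOn) fun p hp =>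
      ⟨(h.incidence p.2 hp.2 p.1 hp.1).1.1, h.param_subset hp.2⟩
  have hK : IsCompact (Metric.closedBall (0 : Plane) (r / 2) ×ˢ Metric.closedBall y₀ s) :=
    (isCompact_closedBall _ _).prod (isCompact_closedBall _ _)
  have hKΩ : Metric.closedBall (0 : Plane) (r / 2) ×ˢ Metric.closedBall y₀ s ⊆ Ω :=
    prod_mono (Metric.closedBall_subset_ball (half_lt_self h.pos)) hs
  -- Where `c (X (u, y)) ≠ 0`, the parameter `u` lies in the half ball and `χ = 1`; elsewhere both
  -- sides vanish. The cutoff therefore does not alter the density.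
  obtain ⟨χ, hχ, hχc, hχΩ, N, -, hKN, -, hχ1⟩ := exists_smooth_cutoff hK hΩ hKΩ
  refine ⟨fun p => χ p • C₀ p, contDiff_smul_of_tsupport_subset hχ hΩ hχΩ hC₀s, hχc.smul_right,
    fun y hy => ⟨fun u hu => ?_, fun u hu => ?_⟩⟩
  · have hp : (u, y) ∈ Ω := ⟨hu, hs hy⟩
    have h1 : C₀ (u, y) =
        areaFactor (fderiv ℝ (fun u' => X (u', y)) u) * (b (X (u, y)) y * c (X (u, y))) := by
      have h2 : fderiv ℝ (fun u' => X (u', y)) u = L (u, y) := hLeq (u, y) hp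
      rw [areaFactor_eq_sqrt, h2]
    rw [← h1]
    by_cases hcX : c (X (u, y)) = 0
    · simp only [hC₀, hcX, mul_zero, smul_zero]
    · have h2 := h.norm_lt_of_mem (hs hy) hu (hcB (subset_tsupport _ hcX))
      have h3 : χ (u, y) = 1 :=
        hχ1 _ (hKN (mk_mem_prod (Metric.ball_subset_closedBall h2) hy))
      change χ (u, y) • C₀ (u, y) = _
      rw [h3, one_smul]
  · have h3 : χ (u, y) = 0 := image_eq_zero_of_notMem_tsupport fun hmem => hu (hχΩ hmem).1
    change χ (u, y) • C₀ (u, y) = _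
    rw [h3, zero_smul]

theorem measurableSet_surface (hU : IsOpen U) (hΦ : ContDiffOn ℝ ∞ (Function.uncurry Φ) (U ×ˢ V))
    {y : Space} (hy : y ∈ V) : MeasurableSet (surface U Φ y) := by
  have h1 : ContinuousOn (fun x => Φ x y) U :=
    hΦ.continuousOn.comp (f := fun x => (x, y)) (by fun_prop) fun x hx => ⟨hx, hy⟩
  have h2 : surface U Φ y = U \ (U ∩ (fun x => Φ x y) ⁻¹' {0}ᶜ) := by
    ext x
    simp only [surface, mem_ofPred_eq, Set.mem_sdiff, mem_inter_iff, mem_preimage, mem_compl_iff,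
      mem_singleton_iff]
    tauto
  rw [h2]
  exact hU.measurableSet.diff
    (h1.isOpen_inter_preimage hU isOpen_compl_singleton).measurableSet

/-- The generalized Radon transform of a function with a jump, in the parameters of a chart. -/
theorem IsMorseChart.radon_eq (h : IsMorseChart U V Φ O ρ x₀ y₀ X v r V₂ B₀) (hU : IsOpen U)
    (hΦ : ContDiffOn ℝ ∞ (Function.uncurry Φ) (U ×ˢ V))
    {b : Space → Space → ℝ} {f a c : Space → ℝ} {B : Set Space} (hBB : B ⊆ B₀)
    (hfB : ∀ x ∉ B, f x = 0) (haB : ∀ x ∉ B, a x = 0) (hcB : ∀ x ∉ B, c x = 0)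
    (hf : ∀ x ∈ B, ρ x ≠ 0 → f x = a x + if 0 < ρ x then c x else 0) {y : Space} (hy : y ∈ V₂)
    {A C : Plane → ℝ} (hA : Continuous A) (hC : Continuous C)
    (hAeq : ∀ u ∈ Metric.ball (0 : Plane) r, A u =
      areaFactor (fderiv ℝ (fun u' => X (u', y)) u) * (b (X (u, y)) y * a (X (u, y))))
    (hCeq : ∀ u ∈ Metric.ball (0 : Plane) r, C u =
      areaFactor (fderiv ℝ (fun u' => X (u', y)) u) * (b (X (u, y)) y * c (X (u, y))))
    (hC0 : ∀ u ∉ Metric.ball (0 : Plane) r, C u = 0) :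
    IntegrableOn (fun x => b x y * f x) (surface U Φ y) (μHE[2] : Measure Space) ∧
      radon U Φ b f y = (∫ u in Metric.ball (0 : Plane) r, A u)
        + ∫ u in {u : Plane | ‖u‖ ^ 2 < v y}, C u := by
  set S := {u : Plane | ‖u‖ ^ 2 < v y} with hS
  have hSm : MeasurableSet S :=
    (isOpen_lt (continuous_norm.pow 2) continuous_const).measurableSet
  set T := (fun u => X (u, y)) '' Metric.ball (0 : Plane) r with hT
  have hsm := h.contDiffOn_slice hy
  have hTS : T ⊆ surface U Φ y := by
    rintro _ ⟨u, hu, rfl⟩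
    exact ⟨(h.incidence y hy u hu).1.1, (h.incidence y hy u hu).2.1⟩
  -- Every point of `S_y` in `B ⊆ B₀` lies in the image of the chart, so the part of `S_y` outside
  -- the chart does not contribute.
  have hzero : ∀ x ∈ surface U Φ y \ T, b x y * f x = 0 := by
    rintro x ⟨hx, hxT⟩
    rw [hfB x fun hxB => hxT ?_, mul_zero]
    obtain ⟨u, hu, hux⟩ := h.surjOn y hy x (hBB hxB) hx.2
    exact ⟨u, Metric.ball_subset_ball (half_le_self h.pos.le) hu, hux⟩
  have hSurf : MeasurableSet (surface U Φ y) := measurableSet_surface hU hΦ (h.param_subset hy)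
  -- The decomposition of `f` is known only where `ρ ≠ 0`. In the chart the exceptional set is the
  -- circle `‖u‖² = v y`, a null set.
  have hae : (fun u => areaFactor (fderiv ℝ (fun u' => X (u', y)) u) *
      (b (X (u, y)) y * f (X (u, y)))) =ᵐ[volume.restrict (Metric.ball (0 : Plane) r)]
      fun u => A u + S.indicator C u := by
    have hnull : volume {u : Plane | ‖u‖ ^ 2 = v y} = 0 := by
      refine measure_mono_null (fun u (hu : ‖u‖ ^ 2 = v y) => ?_)
        (Measure.addHaar_sphere (volume : Measure Plane) 0 (√(v y)))
      rw [mem_sphere_zero_iff_norm, ← hu, Real.sqrt_sq (norm_nonneg u)]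
    have h1 : ∀ᵐ u : Plane, ‖u‖ ^ 2 ≠ v y := by
      rw [ae_iff]
      simpa using hnull
    filter_upwards [ae_restrict_of_ae h1, ae_restrict_mem Metric.isOpen_ball.measurableSet]
      with u hu hur
    have hρu := (h.incidence y hy u hur).2.2
    by_cases hXB : X (u, y) ∈ B
    · rw [hf _ hXB (by rw [hρu]; exact sub_ne_zero.2 hu.symm), hAeq u hur]
      by_cases hlt : ‖u‖ ^ 2 < v y
      · rw [if_pos (by rw [hρu]; exact sub_pos.2 hlt), indicator_of_mem (show u ∈ S from hlt),
          hCeq u hur]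
        ring
      · rw [if_neg (by rw [hρu, sub_pos]; exact hlt), indicator_of_notMem (show u ∉ S from hlt)]
        ring
    · have h2 : S.indicator C u = 0 := by
        rw [indicator_apply_eq_zero]
        intro _
        rw [hCeq u hur, hcB _ hXB, mul_zero, mul_zero]
      rw [hfB _ hXB, hAeq u hur, haB _ hXB, h2]
      ring
  have hAi : IntegrableOn A (Metric.ball (0 : Plane) r) :=
    (hA.continuousOn.integrableOn_compact (isCompact_closedBall (0 : Plane) r)).mono_set
      Metric.ball_subset_closedBall
  have hCi : IntegrableOn (S.indicator C) (Metric.ball (0 : Plane) r) :=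
    ((hC.continuousOn.integrableOn_compact (isCompact_closedBall (0 : Plane) r)).mono_set
      Metric.ball_subset_closedBall).indicator hSm
  constructor
  · refine IntegrableOn.of_forall_sdiff_eq_zero ?_ hSurf hzero
    rw [integrableOn_image_area_iff Metric.isOpen_ball hsm (h.injOn y hy) (h.immersion y hy)]
    exact (integrableOn_congr_fun_ae hae).2 (hAi.add hCi)
  · rw [radon, setIntegral_eq_of_subset_of_forall_sdiff_eq_zero hSurf hTS hzero,
      setIntegral_image_area Metric.isOpen_ball hsm (h.injOn y hy) (h.immersion y hy),
      integral_congr_ae hae, integral_add hAi hCi, setIntegral_indicator hSm]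
    congr 1
    refine (setIntegral_eq_of_subset_of_forall_sdiff_eq_zero hSm inter_subset_right ?_).symm
    rintro u ⟨hu, hu'⟩
    exact hC0 u fun hur => hu' ⟨hur, hu⟩

end SurfaceIntegral

/-! ### Points of tangency and the derivative of the height `v` -/

section Tangency

variable {U V : Set Space} {Φ : Space → Space → ℝ} {O : Set Space} {ρ : Space → ℝ}
  {x₀ y₀ : Space} {X : Plane × Space → Space} {v : Space → ℝ} {r : ℝ} {V₂ B₀ : Set Space}

/-- A point of tangency is the center of the chart, and the form `N` is there a multiple of the
metric of the parameter plane. -/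
theorem IsMorseChart.tangency (h : IsMorseChart U V Φ O ρ x₀ y₀ X v r V₂ B₀) (hU : IsOpen U)
    (hV : IsOpen V) (hΦ : ContDiffOn ℝ ∞ (Function.uncurry Φ) (U ×ˢ V)) (hO : IsOpen O)
    (hρ : ContDiffOn ℝ ∞ ρ O) (hρ0 : ∀ x ∈ O, gradient ρ x ≠ 0) {z y : Space} (hz : z ∈ B₀)
    (hy : y ∈ V₂) (h0 : Φ z y = 0) {l : ℝ} (hl : l ≠ 0) (hgrad : gradX Φ z y = l • unitNormal ρ z) :
    X (0, y) = z ∧ (∀ a, inner ℝ (unitNormal ρ z) (fderiv ℝ (fun u => X (u, y)) 0 a) = 0) ∧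
      ∀ a b, formN Φ ρ y z (fderiv ℝ (fun u => X (u, y)) 0 a) (fderiv ℝ (fun u => X (u, y)) 0 b) =
        -(2 / ‖gradient ρ z‖ * inner ℝ a b) := by
  obtain ⟨u, hu, hXu⟩ := h.surjOn y hy z hz h0
  have hur : u ∈ Metric.ball (0 : Plane) r := Metric.ball_subset_ball (half_le_self h.pos.le) hu
  have hzO : z ∈ O := (h.base_subset hz).2
  have hball : Metric.ball (0 : Plane) r ∈ 𝓝 u := Metric.isOpen_ball.mem_nhds hur
  have hXat : ContDiffAt ℝ ∞ (fun u => X (u, y)) u := (h.contDiffOn_slice hy).contDiffAt hball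
  have hρat : ContDiffAt ℝ ∞ ρ z := hρ.contDiffAt (hO.mem_nhds hzO)
  have hΦat : ContDiffAt ℝ ∞ (fun x => Φ x y) z :=
    ContDiffAt.comp z (g := Function.uncurry Φ) (f := fun x => (x, y))
      (hΦ.contDiffAt ((hU.prod hV).mem_nhds ⟨(h.base_subset hz).1, h.param_subset hy⟩))
      (contDiff_id.prodMk contDiff_const).contDiffAt
  obtain ⟨htan, hform⟩ := formN_eq_hessian hXat hXu hΦat hρat (hρ0 z hzO) hl hgrad (by
    filter_upwards [hball] with u' hu'
    exact (h.incidence y hy u' hu').2.1)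
  have hcomp : (ρ ∘ fun u => X (u, y)) =ᶠ[𝓝 u] fun u => v y - ‖u‖ ^ 2 := by
    filter_upwards [hball] with u' hu'
    exact (h.incidence y hy u' hu').2.2
  -- At a point of tangency the differential of `ρ ∘ X` vanishes; in the chart it is `-2⟨u, ·⟩`.
  have hu0 : u = 0 := by
    have h1 : HasFDerivAt (ρ ∘ fun u => X (u, y)) _ u :=
      HasFDerivAt.comp u (g := ρ) (f := fun u => X (u, y))
        (by rw [hXu]; exact (hρat.differentiableAt (by simp)).hasFDerivAt)
        (hXat.differentiableAt (by simp)).hasFDerivAt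
    have h2 := congrArg (fun L => L u) ((h1.congr_of_eventuallyEq hcomp.symm).unique
      (hasFDerivAt_const_sub_norm_sq (v y) u))
    simp only [ContinuousLinearMap.comp_apply, ← inner_gradient] at h2
    rw [← norm_smul_unitNormal (hρ0 z hzO), inner_smul_left, htan, mul_zero] at h2
    simpa using h2
  subst hu0
  refine ⟨hXu, htan, fun a b => ?_⟩
  rw [hform, hcomp.fderiv.fderiv_eq, fderiv_fderiv_const_sub_norm_sq]
  ring

/-- The derivative of the height in the normal direction. -/
theorem IsMorseChart.hasDerivAt_height (h : IsMorseChart U V Φ O ρ x₀ y₀ X v r V₂ B₀)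
    (hU : IsOpen U) (hV : IsOpen V) (hΦ : ContDiffOn ℝ ∞ (Function.uncurry Φ) (U ×ˢ V))
    (hO : IsOpen O) (hρ : ContDiffOn ℝ ∞ ρ O) {z : Space} (hz : z ∈ B₀) (hρ0 : gradient ρ z ≠ 0)
    {γ : ℝ → Space} (hγ : DifferentiableAt ℝ γ 0) (hy : γ 0 ∈ V₂) (hX : X (0, γ 0) = z) {l : ℝ}
    (hl : l ≠ 0) (hgrad : gradX Φ z (γ 0) = l • unitNormal ρ z)
    (hinc : ∀ᶠ p : ℝ in 𝓝 0, Φ (z + p • unitNormal ρ z) (γ p) = 0) :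
    HasDerivAt (fun p => v (γ p)) ‖gradient ρ z‖ 0 := by
  have hzO : z ∈ O := (h.base_subset hz).2
  have hzU : z ∈ U := (h.base_subset hz).1
  set n := unitNormal ρ z with hn
  have hγV : ∀ᶠ p in 𝓝 0, γ p ∈ V₂ :=
    hγ.continuousAt.eventually_mem (h.isOpen_param.mem_nhds hy)
  have hη : DifferentiableAt ℝ (fun p => X (0, γ p)) 0 :=
    DifferentiableAt.comp (0 : ℝ) (g := fun y => X (0, y))
      ((h.contDiffOn_center.contDiffAt (h.isOpen_param.mem_nhds hy)).differentiableAt (by simp)) hγ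
  set η' := deriv (fun p => X (0, γ p)) 0 with hη'
  have hline : HasDerivAt (fun p : ℝ => z + p • n) n 0 := by
    simpa using ((hasDerivAt_id (0 : ℝ)).smul_const n).const_add z
  have hΦd : HasFDerivAt (Function.uncurry Φ) (fderiv ℝ (Function.uncurry Φ) (z, γ 0)) (z, γ 0) :=
    ((hΦ.contDiffAt ((hU.prod hV).mem_nhds ⟨hzU, h.param_subset hy⟩)).differentiableAt
      (by simp)).hasFDerivAt
  -- The curves `z + p n` and `X (0, γ p)` start at the same point and run on the same moving
  -- surfaces. The difference of their velocities is annihilated by the `x`-gradient `l n`, so both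
  -- have normal velocity `1`, and `v = ρ ∘ X (0, ·)` grows at the rate `|∇ρ|`.
  have h1 : fderiv ℝ (Function.uncurry Φ) (z, γ 0) (n, deriv γ 0) = 0 := by
    have h2 : HasDerivAt (fun p : ℝ => Function.uncurry Φ (z + p • n, γ p)) _ 0 :=
      HasFDerivAt.comp_hasDerivAt (l := Function.uncurry Φ) (f := fun p : ℝ => (z + p • n, γ p))
        (0 : ℝ) (by rw [zero_smul, add_zero]; exact hΦd) (hline.prodMk hγ.hasDerivAt)
    exact h2.unique ((hasDerivAt_const (0 : ℝ) (0 : ℝ)).congr_of_eventuallyEq hinc)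
  have h2 : fderiv ℝ (Function.uncurry Φ) (z, γ 0) (η', deriv γ 0) = 0 := by
    have h3 : HasDerivAt (fun p : ℝ => Function.uncurry Φ (X (0, γ p), γ p)) _ 0 :=
      HasFDerivAt.comp_hasDerivAt (l := Function.uncurry Φ) (f := fun p : ℝ => (X (0, γ p), γ p))
        (0 : ℝ) (by rw [hX]; exact hΦd) (hη.hasDerivAt.prodMk hγ.hasDerivAt)
    refine h3.unique ((hasDerivAt_const (0 : ℝ) (0 : ℝ)).congr_of_eventuallyEq ?_)
    filter_upwards [hγV] with p hp
    exact (h.incidence _ hp 0 h.zero_mem).2.1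
  have h3 : inner ℝ n (η' - n) = (0 : ℝ) := by
    have h4 : fderiv ℝ (Function.uncurry Φ) (z, γ 0) (η' - n, 0) = 0 := by
      have h5 : ((η' - n, 0) : Space × Space) = (η', deriv γ 0) - (n, deriv γ 0) := by
        rw [Prod.mk_sub_mk, sub_self]
      rw [h5, map_sub, h1, h2, sub_zero]
    rw [fderiv_slice_eq_inner hU hV hΦ hzU (h.param_subset hy), hgrad, inner_smul_left] at h4
    exact (mul_eq_zero.1 h4).resolve_left hl
  have h4 : HasDerivAt (fun p => ρ (X (0, γ p))) (fderiv ℝ ρ z η') 0 :=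
    HasFDerivAt.comp_hasDerivAt (l := ρ) (f := fun p : ℝ => X (0, γ p)) (0 : ℝ)
      (by rw [hX]; exact ((hρ.contDiffAt (hO.mem_nhds hzO)).differentiableAt (by simp)).hasFDerivAt)
      hη.hasDerivAt
  have h5 : (fun p => v (γ p)) =ᶠ[𝓝 0] fun p => ρ (X (0, γ p)) := by
    filter_upwards [hγV] with p hp
    exact h.apply_center hp
  refine (h4.congr_of_eventuallyEq h5).congr_deriv ?_
  rw [inner_sub_right, real_inner_self_eq_norm_sq, hn, norm_unitNormal hρ0, ← hn] at h3
  rw [← inner_gradient, ← norm_smul_unitNormal hρ0, inner_smul_left, ← hn,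
    show inner ℝ n η' = (1 : ℝ) by linarith, norm_smul_unitNormal hρ0]
  simp

end Tangency

end GRT

/-! ### Assembly of the asymptotic formula -/

theorem mainTheorem4
    (U V : Set GRT.Space) (hU : IsOpen U) (hUc : IsConnected U)
    (hV : IsOpen V) (hVc : IsConnected V)
    (Φ : GRT.Space → GRT.Space → ℝ) (hΦ : GRT.IsDefiningFunction U V Φ)
    (b : GRT.Space → GRT.Space → ℝ)
    (hb : ContDiffOn ℝ ∞ (Function.uncurry b) (U ×ˢ V))
    (hb0 : ∀ x ∈ U, ∀ y ∈ V, b x y ≠ 0)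
    {m : ℕ} (D : Fin m → Set GRT.Space)
    (hDo : ∀ j, IsOpen (D j)) (hDc : ∀ j, IsConnected (D j))
    (hDb : ∀ j, Bornology.IsBounded (D j)) (hDU : ∀ j, D j ⊆ U)
    (x₀ y₀ : GRT.Space) (hx₀ : x₀ ∈ U) (hy₀ : y₀ ∈ V)
    (hx₀S : x₀ ∈ GRT.boundaryUnion D)
    (O : Set GRT.Space) (ρ : GRT.Space → ℝ)
    (hρ : GRT.IsLocalEquation (GRT.boundaryUnion D) x₀ O ρ)
    (htan : GRT.IsNormalAt U Φ y₀ x₀ (GRT.unitNormal ρ x₀))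
    (hN : ∀ u : GRT.Space, u ≠ 0 → inner ℝ (GRT.unitNormal ρ x₀) u = 0 →
      GRT.formN Φ ρ y₀ x₀ u u < 0) :
    ∃ B ∈ 𝓝 x₀, ∃ W : Set GRT.Space, IsOpen W ∧ x₀ ∈ W ∧ W ⊆ O ∩ U ∧ ∃ δ : ℝ, 0 < δ ∧
    ∃ V₁ : Set GRT.Space, IsOpen V₁ ∧ y₀ ∈ V₁ ∧ V₁ ⊆ V ∧
    ∃ yb : GRT.Space → ℝ → GRT.Space,
      -- the smooth function `(z, p) ↦ yb z p` determined by the incidence and normality conditions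
      ContDiffOn ℝ ∞ (Function.uncurry yb) (W ×ˢ Ioo (-δ) δ) ∧
      yb x₀ 0 = y₀ ∧
      (∀ z ∈ GRT.boundaryUnion D ∩ W, ∀ p ∈ Ioo (-δ) δ, yb z p ∈ V₁ ∧
        ∀ y ∈ V₁, GRT.IsNormalAt U Φ y (z + p • GRT.unitNormal ρ z) (GRT.unitNormal ρ z) ↔
          y = yb z p) ∧
      -- the behavior of the data
      ∀ F : Fin m → GRT.Space → ℝ,
        (∀ j, ∃ Ω : Set GRT.Space, IsOpen Ω ∧ closure (D j) ⊆ Ω ∧ ContDiffOn ℝ ∞ (F j) Ω) →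
        tsupport (GRT.piecewiseFun D F) ⊆ B →
        ∃ (G G₁ : GRT.Space → ℝ → ℝ) (f₀ : GRT.Space → ℝ),
          ContDiffOn ℝ ∞ (Function.uncurry G) (W ×ˢ Ioo (-δ) δ) ∧
          ContDiffOn ℝ ∞ (Function.uncurry G₁) (W ×ˢ Ioo (-δ) δ) ∧
          (∀ z ∈ GRT.boundaryUnion D ∩ W, ∀ p ∈ Ioo (-δ) δ,
            IntegrableOn (fun x => b x (yb z p) * GRT.piecewiseFun D F x)
              (GRT.surface U Φ (yb z p)) (μHE[2] : Measure GRT.Space) ∧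
            GRT.radon U Φ b (GRT.piecewiseFun D F) (yb z p) = max p 0 * G z p + G₁ z p) ∧
          (∀ z ∈ GRT.boundaryUnion D ∩ W,
            -- `f₀ z` is the jump of the function across the surface at `z`
            Tendsto (fun ε : ℝ => GRT.piecewiseFun D F (z + ε • GRT.unitNormal ρ z)
                - GRT.piecewiseFun D F (z - ε • GRT.unitNormal ρ z)) (𝓝[>] 0) (𝓝 (f₀ z)) ∧
            ∀ e : Fin 2 → GRT.Space, Orthonormal ℝ e →
              (∀ i, inner ℝ (GRT.unitNormal ρ z) (e i) = 0) →
              (GRT.matrixN Φ ρ (yb z 0) z e).IsSymm ∧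
              (-GRT.matrixN Φ ρ (yb z 0) z e).PosDef ∧
              G z 0 = f₀ z * b z (yb z 0) *
                (2 * Real.pi / Real.sqrt (GRT.matrixN Φ ρ (yb z 0) z e).det)) := by
  have hxO := hρ.mem
  have hρ0 := hρ.gradient_ne_zero
  have hzero : ∀ z ∈ GRT.boundaryUnion D, z ∈ O → ρ z = 0 := fun z hz hzO => by
    have h1 : z ∈ GRT.boundaryUnion D ∩ O := ⟨hz, hzO⟩
    rw [hρ.inter_eq] at h1
    exact h1.2
  obtain ⟨hxS, l₀, hl₀⟩ := id htan
  obtain ⟨X, v, r, V₂, B₀, hX⟩ := GRT.exists_morse_chart hU hV hΦ.smooth hx₀ hy₀ hxS.2 hρ.isOpen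
    hxO hρ.smooth (hρ0 _ hxO) (GRT.ne_zero_of_isNormalAt hΦ hy₀ hxS hl₀) hl₀ hN
  have hv0 : v y₀ = 0 := by
    rw [hX.apply_center hX.mem_param, hX.apply_zero, hzero _ hx₀S hxO]
  have hvs := hX.contDiffOn_height hρ.smooth
  -- The closed ball provides the compact parameter set for the densities, and `v < 1 / 2` is the
  -- range in which the disc formula holds.
  obtain ⟨s, hs, hsV⟩ : ∃ s > 0, Metric.closedBall y₀ s ⊆ V₂ ∩ {y | v y < 1 / 2} := by
    refine Metric.nhds_basis_closedBall.mem_iff.1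
      (inter_mem (hX.isOpen_param.mem_nhds hX.mem_param) ?_)
    refine (hvs.continuousOn.continuousAt (hX.isOpen_param.mem_nhds hX.mem_param)).eventually_lt_const ?_
    rw [hv0]
    norm_num
  have hsV₂ : Metric.closedBall y₀ s ⊆ V₂ := fun y hy => (hsV hy).1
  obtain ⟨B, hB, hxB, hBM, hsides⟩ := GRT.exists_local_sides hx₀S hρ
    (hX.isOpen_base.mem_nhds hX.mem_base)
  have hBB₀ : B ⊆ B₀ := fun x hx => (hBM hx).1
  obtain ⟨r₀, hr₀, hr₀B⟩ := Metric.nhds_basis_closedBall.mem_iff.1 (hB.mem_nhds hxB)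
  obtain ⟨yb, V₁, W₀, δ₀, hδ₀, hV₁, hyV₁, hV₁V, hW₀, hxW₀, hW₀O, hyb, hyb0, hcontact⟩ :=
    GRT.exists_contact hU hV hΦ hy₀ hρ.isOpen hxO hρ.smooth hρ0 htan
  have hI : ∀ δ : ℝ, 0 < δ → (0 : ℝ) ∈ Ioo (-δ) δ := fun δ hδ => ⟨neg_lt_zero.2 hδ, hδ⟩
  set Ω : Set (GRT.Space × ℝ) :=
    (W₀ ×ˢ Ioo (-δ₀) δ₀) ∩ Function.uncurry yb ⁻¹' Metric.ball y₀ s with hΩd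
  have hΩ : IsOpen Ω :=
    hyb.continuousOn.isOpen_inter_preimage (hW₀.prod isOpen_Ioo) Metric.isOpen_ball
  have hΩ0 : (x₀, (0 : ℝ)) ∈ Ω := by
    refine ⟨⟨hxW₀, hI _ hδ₀⟩, ?_⟩
    change yb x₀ 0 ∈ Metric.ball y₀ s
    rw [hyb0]
    exact Metric.mem_ball_self hs
  have hybV : ∀ z p, (z, p) ∈ Ω → yb z p ∈ Metric.closedBall y₀ s := fun z p hq =>
    Metric.ball_subset_closedBall hq.2
  have hvyb : ContDiffOn ℝ ∞ (fun q : GRT.Space × ℝ => v (yb q.1 q.2)) Ω :=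
    hvs.comp (hyb.mono inter_subset_left) fun q hq => hsV₂ (hybV q.1 q.2 hq)
  obtain ⟨η, hη, -, N, hNo, hN0, hNΩ, hηv⟩ := GRT.exists_smooth_extension
    (isCompact_singleton (x := (x₀, (0 : ℝ)))) hΩ (singleton_subset_iff.2 hΩ0) hvyb
  -- `η` is a global extension of `v (yb z p)`. As it vanishes at `p = 0` for `z ∈ S`, Hadamard's
  -- lemma gives `η = p q` there.
  obtain ⟨q, hq, hηq, hq0⟩ := GRT.exists_contDiff_hadamard (f := fun z p => η (z, p)) hη
  have hcenter : ∀ z ∈ GRT.boundaryUnion D, z ∈ B → (z, (0 : ℝ)) ∈ N →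
      X (0, yb z 0) = z ∧
      (∀ a, inner ℝ (GRT.unitNormal ρ z) (fderiv ℝ (fun u => X (u, yb z 0)) 0 a) = 0) ∧
      (∀ a b, GRT.formN Φ ρ (yb z 0) z (fderiv ℝ (fun u => X (u, yb z 0)) 0 a)
        (fderiv ℝ (fun u => X (u, yb z 0)) 0 b) = -(2 / ‖gradient ρ z‖ * inner ℝ a b)) ∧
      η (z, 0) = 0 ∧ q z 0 = ‖gradient ρ z‖ := by
    intro z hz hzB hzN
    have hzO : z ∈ O := (hBM hzB).2
    have hy : yb z 0 ∈ V₂ := hsV₂ (hybV _ _ (hNΩ hzN))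
    have h1 := hcontact z (hNΩ hzN).1.1 0 (hI _ hδ₀)
    obtain ⟨hzS, l, hl⟩ := (h1.2 _ h1.1).2 rfl
    rw [zero_smul, add_zero] at hzS hl
    have hl0 := GRT.ne_zero_of_isNormalAt hΦ (hV₁V h1.1) hzS hl
    obtain ⟨h2, h3, h4⟩ := hX.tangency hU hV hΦ.smooth hρ.isOpen hρ.smooth hρ0 (hBB₀ hzB) hy hzS.2
      hl0 hl
    refine ⟨h2, h3, h4, ?_, ?_⟩
    · rw [hηv _ hzN]
      change v (yb z 0) = 0
      rw [hX.apply_center hy, h2, hzero z hz hzO]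
    · have hline : Continuous fun p : ℝ => (z, p) := by fun_prop
      have hyd : DifferentiableAt ℝ (yb z) 0 :=
        (ContDiffAt.comp (0 : ℝ) (g := Function.uncurry yb) (f := fun p : ℝ => (z, p))
          (hyb.contDiffAt ((hW₀.prod isOpen_Ioo).mem_nhds (hNΩ hzN).1))
          (contDiff_const.prodMk contDiff_id).contDiffAt).differentiableAt (by simp)
      have h5 := hX.hasDerivAt_height hU hV hΦ.smooth hρ.isOpen hρ.smooth (hBB₀ hzB) (hρ0 z hzO)
        hyd hy h2 hl0 hl (by
          filter_upwards [isOpen_Ioo.mem_nhds (hI _ hδ₀)] with p hp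
          have h6 := hcontact z (hNΩ hzN).1.1 p hp
          exact ((h6.2 _ h6.1).2 rfl).1.2)
      have h6 : (fun p => η (z, p)) =ᶠ[𝓝 0] fun p => v (yb z p) := by
        filter_upwards [hline.continuousAt (hNo.mem_nhds hzN)] with p hp
        exact hηv _ hp
      rw [hq0, h6.deriv_eq, h5.deriv]
  have hqx : 0 < q x₀ 0 := by
    rw [(hcenter x₀ hx₀S hxB (hN0 rfl)).2.2.2.2]
    exact norm_pos_iff.2 (hρ0 _ hxO)
  -- Where `q > 0`, the positive part of `p q` is `p₊ q`. This positivity determines the final sizes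
  -- of `W` and `δ`.
  have hN' : N ∩ {w : GRT.Space × ℝ | 0 < q w.1 w.2} ∩ (Prod.fst ⁻¹' B) ∈ 𝓝 (x₀, (0 : ℝ)) := by
    have h1 : IsOpen {w : GRT.Space × ℝ | 0 < q w.1 w.2} :=
      isOpen_lt continuous_const hq.continuous
    exact ((hNo.inter h1).inter (hB.preimage continuous_fst)).mem_nhds ⟨⟨hN0 rfl, hqx⟩, hxB⟩
  obtain ⟨W', hW', I, hIn, hWI⟩ := mem_nhds_prod_iff.1 hN'
  obtain ⟨W, hWsub, hW, hxW⟩ := mem_nhds_iff.1 hW'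
  obtain ⟨δ, hδ, hδI⟩ := Metric.mem_nhds_iff.1 hIn
  rw [Real.ball_eq_Ioo, zero_sub, zero_add] at hδI
  have hWN : ∀ z ∈ W, ∀ p ∈ Ioo (-δ) δ, (z, p) ∈ N ∧ 0 < q z p ∧ z ∈ B := fun z hz p hp => by
    have h1 := hWI (mk_mem_prod (hWsub hz) (hδI hp))
    exact ⟨h1.1.1, h1.1.2, h1.2⟩
  have hδ0 := hI _ hδ
  have hsub : W ×ˢ Ioo (-δ) δ ⊆ W₀ ×ˢ Ioo (-δ₀) δ₀ := fun w hw =>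
    (hNΩ (hWN _ hw.1 _ hw.2).1).1
  have hybs : ContDiffOn ℝ ∞ (Function.uncurry yb) (W ×ˢ Ioo (-δ) δ) := hyb.mono hsub
  refine ⟨Metric.closedBall x₀ r₀, Metric.closedBall_mem_nhds x₀ hr₀, W, hW, hxW,
    fun z hz => hW₀O (hsub (mk_mem_prod hz hδ0)).1, δ, hδ, V₁, hV₁, hyV₁, hV₁V, yb, hybs, hyb0,
    fun z hz p hp => hcontact z (hsub (mk_mem_prod hz.2 hp)).1 p (hsub (mk_mem_prod hz.2 hp)).2,
    fun F hF hsupp => ?_⟩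
  obtain ⟨a, c, ha, hc, haB, hcB, hfac⟩ := GRT.exists_jump_decomposition hB hDb hsides
    (isCompact_closedBall x₀ r₀) hr₀B hF hsupp
  obtain ⟨A, hA, -, hAeq⟩ := hX.exists_density hb ha (haB.trans hBB₀) hsV₂
  obtain ⟨C, hC, hCc, hCeq⟩ := hX.exists_density hb hc (hcB.trans hBB₀) hsV₂
  obtain ⟨H, hH, hHdisc, hH0⟩ := GRT.exists_contDiff_integral_disc hC hCc
  have hG₁ : ContDiff ℝ ∞ fun y => ∫ u in Metric.ball (0 : GRT.Plane) r, A (u, y) :=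
    GRT.contDiff_setIntegral_param (f := fun y u => A (u, y))
      (hA.comp (contDiff_snd.prodMk contDiff_fst)) Metric.isBounded_ball
      Metric.isOpen_ball.measurableSet
  -- The disc integral `v₊ H(v, y)` with `v = p q` gives `G = q H`; the integral of the continuous
  -- part `a` over the whole chart is `G₁`, and `c` restricts to the jump.
  refine ⟨fun z p => q z p * H (η (z, p), yb z p),
    fun z p => ∫ u in Metric.ball (0 : GRT.Plane) r, A (u, yb z p), c, ?_, ?_, ?_, ?_⟩
  · exact hq.contDiffOn.mul (hH.comp_contDiffOn (hη.contDiffOn.prodMk hybs))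
  · exact hG₁.comp_contDiffOn hybs
  · rintro z ⟨hzS, hzW⟩ p hp
    obtain ⟨hzN, hqpos, hzB⟩ := hWN z hzW p hp
    have hy := hybV _ _ (hNΩ hzN)
    have hslice : Continuous fun u : GRT.Plane => (u, yb z p) := by fun_prop
    obtain ⟨h1, h2⟩ := hX.radon_eq hU hΦ.smooth (b := b) hBB₀
      (fun x hx => image_eq_zero_of_notMem_tsupport fun h => hx (hr₀B (hsupp h)))
      (fun x hx => image_eq_zero_of_notMem_tsupport fun h => hx (haB h))
      (fun x hx => image_eq_zero_of_notMem_tsupport fun h => hx (hcB h)) hfac (hsV₂ hy)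
      (hA.continuous.comp hslice) (hC.continuous.comp hslice) (hAeq _ hy).1 (hCeq _ hy).1
      (hCeq _ hy).2
    refine ⟨h1, h2.trans ?_⟩
    have h3 : η (z, p) = p * q z p := by
      have h4 := hηq z p
      simp only [smul_eq_mul] at h4
      rw [h4, (hcenter z hzS hzB (hWN z hzW 0 hδ0).1).2.2.2.1, zero_add]
    have h5 : v (yb z p) = η (z, p) := (hηv _ hzN).symm
    have h6 : max (η (z, p)) 0 = max p 0 * q z p := by
      rw [h3, max_mul_of_nonneg _ _ hqpos.le, zero_mul]
    have h7 := hHdisc (v (yb z p)) (yb z p) (le_of_lt (hsV hy).2)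
    simp only [Function.comp_apply]
    rw [h7, h5, h6]
    ring
  · rintro z ⟨hzS, hzW⟩
    obtain ⟨hzN, -, hzB⟩ := hWN z hzW 0 hδ0
    have hzO : z ∈ O := (hBM hzB).2
    have hg := norm_pos_iff.2 (hρ0 z hzO)
    have hy := hybV _ _ (hNΩ hzN)
    obtain ⟨h1, h2, h3, h4, h5⟩ := hcenter z hzS hzB hzN
    refine ⟨GRT.tendsto_jump ((hρ.smooth.contDiffAt (hρ.isOpen.mem_nhds hzO)).differentiableAt
      (by simp)) (hρ0 z hzO) (hzero z hzS hzO) ha.continuous hc.continuous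
      (by filter_upwards [hB.mem_nhds hzB] with x hx using hfac x hx), fun e he hne => ?_⟩
    have himm := hX.immersion _ (hsV₂ hy) 0 hX.zero_mem
    obtain ⟨h6, h7, h8⟩ := GRT.matrixN_of_conformal himm (GRT.norm_unitNormal (hρ0 z hzO)) h2
      (div_pos two_pos hg) h3 he hne
    refine ⟨h6, h7, ?_⟩
    -- With `J` the area factor at the center, `q = |∇ρ|`, `H = π J b c` and `√det N = (2/|∇ρ|)/J`
    -- combine to the stated value.
    have h9 := (hCeq _ hy).1 0 hX.zero_mem
    change q z 0 * H (η (z, 0), yb z 0) = _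
    rw [h8, h5, h4, hH0, h9, h1]
    field_simp
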